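/- All algebras are associative algebras over $\mathbb{C}$, not necessarily unital. The product of an algebra $B$ is *non-degenerate* if $b=0$ whenever $bc=0$ for all $c\in B$ or $cb=0$ for all $c\in B$; $M(B)$ denotes the multiplier algebra. Let $(A,\Delta)$ be a regular weak multiplier Hopf algebra. That is, first, $(A,\Delta)$ is a weak multiplier Hopf algebra: $A$ is an idempotent algebra with non-degenerate product, and $\Delta:A\to M(A\otimes A)$ is a full coproduct (a homomorphism with $\Delta(a)(1\otimes b)\in A\otimes A$ and $(a\otimes 1)\Delta(b)\in A\otimes A$ for all $a,b\in A$, which is coassociative) that admits a counit, such that: 1. there is an idempotent $E\in M(A\otimes A)$ with $E(A\otimes A)=T_1(A\otimes A)$ and $(A\otimes A)E=T_2(A\otimes A)$, where $T_1(a\otimes b)=\Delta(a)(1\otimes b)$ and $T_2(a\otimes b)=(a\otimes 1)\Delta(b)$; 2. $(\iota\otimes\Delta)E=(E\otimes 1)(1\otimes E)=(1\otimes E)(E\otimes 1)$, where $\iota\otimes\Delta$ is extended to $M(A\otimes A)$ with value $1\otimes E$ at $1$; 3. $\ker T_i=(1-G_i)(A\otimes A)$ for $i=1,2$, where $G_1,G_2$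 are the linear maps on $A\otimes A$ given by $(G_1\otimes\iota)(\Delta_{13}(a)(1\otimes b\otimes c))=\Delta_{13}(a)(1\otimes E)(1\otimes b\otimes c)$ and $(\iota\otimes G_2)((a\otimes b\otimes 1)\Delta_{13}(c))=(a\otimes b\otimes 1)(E\otimes 1)\Delta_{13}(c)$. Second, regularity means that also $\Delta(a)(b\otimes 1)$ and $(1\otimes a)\Delta(b)$ lie in $A\otimes A$ for all $a,b\in A$, and $(A,\Delta^{\mathrm{cop}})$ is a weak multiplier Hopf algebra. Let $E\in M(A\otimes A)$ be the canonical idempotent, i.e. the (unique) idempotent as in 1. Let $R$ be a left $A$-module algebra: an algebra with non-degenerate product which is a left $A$-module with $A\rhd R=R$, such that $a\rhd(xy)=\sum(a_{(1)}\rhd x)(a_{(2)}\rhd y)$ for all $a\in A$, $x,y\in R$, i.e. $a\rhd(xy)=m(\Delta(a)\rhd(x\otimes y))$, where $m$ is the product of $R$ and $M(A\otimes A)$ acts on $R\otimes R$ by the extension of the action $(a\otimes b)\rhd(x\otimes y)=(a\rhd x)\otimes(b\rhd y)$ of $A\otimes A$. Denote by $R\#A$ the space $R\otimes A$ with the product $$(r\otimes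 a)(s\otimes b)=\sum r(a_{(1)}\rhd s)\otimes a_{(2)}b ,\qquad \sum a_{(1)}\otimes a_{(2)}b:=\Delta(a)(1\otimes b)\in A\otimes A .$$ Then: * (i) the product of $R\#A$ is associative; * (ii) the action $(p\otimes q)\rhd(r\otimes a)=(p\rhd r)\otimes qa$ of $A\otimes A$ on $R\# A$ extends to $M(A\otimes A)$ by $m\rhd(t\rhd x)=(mt)\rhd x$ for $m\in M(A\otimes A)$, $t\in A\otimes A$, $x\in R\#A$, and for all $x,y\in R\#A$ $$(E\rhd x)y=xy=x(E\rhd y),\qquad E\rhd(xy)=(E\rhd x)y ;$$ * (iii) the subspace $R\#_EA:=E\rhd(R\#A)$ is a subalgebra and a right ideal of $R\#A$; * (iv) the product of the algebra $R\#_EA$ is non-degenerate. -/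

import Mathlib

open scoped TensorProduct

noncomputable section

namespace WMHA

section Multipliers

variable (A : Type*) [NonUnitalRing A] [Module ℂ A] [IsScalarTower ℂ A A] [SMulCommClass ℂ A A]

/-- The product of `A` is non-degenerate. -/
def IsNondegenerateAlgebra : Prop :=
  (∀ a : A, (∀ b : A, a * b = 0) → a = 0) ∧ (∀ a : A, (∀ b : A, b * a = 0) → a = 0)

/-- `A² = A`. -/
def IsIdempotentAlgebra : Prop :=
  Submodule.span ℂ {x : A | ∃ a b : A, x = a * b} = ⊤

/-- The multiplier algebra `M(A)`: pairs `(l, r)` of linear maps with `l(ab) = l(a)b`,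
`r(ab) = a r(b)` and `r(a)b = a l(b)`. Left multipliers are multiplied by composition, right
multipliers by composition in the opposite order. -/
def multiplierAlgebra : Subalgebra ℂ (Module.End ℂ A × (Module.End ℂ A)ᵐᵒᵖ) where
  carrier := {m | (∀ a b, m.1 (a * b) = m.1 a * b) ∧
    (∀ a b, m.2.unop (a * b) = a * m.2.unop b) ∧ (∀ a b, m.2.unop a * b = a * m.1 b)}
  mul_mem' := by
    rintro m n ⟨h1, h2, h3⟩ ⟨k1, k2, k3⟩
    exact ⟨fun a b => by simp [h1, k1], fun a b => by simp [h2, k2], fun a b => by simp [h3, k3]⟩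
  add_mem' := by
    rintro m n ⟨h1, h2, h3⟩ ⟨k1, k2, k3⟩
    exact ⟨fun a b => by simp [h1, k1, add_mul], fun a b => by simp [h2, k2, mul_add],
      fun a b => by simp [h3, k3, add_mul, mul_add]⟩
  algebraMap_mem' := by
    intro c
    refine ⟨fun a b => ?_, fun a b => ?_, fun a b => ?_⟩ <;>
      simp [Module.algebraMap_end_apply, smul_mul_assoc, mul_smul_comm]

/-- `M(A)`. -/
abbrev Multiplier : Type _ := ↥(multiplierAlgebra A)

variable {A}

/-- `m · a`. -/
def Multiplier.left (m : Multiplier A) : A →ₗ[ℂ] A := m.1.1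

/-- `a · m`, as a function of `a`. -/
def Multiplier.right (m : Multiplier A) : A →ₗ[ℂ] A := m.1.2.unop

/-- The canonical map `A → M(A)`. -/
def embed : A →ₗ[ℂ] Multiplier A where
  toFun a := ⟨(LinearMap.mulLeft ℂ a, MulOpposite.op (LinearMap.mulRight ℂ a)),
    fun b c => by simp [mul_assoc], fun b c => by simp [mul_assoc],
    fun b c => by simp [mul_assoc]⟩
  map_add' a b := by
    apply Subtype.ext; apply Prod.ext
    · ext x; simp [add_mul]
    · apply MulOpposite.unop_injective; ext x; simp [mul_add]
  map_smul' c a := by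
    apply Subtype.ext; apply Prod.ext
    · ext x; simp [smul_mul_assoc]
    · apply MulOpposite.unop_injective; ext x; simp [mul_smul_comm]

open Classical in
/-- A linear left inverse of `A → M(A)` (for non-degenerate `A`). It is only meant to be applied
to multipliers that lie in the image of `A`, where it gives the element they come from. -/
def unembed : Multiplier A →ₗ[ℂ] A :=
  if h : LinearMap.ker (embed : A →ₗ[ℂ] Multiplier A) = ⊥ then
    (LinearMap.exists_leftInverse_of_injective _ h).choose
  else 0

theorem embed_unembed (hA : IsNondegenerateAlgebra A) {m : Multiplier A}
    (hm : m ∈ LinearMap.range (embed : A →ₗ[ℂ] Multiplier A)) : embed (unembed m) = m := by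
  have h : LinearMap.ker (embed : A →ₗ[ℂ] Multiplier A) = ⊥ := by
    rw [LinearMap.ker_eq_bot']
    intro a ha
    refine hA.1 a fun b => ?_
    have := congrArg (fun m : Multiplier A => m.left b) ha
    simpa [Multiplier.left, embed] using this
  obtain ⟨a, rfl⟩ := hm
  rw [unembed, dif_pos h]
  have := LinearMap.congr_fun (LinearMap.exists_leftInverse_of_injective _ h).choose_spec a
  rw [LinearMap.comp_apply, LinearMap.id_apply] at this
  rw [this]

variable {B : Type*} [NonUnitalRing B] [Module ℂ B] [IsScalarTower ℂ B B] [SMulCommClass ℂ B B]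

/-- `M(A) ⊗ M(B) ⊆ M(A ⊗ B)`: the multiplier `m ⊗ n`. -/
def tens : Multiplier A →ₗ[ℂ] Multiplier B →ₗ[ℂ] Multiplier (A ⊗[ℂ] B) :=
  LinearMap.mk₂ ℂ
    (fun m n => ⟨(TensorProduct.map m.left n.left,
        MulOpposite.op (TensorProduct.map m.right n.right)), by
      obtain ⟨m, h1, h2, h3⟩ := m
      obtain ⟨n, k1, k2, k3⟩ := n
      refine ⟨fun a b => ?_, fun a b => ?_, fun a b => ?_⟩ <;>
      · induction a using TensorProduct.induction_on with
        | zero => simp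
        | add x y hx hy => simp only [add_mul, map_add, hx, hy]
        | tmul x y =>
          induction b using TensorProduct.induction_on with
          | zero => simp
          | add x y hx hy => simp only [mul_add, map_add, hx, hy]
          | tmul z w =>
            simp [Multiplier.left, Multiplier.right, h1, h2, h3, k1, k2, k3]⟩)
    (fun m m' n => by
      apply Subtype.ext; apply Prod.ext
      · exact TensorProduct.map_add_left _ _ _
      · exact MulOpposite.unop_injective (TensorProduct.map_add_left _ _ _))
    (fun c m n => by
      apply Subtype.ext; apply Prod.ext
      · exact TensorProduct.map_smul_left _ _ _
      · exact MulOpposite.unop_injective (TensorProduct.map_smul_left _ _ _))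
    (fun m n n' => by
      apply Subtype.ext; apply Prod.ext
      · exact TensorProduct.map_add_right _ _ _
      · exact MulOpposite.unop_injective (TensorProduct.map_add_right _ _ _))
    (fun c m n => by
      apply Subtype.ext; apply Prod.ext
      · exact TensorProduct.map_smul_right _ _ _
      · exact MulOpposite.unop_injective (TensorProduct.map_smul_right _ _ _))

/-- The isomorphism `M(A) → M(B)` induced by an isomorphism of algebras `e : A → B`. -/
def transport (e : A ≃ₗ[ℂ] B) (he : ∀ x y, e (x * y) = e x * e y) :
    Multiplier A →ₐ[ℂ] Multiplier B where
  toFun m := ⟨(e.toLinearMap ∘ₗ m.left ∘ₗ e.symm.toLinearMap,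
      MulOpposite.op (e.toLinearMap ∘ₗ m.right ∘ₗ e.symm.toLinearMap)), by
    have he' : ∀ x y, e.symm (x * y) = e.symm x * e.symm y := fun x y => by
      apply e.injective; simp [he]
    obtain ⟨m, h1, h2, h3⟩ := m
    refine ⟨fun a b => ?_, fun a b => ?_, fun a b => ?_⟩
    · simp [Multiplier.left, he', h1, he]
    · simp [Multiplier.right, he', h2, he]
    · have := congrArg e (h3 (e.symm a) (e.symm b))
      simpa [Multiplier.left, Multiplier.right, he] using this⟩
  map_one' := by
    apply Subtype.ext; apply Prod.ext
    · ext x; simp [Multiplier.left]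
    · apply MulOpposite.unop_injective; ext x; simp [Multiplier.right]
  map_mul' m n := by
    apply Subtype.ext; apply Prod.ext
    · ext x; simp [Multiplier.left]
    · apply MulOpposite.unop_injective; ext x; simp [Multiplier.right]
  map_zero' := by
    apply Subtype.ext; apply Prod.ext
    · ext x; simp [Multiplier.left]
    · apply MulOpposite.unop_injective; ext x; simp [Multiplier.right]
  map_add' m n := by
    apply Subtype.ext; apply Prod.ext
    · ext x; simp [Multiplier.left]
    · apply MulOpposite.unop_injective; ext x; simp [Multiplier.right]
  commutes' c := by
    apply Subtype.ext; apply Prod.ext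
    · ext x; simp [Multiplier.left, Module.algebraMap_end_apply]
    · apply MulOpposite.unop_injective; ext x
      simp [Multiplier.right, Module.algebraMap_end_apply]

end Multipliers

section Coproducts

variable {A : Type*} [NonUnitalRing A] [Module ℂ A] [IsScalarTower ℂ A A] [SMulCommClass ℂ A A]

theorem assoc_mul (x y : (A ⊗[ℂ] A) ⊗[ℂ] A) :
    TensorProduct.assoc ℂ A A A (x * y) =
      TensorProduct.assoc ℂ A A A x * TensorProduct.assoc ℂ A A A y := by
  have h : (LinearMap.mul ℂ _).compr₂ (TensorProduct.assoc ℂ A A A).toLinearMap =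
      (LinearMap.mul ℂ _).compl₁₂ (TensorProduct.assoc ℂ A A A).toLinearMap
        (TensorProduct.assoc ℂ A A A).toLinearMap := by
    ext; simp
  exact LinearMap.congr_fun₂ h x y

theorem comm_mul (x y : A ⊗[ℂ] A) :
    TensorProduct.comm ℂ A A (x * y) =
      TensorProduct.comm ℂ A A x * TensorProduct.comm ℂ A A y := by
  have h : (LinearMap.mul ℂ _).compr₂ (TensorProduct.comm ℂ A A).toLinearMap =
      (LinearMap.mul ℂ _).compl₁₂ (TensorProduct.comm ℂ A A).toLinearMap
        (TensorProduct.comm ℂ A A).toLinearMap := by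
    ext; simp
  exact LinearMap.congr_fun₂ h x y

/-- The isomorphism `(A ⊗ A) ⊗ A → A ⊗ (A ⊗ A)`, `(p ⊗ q) ⊗ b ↦ p ⊗ (b ⊗ q)`. -/
def leg13 : (A ⊗[ℂ] A) ⊗[ℂ] A ≃ₗ[ℂ] A ⊗[ℂ] (A ⊗[ℂ] A) :=
  (TensorProduct.assoc ℂ A A A).trans
    (TensorProduct.congr (LinearEquiv.refl ℂ A) (TensorProduct.comm ℂ A A))

theorem leg13_mul (x y : (A ⊗[ℂ] A) ⊗[ℂ] A) : leg13 (x * y) = leg13 x * leg13 y := by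
  have h : (LinearMap.mul ℂ _).compr₂ (leg13 (A := A)).toLinearMap =
      (LinearMap.mul ℂ _).compl₁₂ (leg13 (A := A)).toLinearMap
        (leg13 (A := A)).toLinearMap := by
    ext; simp [leg13]
  exact LinearMap.congr_fun₂ h x y

variable (Δ : A →ₙₐ[ℂ] Multiplier (A ⊗[ℂ] A))

/-- The canonical map `T₁(a ⊗ b) = Δ(a)(1 ⊗ b)`. -/
def T₁ : A ⊗[ℂ] A →ₗ[ℂ] A ⊗[ℂ] A :=
  TensorProduct.lift ((LinearMap.mul ℂ (Multiplier (A ⊗[ℂ] A))).compl₁₂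
    (Δ : A →ₗ[ℂ] Multiplier (A ⊗[ℂ] A)) (tens (1 : Multiplier A) ∘ₗ embed) |>.compr₂ unembed)

/-- The canonical map `T₂(a ⊗ b) = (a ⊗ 1)Δ(b)`. -/
def T₂ : A ⊗[ℂ] A →ₗ[ℂ] A ⊗[ℂ] A :=
  TensorProduct.lift ((LinearMap.mul ℂ (Multiplier (A ⊗[ℂ] A))).compl₁₂
    ((tens : Multiplier A →ₗ[ℂ] Multiplier A →ₗ[ℂ] _).flip 1 ∘ₗ embed)
    (Δ : A →ₗ[ℂ] Multiplier (A ⊗[ℂ] A)) |>.compr₂ unembed)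

theorem T₁_tmul (a b : A) : T₁ Δ (a ⊗ₜ b) = unembed (Δ a * tens 1 (embed b)) := rfl

theorem T₂_tmul (a b : A) : T₂ Δ (a ⊗ₜ b) = unembed (tens (embed a) 1 * Δ b) := rfl

/-- `Δ ⊗ ι : A ⊗ A → M(A ⊗ A ⊗ A)`. -/
def coprodTensorId : A ⊗[ℂ] A →ₗ[ℂ] Multiplier (A ⊗[ℂ] (A ⊗[ℂ] A)) :=
  (transport (TensorProduct.assoc ℂ A A A) assoc_mul).toLinearMap ∘ₗ
    TensorProduct.lift (tens.compl₁₂ (Δ : A →ₗ[ℂ] Multiplier (A ⊗[ℂ] A)) embed)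

/-- `ι ⊗ Δ : A ⊗ A → M(A ⊗ A ⊗ A)`. -/
def idTensorCoprod : A ⊗[ℂ] A →ₗ[ℂ] Multiplier (A ⊗[ℂ] (A ⊗[ℂ] A)) :=
  TensorProduct.lift (tens.compl₁₂ embed (Δ : A →ₗ[ℂ] Multiplier (A ⊗[ℂ] A)))

/-- `Δ` is a coproduct on the (non-degenerate) algebra `A`. -/
structure IsCoproduct : Prop where
  covered_right : ∀ a b : A,
    Δ a * tens 1 (embed b) ∈ LinearMap.range (embed : A ⊗[ℂ] A →ₗ[ℂ] _)
  covered_left : ∀ a b : A,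
    tens (embed a) 1 * Δ b ∈ LinearMap.range (embed : A ⊗[ℂ] A →ₗ[ℂ] _)
  coassoc : ∀ a b c : A,
    tens (embed c) 1 * coprodTensorId Δ (T₁ Δ (a ⊗ₜ b)) =
      idTensorCoprod Δ (T₂ Δ (c ⊗ₜ a)) * tens 1 (tens 1 (embed b))

/-- The coproduct is full: the only subspaces `V`, `W` of `A` with `Δ(A)(1 ⊗ A) ⊆ V ⊗ A` and
`(A ⊗ 1)Δ(A) ⊆ A ⊗ W` are `V = A` and `W = A`. -/
def IsFull : Prop :=
  (∀ V : Submodule ℂ A,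
    LinearMap.range (T₁ Δ) ≤ LinearMap.range (LinearMap.rTensor A V.subtype) → V = ⊤) ∧
  (∀ W : Submodule ℂ A,
    LinearMap.range (T₂ Δ) ≤ LinearMap.range (LinearMap.lTensor A W.subtype) → W = ⊤)

/-- `ε` is a counit for `Δ`. -/
def IsCounit (ε : A →ₗ[ℂ] ℂ) : Prop :=
  (∀ a b : A, TensorProduct.lid ℂ A (LinearMap.rTensor A ε (T₁ Δ (a ⊗ₜ b))) = a * b) ∧
  (∀ a b : A, TensorProduct.rid ℂ A (LinearMap.lTensor A ε (T₂ Δ (a ⊗ₜ b))) = a * b)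

/-- `E` is an idempotent giving the ranges of the canonical maps:
`E(A ⊗ A) = T₁(A ⊗ A)` and `(A ⊗ A)E = T₂(A ⊗ A)`. There is at most one such `E`. -/
structure IsCanonicalIdempotent (E : Multiplier (A ⊗[ℂ] A)) : Prop where
  idem : E * E = E
  range_left : LinearMap.range E.left = LinearMap.range (T₁ Δ)
  range_right : LinearMap.range E.right = LinearMap.range (T₂ Δ)

/-- `n` is the value at `m ∈ M(B)` of the extension to `M(B)` of a homomorphism `φ : B → M(C)`,
where the extension is normalized to have the value `e` at `1`. (If
`φ(B)C = eC` and `Cφ(B) = Ce`, then `n` is determined by these conditions.) -/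
def IsExtensionValue {B C : Type*}
    [NonUnitalRing B] [Module ℂ B] [IsScalarTower ℂ B B] [SMulCommClass ℂ B B]
    [NonUnitalRing C] [Module ℂ C] [IsScalarTower ℂ C C] [SMulCommClass ℂ C C]
    (φ : B →ₗ[ℂ] Multiplier C) (e : Multiplier C) (m : Multiplier B) (n : Multiplier C) : Prop :=
  e * n = n ∧ n * e = n ∧
    (∀ x, n * φ x = φ (m.left x)) ∧ (∀ x, φ x * n = φ (m.right x))

/-- `E ⊗ 1` in `M(A ⊗ A ⊗ A)`. -/
def tensOne (E : Multiplier (A ⊗[ℂ] A)) : Multiplier (A ⊗[ℂ] (A ⊗[ℂ] A)) :=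
  transport (TensorProduct.assoc ℂ A A A) assoc_mul (tens E 1)

/-- `1 ⊗ E` in `M(A ⊗ A ⊗ A)`. -/
def oneTens (E : Multiplier (A ⊗[ℂ] A)) : Multiplier (A ⊗[ℂ] (A ⊗[ℂ] A)) := tens 1 E

/-- `Δ₁₃(a)` in `M(A ⊗ A ⊗ A)`. -/
def coprod13 (a : A) : Multiplier (A ⊗[ℂ] (A ⊗[ℂ] A)) := transport leg13 leg13_mul (tens (Δ a) 1)

/-- `G ⊗ ι` on `A ⊗ A ⊗ A`. -/
def onLegs12 (G : A ⊗[ℂ] A →ₗ[ℂ] A ⊗[ℂ] A) : A ⊗[ℂ] (A ⊗[ℂ] A) →ₗ[ℂ] A ⊗[ℂ] (A ⊗[ℂ] A) :=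
  (TensorProduct.assoc ℂ A A A).toLinearMap ∘ₗ LinearMap.rTensor A G ∘ₗ
    (TensorProduct.assoc ℂ A A A).symm.toLinearMap

/-- `(G₁ ⊗ ι)(Δ₁₃(a)(1 ⊗ b ⊗ c)) = Δ₁₃(a)(1 ⊗ E)(1 ⊗ b ⊗ c)`; the element
`Δ₁₃(a)(1 ⊗ b ⊗ c)` of `A ⊗ A ⊗ A` is `Δ(a)(1 ⊗ c)` in the legs 1, 3 and `b` in the leg 2. -/
def IsG₁ (E : Multiplier (A ⊗[ℂ] A)) (G : A ⊗[ℂ] A →ₗ[ℂ] A ⊗[ℂ] A) : Prop :=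
  ∀ a b c : A, embed (onLegs12 G (leg13 (T₁ Δ (a ⊗ₜ c) ⊗ₜ b))) =
    coprod13 Δ a * oneTens E * tens 1 (tens (embed b) (embed c))

/-- `(ι ⊗ G₂)((a ⊗ b ⊗ 1)Δ₁₃(c)) = (a ⊗ b ⊗ 1)(E ⊗ 1)Δ₁₃(c)`; the element
`(a ⊗ b ⊗ 1)Δ₁₃(c)` of `A ⊗ A ⊗ A` is `(a ⊗ 1)Δ(c)` in the legs 1, 3 and `b` in the leg 2. -/
def IsG₂ (E : Multiplier (A ⊗[ℂ] A)) (G : A ⊗[ℂ] A →ₗ[ℂ] A ⊗[ℂ] A) : Prop :=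
  ∀ a b c : A, embed (LinearMap.lTensor A G (leg13 (T₂ Δ (a ⊗ₜ c) ⊗ₜ b))) =
    tens (embed a) (tens (embed b) 1) * tensOne E * coprod13 Δ c

/-- `(A, Δ)` is a weak multiplier Hopf algebra. -/
structure IsWeakMultiplierHopfAlgebra : Prop where
  nondegenerate : IsNondegenerateAlgebra A
  idempotent : IsIdempotentAlgebra A
  coproduct : IsCoproduct Δ
  full : IsFull Δ
  counit : ∃ ε : A →ₗ[ℂ] ℂ, IsCounit Δ ε
  canonical : ∃ E : Multiplier (A ⊗[ℂ] A), IsCanonicalIdempotent Δ E ∧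
    -- `(ι ⊗ Δ)E = (E ⊗ 1)(1 ⊗ E) = (1 ⊗ E)(E ⊗ 1)`
    IsExtensionValue (idTensorCoprod Δ) (oneTens E) E (tensOne E * oneTens E) ∧
    tensOne E * oneTens E = oneTens E * tensOne E ∧
    (∃ G₁, IsG₁ Δ E G₁ ∧ LinearMap.ker (T₁ Δ) = LinearMap.range (LinearMap.id - G₁)) ∧
    (∃ G₂, IsG₂ Δ E G₂ ∧ LinearMap.ker (T₂ Δ) = LinearMap.range (LinearMap.id - G₂))

/-- The opposite coproduct `Δ^cop`. -/
def cop : A →ₙₐ[ℂ] Multiplier (A ⊗[ℂ] A) :=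
  (transport (TensorProduct.comm ℂ A A) comm_mul : _ →ₙₐ[ℂ] _).comp Δ

/-- `(A, Δ)` is a regular weak multiplier Hopf algebra. -/
structure IsRegularWeakMultiplierHopfAlgebra : Prop where
  weak : IsWeakMultiplierHopfAlgebra Δ
  regular_left : ∀ a b : A,
    Δ a * tens (embed b) 1 ∈ LinearMap.range (embed : A ⊗[ℂ] A →ₗ[ℂ] _)
  regular_right : ∀ a b : A,
    tens 1 (embed a) * Δ b ∈ LinearMap.range (embed : A ⊗[ℂ] A →ₗ[ℂ] _)
  weak_cop : IsWeakMultiplierHopfAlgebra (cop Δ)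

end Coproducts

section Modules

variable {B : Type*} [NonUnitalRing B] [Module ℂ B] [IsScalarTower ℂ B B] [SMulCommClass ℂ B B]
  {V : Type*} [AddCommGroup V] [Module ℂ V]

/-- The left `B`-module `V` is unital: `BV = V`. -/
def IsUnitalModule (ρ : B →ₙₐ[ℂ] Module.End ℂ V) : Prop :=
  Submodule.span ℂ {x : V | ∃ b v, x = ρ b v} = ⊤

open Classical in
/-- The action of `M(B)` that extends the action of `B` on a unital, non-degenerate module `V`:
`m(bv) = (mb)v`. -/
def extendedAction (ρ : B →ₙₐ[ℂ] Module.End ℂ V) (m : Multiplier B) : Module.End ℂ V :=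
  if h : ∃ f : Module.End ℂ V, ∀ b v, f (ρ b v) = ρ (m.left b) v then h.choose else 0

theorem extendedAction_apply (ρ : B →ₙₐ[ℂ] Module.End ℂ V) (hu : IsUnitalModule ρ)
    (hn : ∀ v, (∀ b, ρ b v = 0) → v = 0) (m : Multiplier B) (b : B) (v : V) :
    extendedAction ρ m (ρ b v) = ρ (m.left b) v := by
  have h : ∃ f : Module.End ℂ V, ∀ b v, f (ρ b v) = ρ (m.left b) v := by
    let p : B ⊗[ℂ] V →ₗ[ℂ] V := TensorProduct.lift (ρ : B →ₗ[ℂ] Module.End ℂ V)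
    let q : B ⊗[ℂ] V →ₗ[ℂ] V := p ∘ₗ LinearMap.rTensor V m.left
    have hp : LinearMap.range p = ⊤ := by
      rw [eq_top_iff, ← hu, Submodule.span_le]
      rintro _ ⟨b, v, rfl⟩
      exact ⟨b ⊗ₜ v, rfl⟩
    have key : ∀ c t, ρ c (q t) = ρ (m.right c) (p t) := by
      intro c t
      induction t using TensorProduct.induction_on with
      | zero => simp
      | add x y hx hy => simp only [map_add, hx, hy]
      | tmul b v =>
        change ρ c (ρ (m.left b) v) = ρ (m.right c) (ρ b v)
        rw [← Module.End.mul_apply, ← map_mul, ← Module.End.mul_apply, ← map_mul]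
        exact congrArg (fun x => ρ x v) (m.2.2.2 c b).symm
    obtain ⟨s, hs⟩ := p.exists_rightInverse_of_surjective hp
    refine ⟨q ∘ₗ s, fun b v => ?_⟩
    have : q (s (ρ b v)) - q (b ⊗ₜ v) = 0 := by
      refine hn _ fun c => ?_
      have h1 : p (s (ρ b v)) = ρ b v := LinearMap.congr_fun hs _
      rw [map_sub, key, key, h1]
      exact sub_self _
    exact sub_eq_zero.1 this
  rw [extendedAction, dif_pos h]
  exact h.choose_spec b v

variable {C : Type*} [NonUnitalRing C] [Module ℂ C] [IsScalarTower ℂ C C] [SMulCommClass ℂ C C]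
  {W : Type*} [AddCommGroup W] [Module ℂ W]

/-- The action of `B ⊗ C` on `V ⊗ W`: `(b ⊗ c)(v ⊗ w) = bv ⊗ cw`. -/
def tensorAction (ρ : B →ₙₐ[ℂ] Module.End ℂ V) (σ : C →ₙₐ[ℂ] Module.End ℂ W) :
    B ⊗[ℂ] C →ₙₐ[ℂ] Module.End ℂ (V ⊗[ℂ] W) :=
  { TensorProduct.homTensorHomMap (RingHom.id ℂ) V W V W ∘ₗ
      TensorProduct.map (ρ : B →ₗ[ℂ] Module.End ℂ V) (σ : C →ₗ[ℂ] Module.End ℂ W) with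
    map_zero' := map_zero _
    map_mul' := fun x y => by
      change (TensorProduct.homTensorHomMap (RingHom.id ℂ) V W V W ∘ₗ
          TensorProduct.map (ρ : B →ₗ[ℂ] Module.End ℂ V) (σ : C →ₗ[ℂ] Module.End ℂ W)) (x * y) =
        (TensorProduct.homTensorHomMap (RingHom.id ℂ) V W V W ∘ₗ
          TensorProduct.map (ρ : B →ₗ[ℂ] Module.End ℂ V) (σ : C →ₗ[ℂ] Module.End ℂ W)) x *
        (TensorProduct.homTensorHomMap (RingHom.id ℂ) V W V W ∘ₗ
          TensorProduct.map (ρ : B →ₗ[ℂ] Module.End ℂ V) (σ : C →ₗ[ℂ] Module.End ℂ W)) y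
      induction x using TensorProduct.induction_on with
      | zero => simp
      | add x x' hx hx' => simp only [add_mul, map_add, hx, hx']
      | tmul b c =>
        induction y using TensorProduct.induction_on with
        | zero => simp
        | add y y' hy hy' => simp only [mul_add, map_add, hy, hy']
        | tmul b' c' =>
          ext v w
          simp }

theorem tensorAction_tmul (ρ : B →ₙₐ[ℂ] Module.End ℂ V) (σ : C →ₙₐ[ℂ] Module.End ℂ W)
    (b : B) (c : C) (v : V) (w : W) :
    tensorAction ρ σ (b ⊗ₜ c) (v ⊗ₜ w) = ρ b v ⊗ₜ σ c w := rfl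

/-- The action of `B` on itself by left multiplication. -/
def leftRegular : B →ₙₐ[ℂ] Module.End ℂ B := NonUnitalAlgHom.lmul ℂ B

end Modules

section Smash

variable {A : Type*} [NonUnitalRing A] [Module ℂ A] [IsScalarTower ℂ A A] [SMulCommClass ℂ A A]
  {R : Type*} [NonUnitalRing R] [Module ℂ R] [IsScalarTower ℂ R R] [SMulCommClass ℂ R R]

/-- `R`, with the action `act` of `A`, is a left `A`-module algebra: a unital left `A`-module with
`a ▷ (xy) = m(Δ(a) ▷ (x ⊗ y))`, where `m` is the product of `R`. -/
structure IsModuleAlgebra (Δ : A →ₙₐ[ℂ] Multiplier (A ⊗[ℂ] A))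
    (act : A →ₙₐ[ℂ] Module.End ℂ R) : Prop where
  unital : IsUnitalModule act
  act_mul : ∀ (a : A) (x y : R), act a (x * y) =
    LinearMap.mul' ℂ R (extendedAction (tensorAction act act) (Δ a) (x ⊗ₜ y))

/-- The linear map `(r ⊗ s) ⊗ (p ⊗ q) ↦ r(p ▷ s) ⊗ q`. -/
def smashAux (act : A →ₙₐ[ℂ] Module.End ℂ R) :
    (R ⊗[ℂ] R) ⊗[ℂ] (A ⊗[ℂ] A) →ₗ[ℂ] R ⊗[ℂ] A :=
  TensorProduct.lift (TensorProduct.lift (LinearMap.mk₂ ℂ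
    (fun r s => LinearMap.rTensor A
      (LinearMap.mulLeft ℂ r ∘ₗ (act : A →ₗ[ℂ] Module.End ℂ R).flip s))
    (fun r r' s => by ext; simp [add_mul, TensorProduct.add_tmul])
    (fun c r s => by ext; simp [smul_mul_assoc, TensorProduct.smul_tmul'])
    (fun r s s' => by ext; simp [mul_add, TensorProduct.add_tmul])
    (fun c r s => by ext; simp [TensorProduct.smul_tmul'])))

/-- The product of `R # A`: `(r ⊗ a)(s ⊗ b) = ∑ r(a₍₁₎ ▷ s) ⊗ a₍₂₎b`, where
`∑ a₍₁₎ ⊗ a₍₂₎b` is the element `Δ(a)(1 ⊗ b)` of `A ⊗ A`. -/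
def smashMul (Δ : A →ₙₐ[ℂ] Multiplier (A ⊗[ℂ] A)) (act : A →ₙₐ[ℂ] Module.End ℂ R) :
    R ⊗[ℂ] A →ₗ[ℂ] R ⊗[ℂ] A →ₗ[ℂ] R ⊗[ℂ] A :=
  TensorProduct.curry (smashAux act ∘ₗ LinearMap.lTensor (R ⊗[ℂ] R) (T₁ Δ) ∘ₗ
    (TensorProduct.tensorTensorTensorComm ℂ R A R A).toLinearMap)

theorem smashMul_tmul (Δ : A →ₙₐ[ℂ] Multiplier (A ⊗[ℂ] A)) (act : A →ₙₐ[ℂ] Module.End ℂ R)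
    (r s : R) (a b : A) {ι : Type*} (t : Finset ι) (p q : ι → A)
    (h : T₁ Δ (a ⊗ₜ b) = ∑ i ∈ t, p i ⊗ₜ q i) :
    smashMul Δ act (r ⊗ₜ a) (s ⊗ₜ b) = ∑ i ∈ t, (r * act (p i) s) ⊗ₜ q i := by
  simp [smashMul, smashAux, h, TensorProduct.tmul_sum]

/-- The action of `A ⊗ A` on `R # A`: `(p ⊗ q) ▷ (r # a) = (p ▷ r) # qa`. -/
def smashAction (act : A →ₙₐ[ℂ] Module.End ℂ R) :
    A ⊗[ℂ] A →ₙₐ[ℂ] Module.End ℂ (R ⊗[ℂ] A) :=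
  tensorAction act leftRegular

/-- The operator `x ↦ m ▷ x` on `R # A`, for `m ∈ M(A ⊗ A)`. -/
def smashExt (act : A →ₙₐ[ℂ] Module.End ℂ R) (m : Multiplier (A ⊗[ℂ] A)) :
    Module.End ℂ (R ⊗[ℂ] A) :=
  extendedAction (smashAction act) m

/-- The subspace `R #_E A = E ▷ (R # A)` of `R # A`. -/
def smashProduct (act : A →ₙₐ[ℂ] Module.End ℂ R) (E : Multiplier (A ⊗[ℂ] A)) :
    Submodule ℂ (R ⊗[ℂ] A) :=
  LinearMap.range (smashExt act E)

end Smash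

end WMHA

end

/-! Everything rests on left local units in `A` (`exists_leftLocalUnit`). Write `φ(y) = (ι ⊗ ε)(Ey)`
and `ψ(a ⊗ c) = (ι ⊗ ε)(Δ(a)(1 ⊗ c))`. Fullness and the formula for `(ι ⊗ Δ)E` make `φ`, and then
`ψ`, surjective. Given `z = φ(y)` and `Ey = ∑ d ⊗ c`, the elements `a ⊗ z` and `∑ ψ(a ⊗ c) ⊗ d`
agree modulo `ker T₁`. The projection `G₁` along this kernel shows that the second one lies in `A ⊗
Az`, and cancelling `a` yields `z ∈ Az` (`exists_mul_eq_self`). Consequently every unital `A`-module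
is non-degenerate, and multipliers act on `R`, `R ⊗ A` and `R ⊗ R ⊗ A`.

The product then reads `(r ⊗ a)y = m₁₂(r ⊗ (Δ(a) ▷ y))`, where `m₁₂` multiplies the first two legs
of `R ⊗ R ⊗ A`. Associativity becomes coassociativity in `M(A ⊗ A ⊗ A)` together with the module
algebra axiom. The identities for `E` follow from `EΔ(a) = Δ(a) = Δ(a)E`, from the fact that `m₁₂`
absorbs `E ⊗ 1`, and from the formulas for `(ι ⊗ Δ)E` and `(Δ ⊗ ι)E`; the second formula is the
axiom for `cop Δ` with the legs reversed. In particular every product lies in `E ▷ (R # A)`.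

For non-degeneracy, suppose first that `yx = 0` for all `y`. Then `Δ(a) ▷ x = 0` for all `a`, hence
`(A ⊗ A)E ▷ x = 0` and `x = E ▷ x = 0`. The other side is harder (`eq_zero_of_smashMul_left`). The
map `w ↦ T(w)` with `T(r ⊗ a) = ∑ (a₍₁₎ ▷ r) ⊗ a₍₂₎` has a generalized inverse `S` with `TS = E`,
and `T(w)(s ⊗ b)` is `T(w(s ⊗ 1))(1 ⊗ b)`. If `x` kills everything on the right, then `T(S(x)(s ⊗
1)) = 0`. The projection `ST` commutes with right multiplication by `s ⊗ 1`, so `S(x)(s ⊗ 1) = 0`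
for all `s`. Thus `S(x) = 0` and `x = TS(x) = 0`. -/

noncomputable section

namespace WMHA

set_option linter.unusedSectionVars false

/-! ### Joint injectivity and induction on tensor products over a field. -/

section TensorTools

variable {V V' W W' : Type*} [AddCommGroup V] [Module ℂ V] [AddCommGroup V'] [Module ℂ V']
  [AddCommGroup W] [Module ℂ W] [AddCommGroup W'] [Module ℂ W']

/-- A basis of `W` turns a tensor into a finitely supported family of vectors of `V`, on which the
maps act coordinatewise; joint injectivity is then checked in each coordinate. -/
theorem eq_zero_of_forall_rTensor {ι : Type*} (f : ι → V →ₗ[ℂ] V')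
    (hf : ∀ v, (∀ i, f i v = 0) → v = 0) (t : V ⊗[ℂ] W)
    (h : ∀ i, LinearMap.rTensor W (f i) t = 0) : t = 0 := by
  classical
  let b := Module.Basis.ofVectorSpace ℂ W
  have nat : ∀ (g : V →ₗ[ℂ] V') (t : V ⊗[ℂ] W) j,
      TensorProduct.equivFinsuppOfBasisRight b (LinearMap.rTensor W g t) j =
        g (TensorProduct.equivFinsuppOfBasisRight b t j) := by
    intro g t j
    induction t using TensorProduct.induction_on with
    | zero => simp
    | add x y hx hy => simp only [map_add, Finsupp.add_apply, hx, hy]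
    | tmul v w => simp
  apply (TensorProduct.equivFinsuppOfBasisRight b).injective
  rw [map_zero]
  ext j
  refine hf _ fun i => ?_
  rw [← nat, h i]
  simp

theorem eq_of_forall_rTensor {ι : Type*} (f : ι → V →ₗ[ℂ] V')
    (hf : ∀ v, (∀ i, f i v = 0) → v = 0) {s t : V ⊗[ℂ] W}
    (h : ∀ i, LinearMap.rTensor W (f i) s = LinearMap.rTensor W (f i) t) : s = t := by
  rw [← sub_eq_zero]
  exact eq_zero_of_forall_rTensor f hf _ fun i => by rw [map_sub, h, sub_self]

theorem comm_rTensor (f : V →ₗ[ℂ] V') (t : V ⊗[ℂ] W) :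
    TensorProduct.comm ℂ V' W (LinearMap.rTensor W f t) =
      LinearMap.lTensor W f (TensorProduct.comm ℂ V W t) := by
  induction t using TensorProduct.induction_on with
  | zero => simp
  | add x y hx hy => simp only [map_add, hx, hy]
  | tmul v w => simp

theorem comm_lTensor (f : V →ₗ[ℂ] V') (t : W ⊗[ℂ] V) :
    TensorProduct.comm ℂ W V' (LinearMap.lTensor W f t) =
      LinearMap.rTensor W f (TensorProduct.comm ℂ W V t) := by
  induction t using TensorProduct.induction_on with
  | zero => simp
  | add x y hx hy => simp only [map_add, hx, hy]
  | tmul v w => simp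

theorem eq_zero_of_forall_lTensor {ι : Type*} (f : ι → V →ₗ[ℂ] V')
    (hf : ∀ v, (∀ i, f i v = 0) → v = 0) (t : W ⊗[ℂ] V)
    (h : ∀ i, LinearMap.lTensor W (f i) t = 0) : t = 0 := by
  apply (TensorProduct.comm ℂ W V).injective
  rw [map_zero]
  exact eq_zero_of_forall_rTensor f hf _ fun i => by rw [← comm_lTensor, h, map_zero]

/-- Membership in `V ⊗ g(W)` can be tested after applying a jointly injective family of maps on
the first leg. -/
theorem mem_range_lTensor_of_forall {ι : Type*} (f : ι → V →ₗ[ℂ] V')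
    (hf : ∀ v, (∀ i, f i v = 0) → v = 0) (g : W →ₗ[ℂ] W') {t : V ⊗[ℂ] W'}
    (h : ∀ i, LinearMap.rTensor W' (f i) t ∈ LinearMap.range (LinearMap.lTensor V' g)) :
    t ∈ LinearMap.range (LinearMap.lTensor V g) := by
  -- By right exactness, membership in the range is the vanishing of the image in `V ⊗ W'/g(W)`, and
  -- vanishing is what the maps on the first leg detect.
  have hex : Function.Exact g (LinearMap.range g).mkQ := LinearMap.exact_map_mkQ_range g
  have hs := Submodule.mkQ_surjective (LinearMap.range g)
  refine (lTensor_exact V hex hs t).1 ?_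
  refine eq_zero_of_forall_rTensor f hf _ fun i => ?_
  have h1 := (lTensor_exact V' hex hs _).2 (h i)
  rw [← LinearMap.comp_apply, LinearMap.rTensor_comp_lTensor, ← LinearMap.lTensor_comp_rTensor]
  exact h1

/-- Idempotent algebras and unital modules are spanned by products, so identities on their tensor
products need checking only on products. -/
theorem tensor_span_induction {S : Set V} {T : Set W} (hS : Submodule.span ℂ S = ⊤)
    (hT : Submodule.span ℂ T = ⊤) {P : V ⊗[ℂ] W → Prop} (zero : P 0)
    (add : ∀ x y, P x → P y → P (x + y)) (smul : ∀ (c : ℂ) x, P x → P (c • x))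
    (tmul : ∀ v ∈ S, ∀ w ∈ T, P (v ⊗ₜ w)) (t : V ⊗[ℂ] W) : P t := by
  induction t using TensorProduct.induction_on with
  | zero => exact zero
  | add x y hx hy => exact add x y hx hy
  | tmul v w =>
    have hv : v ∈ Submodule.span ℂ S := hS ▸ Submodule.mem_top
    have hw : w ∈ Submodule.span ℂ T := hT ▸ Submodule.mem_top
    induction hv using Submodule.span_induction with
    | zero => simpa using zero
    | add x y _ _ hx hy => rw [TensorProduct.add_tmul]; exact add _ _ hx hy
    | smul c x _ hx => rw [← TensorProduct.smul_tmul']; exact smul _ _ hx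
    | mem x hx =>
      induction hw using Submodule.span_induction with
      | zero => simpa using zero
      | add x y _ _ hx hy => rw [TensorProduct.tmul_add]; exact add _ _ hx hy
      | smul c x _ hx => rw [TensorProduct.tmul_smul]; exact smul _ _ hx
      | mem y hy => exact tmul x hx y hy

end TensorTools

/-! ### Multipliers of non-degenerate algebras and of their tensor products. -/

section MultiplierTools

variable {A : Type*} [NonUnitalRing A] [Module ℂ A] [IsScalarTower ℂ A A] [SMulCommClass ℂ A A]
variable {B : Type*} [NonUnitalRing B] [Module ℂ B] [IsScalarTower ℂ B B] [SMulCommClass ℂ B B]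

namespace Multiplier

theorem left_mul (m : Multiplier A) (x y : A) : m.left (x * y) = m.left x * y := m.2.1 x y

theorem right_mul (m : Multiplier A) (x y : A) : m.right (x * y) = x * m.right y := m.2.2.1 x y

theorem right_mul_eq (m : Multiplier A) (x y : A) : m.right x * y = x * m.left y := m.2.2.2 x y

theorem mul_left_apply (m n : Multiplier A) (x : A) : (m * n).left x = m.left (n.left x) := rfl

theorem mul_right_apply (m n : Multiplier A) (x : A) : (m * n).right x = n.right (m.right x) := rfl

/-- The relation `r(a)b = a l(b)` lets the left half determine the right half in a non-degenerate
algebra. -/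
theorem left_injective (hA : IsNondegenerateAlgebra A) {m n : Multiplier A}
    (h : ∀ x, m.left x = n.left x) : m = n := by
  apply Subtype.ext; apply Prod.ext
  · exact LinearMap.ext h
  · apply MulOpposite.unop_injective
    refine LinearMap.ext fun x => ?_
    change m.right x = n.right x
    rw [← sub_eq_zero]
    refine hA.1 _ fun b => ?_
    rw [sub_mul, right_mul_eq, right_mul_eq, h, sub_self]

theorem right_injective (hA : IsNondegenerateAlgebra A) {m n : Multiplier A}
    (h : ∀ x, m.right x = n.right x) : m = n := by
  refine left_injective hA fun x => ?_
  rw [← sub_eq_zero]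
  refine hA.2 _ fun b => ?_
  rw [mul_sub, ← right_mul_eq, ← right_mul_eq, h, sub_self]

/-- The left action of a multiplier as a linear map of the multiplier. -/
def leftₗ : Multiplier A →ₗ[ℂ] A →ₗ[ℂ] A where
  toFun m := m.left
  map_add' _ _ := rfl
  map_smul' _ _ := rfl

theorem left_add (m n : Multiplier A) (x : A) : (m + n).left x = m.left x + n.left x := rfl

theorem embed_mul_eq (m : Multiplier A) (x : A) : m * embed x = embed (m.left x) := by
  apply Subtype.ext; apply Prod.ext
  · exact LinearMap.ext fun y => m.2.1 x y
  · apply MulOpposite.unop_injective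
    exact LinearMap.ext fun y => m.2.2.2 y x

theorem mul_embed_eq (m : Multiplier A) (x : A) : embed x * m = embed (m.right x) := by
  apply Subtype.ext; apply Prod.ext
  · exact LinearMap.ext fun y => (m.2.2.2 x y).symm
  · apply MulOpposite.unop_injective
    exact LinearMap.ext fun y => m.2.2.1 y x

end Multiplier

theorem embed_left (a x : A) : (embed a).left x = a * x := rfl

theorem embed_right (a x : A) : (embed a).right x = x * a := rfl

theorem embed_injective (hA : IsNondegenerateAlgebra A) {a b : A}
    (h : (embed a : Multiplier A) = embed b) : a = b := by
  rw [← sub_eq_zero]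
  refine hA.1 _ fun x => ?_
  have := congrArg (fun m : Multiplier A => m.left x) h
  rw [sub_mul, sub_eq_zero]
  exact this

theorem embed_mul (a b : A) : (embed (a * b) : Multiplier A) = embed a * embed b := by
  rw [Multiplier.embed_mul_eq, embed_left]

theorem tens_mul_tens (m m' : Multiplier A) (n n' : Multiplier B) :
    tens m n * tens m' n' = tens (m * m') (n * n') := by
  apply Subtype.ext; apply Prod.ext
  · exact (TensorProduct.map_comp m.left n.left m'.left n'.left).symm
  · apply MulOpposite.unop_injective
    exact (TensorProduct.map_comp m'.right n'.right m.right n.right).symm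

theorem tens_embed_embed (a : A) (b : B) : tens (embed a) (embed b) = embed (a ⊗ₜ[ℂ] b) := by
  apply Subtype.ext; apply Prod.ext
  · exact TensorProduct.ext' fun x y => (Algebra.TensorProduct.tmul_mul_tmul a x b y).symm
  · apply MulOpposite.unop_injective
    exact TensorProduct.ext' fun x y => (Algebra.TensorProduct.tmul_mul_tmul x a y b).symm

theorem transport_left (e : A ≃ₗ[ℂ] B) (he : ∀ x y, e (x * y) = e x * e y) (m : Multiplier A)
    (x : B) : (transport e he m).left x = e (m.left (e.symm x)) := rfl

theorem transport_embed (e : A ≃ₗ[ℂ] B) (he : ∀ x y, e (x * y) = e x * e y) (a : A) :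
    transport e he (embed a) = embed (e a) := by
  apply Subtype.ext; apply Prod.ext
  · refine LinearMap.ext fun x => ?_
    change e (a * e.symm x) = e a * x
    rw [he, e.apply_symm_apply]
  · apply MulOpposite.unop_injective
    refine LinearMap.ext fun x => ?_
    change e (e.symm x * a) = x * e a
    rw [he, e.apply_symm_apply]

theorem mul_tmul_eq_map (t : A ⊗[ℂ] B) (a : A) (b : B) :
    t * a ⊗ₜ[ℂ] b = TensorProduct.map (LinearMap.mulRight ℂ a) (LinearMap.mulRight ℂ b) t := by
  induction t using TensorProduct.induction_on with
  | zero => simp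
  | add x y hx hy => simp only [add_mul, map_add, hx, hy]
  | tmul v w => simp

theorem tmul_mul_eq_map (t : A ⊗[ℂ] B) (a : A) (b : B) :
    a ⊗ₜ[ℂ] b * t = TensorProduct.map (LinearMap.mulLeft ℂ a) (LinearMap.mulLeft ℂ b) t := by
  induction t using TensorProduct.induction_on with
  | zero => simp
  | add x y hx hy => simp only [mul_add, map_add, hx, hy]
  | tmul v w => simp

theorem IsNondegenerateAlgebra.eq_of_mul_right (hA : IsNondegenerateAlgebra A) {a b : A}
    (h : ∀ c, a * c = b * c) : a = b := by
  rw [← sub_eq_zero]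
  exact hA.1 _ fun c => by rw [sub_mul, h, sub_self]

theorem IsNondegenerateAlgebra.eq_of_mul_left (hA : IsNondegenerateAlgebra A) {a b : A}
    (h : ∀ c, c * a = c * b) : a = b := by
  rw [← sub_eq_zero]
  exact hA.2 _ fun c => by rw [mul_sub, h, sub_self]

/-- Multiplication by `a ⊗ b` is a multiplication on each leg in turn, and each of the two families
is jointly injective. -/
theorem IsNondegenerateAlgebra.tensor (hA : IsNondegenerateAlgebra A)
    (hB : IsNondegenerateAlgebra B) : IsNondegenerateAlgebra (A ⊗[ℂ] B) := by
  constructor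
  · intro t h
    refine eq_zero_of_forall_rTensor (fun a : A => LinearMap.mulRight ℂ a) (fun v hv => hA.1 v hv) t
      fun a => ?_
    refine eq_zero_of_forall_lTensor (fun b : B => LinearMap.mulRight ℂ b) (fun v hv => hB.1 v hv) _
      fun b => ?_
    rw [← LinearMap.comp_apply, LinearMap.lTensor_comp_rTensor, ← mul_tmul_eq_map]
    exact h _
  · intro t h
    refine eq_zero_of_forall_rTensor (fun a : A => LinearMap.mulLeft ℂ a) (fun v hv => hA.2 v hv) t
      fun a => ?_
    refine eq_zero_of_forall_lTensor (fun b : B => LinearMap.mulLeft ℂ b) (fun v hv => hB.2 v hv) _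
      fun b => ?_
    rw [← LinearMap.comp_apply, LinearMap.lTensor_comp_rTensor, ← tmul_mul_eq_map]
    exact h _

/-- Elements of `A ⊗ B` can be compared after right multiplication by elementary tensors. -/
theorem eq_of_mul_tmul (hA : IsNondegenerateAlgebra A) (hB : IsNondegenerateAlgebra B)
    {s t : A ⊗[ℂ] B} (h : ∀ a b, s * a ⊗ₜ[ℂ] b = t * a ⊗ₜ[ℂ] b) : s = t := by
  refine (hA.tensor hB).eq_of_mul_right fun c => ?_
  induction c using TensorProduct.induction_on with
  | zero => simp
  | add x y hx hy => simp only [mul_add, hx, hy]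
  | tmul v w => exact h v w

theorem eq_of_rTensor_mulLeft (hA : IsNondegenerateAlgebra A) {W : Type*} [AddCommGroup W]
    [Module ℂ W] {s t : A ⊗[ℂ] W}
    (h : ∀ a, LinearMap.rTensor W (LinearMap.mulLeft ℂ a) s =
      LinearMap.rTensor W (LinearMap.mulLeft ℂ a) t) : s = t :=
  eq_of_forall_rTensor (fun a : A => LinearMap.mulLeft ℂ a) (fun v hv => hA.2 v hv) h

end MultiplierTools

/-! ### The canonical maps, the canonical idempotent and the opposite coproduct. -/

section CoproductTools

variable {A : Type*} [NonUnitalRing A] [Module ℂ A] [IsScalarTower ℂ A A] [SMulCommClass ℂ A A]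
variable {B : Type*} [NonUnitalRing B] [Module ℂ B] [IsScalarTower ℂ B B] [SMulCommClass ℂ B B]

theorem rTensor_mulRight_mul (t : A ⊗[ℂ] B) (x u : A) (v : B) :
    LinearMap.rTensor B (LinearMap.mulRight ℂ x) t * u ⊗ₜ[ℂ] v = t * (x * u) ⊗ₜ[ℂ] v := by
  induction t using TensorProduct.induction_on with
  | zero => simp
  | add x y hx hy => simp only [add_mul, map_add, hx, hy]
  | tmul v w => simp [mul_assoc]

theorem lTensor_mulRight_mul (t : A ⊗[ℂ] B) (u : A) (y v : B) :
    LinearMap.lTensor A (LinearMap.mulRight ℂ y) t * u ⊗ₜ[ℂ] v = t * u ⊗ₜ[ℂ] (y * v) := by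
  induction t using TensorProduct.induction_on with
  | zero => simp
  | add x y hx hy => simp only [add_mul, map_add, hx, hy]
  | tmul v w => simp [mul_assoc]

theorem mul_lTensor_mulLeft (t : A ⊗[ℂ] B) (u : A) (y v : B) :
    u ⊗ₜ[ℂ] v * LinearMap.lTensor A (LinearMap.mulLeft ℂ y) t = u ⊗ₜ[ℂ] (v * y) * t := by
  induction t using TensorProduct.induction_on with
  | zero => simp
  | add x y hx hy => simp only [mul_add, map_add, hx, hy]
  | tmul v w => simp [mul_assoc]

theorem rTensor_mulLeft_mul (t s : A ⊗[ℂ] B) (x : A) :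
    LinearMap.rTensor B (LinearMap.mulLeft ℂ x) (t * s) =
      LinearMap.rTensor B (LinearMap.mulLeft ℂ x) t * s := by
  induction t using TensorProduct.induction_on with
  | zero => simp
  | add x y hx hy => simp only [add_mul, map_add, hx, hy]
  | tmul v w =>
    induction s using TensorProduct.induction_on with
    | zero => simp
    | add x y hx hy => simp only [mul_add, map_add, hx, hy]
    | tmul a b => simp [mul_assoc]

/-- The factor `x ⊗ 1` need not belong to `A ⊗ B`, so the multiplier identity does not apply to it
at once; after multiplication by `u ⊗ v` it is absorbed into `xu ⊗ v`. -/
theorem left_rTensor_mulRight (hA : IsNondegenerateAlgebra A) (hB : IsNondegenerateAlgebra B)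
    (m : Multiplier (A ⊗[ℂ] B)) (x : A) (t : A ⊗[ℂ] B) :
    m.left (LinearMap.rTensor B (LinearMap.mulRight ℂ x) t) =
      LinearMap.rTensor B (LinearMap.mulRight ℂ x) (m.left t) := by
  refine eq_of_mul_tmul hA hB fun u v => ?_
  rw [← m.left_mul, rTensor_mulRight_mul, rTensor_mulRight_mul, m.left_mul]

theorem left_lTensor_mulRight (hA : IsNondegenerateAlgebra A) (hB : IsNondegenerateAlgebra B)
    (m : Multiplier (A ⊗[ℂ] B)) (y : B) (t : A ⊗[ℂ] B) :
    m.left (LinearMap.lTensor A (LinearMap.mulRight ℂ y) t) =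
      LinearMap.lTensor A (LinearMap.mulRight ℂ y) (m.left t) := by
  refine eq_of_mul_tmul hA hB fun u v => ?_
  rw [← m.left_mul, lTensor_mulRight_mul, lTensor_mulRight_mul, m.left_mul]

theorem eq_of_tmul_mul (hA : IsNondegenerateAlgebra A) (hB : IsNondegenerateAlgebra B)
    {s t : A ⊗[ℂ] B} (h : ∀ a b, a ⊗ₜ[ℂ] b * s = a ⊗ₜ[ℂ] b * t) : s = t := by
  refine (hA.tensor hB).eq_of_mul_left fun c => ?_
  induction c using TensorProduct.induction_on with
  | zero => simp
  | add x y hx hy => simp only [add_mul, hx, hy]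
  | tmul v w => exact h v w

theorem right_lTensor_mulLeft (hA : IsNondegenerateAlgebra A) (hB : IsNondegenerateAlgebra B)
    (m : Multiplier (A ⊗[ℂ] B)) (y : B) (t : A ⊗[ℂ] B) :
    m.right (LinearMap.lTensor A (LinearMap.mulLeft ℂ y) t) =
      LinearMap.lTensor A (LinearMap.mulLeft ℂ y) (m.right t) := by
  refine eq_of_tmul_mul hA hB fun u v => ?_
  rw [← m.right_mul, mul_lTensor_mulLeft, mul_lTensor_mulLeft, m.right_mul]

variable {Δ : A →ₙₐ[ℂ] Multiplier (A ⊗[ℂ] A)}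

theorem embed_T₁ (hN : IsNondegenerateAlgebra A) (hc : IsCoproduct Δ) (a b : A) :
    embed (T₁ Δ (a ⊗ₜ b)) = Δ a * tens 1 (embed b) :=
  embed_unembed (hN.tensor hN) (hc.covered_right a b)

theorem embed_T₂ (hN : IsNondegenerateAlgebra A) (hc : IsCoproduct Δ) (a b : A) :
    embed (T₂ Δ (a ⊗ₜ b)) = tens (embed a) 1 * Δ b :=
  embed_unembed (hN.tensor hN) (hc.covered_left a b)

theorem T₁_mul_tmul (hN : IsNondegenerateAlgebra A) (hc : IsCoproduct Δ) (a b x y : A) :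
    T₁ Δ (a ⊗ₜ b) * x ⊗ₜ y = (Δ a).left (x ⊗ₜ (b * y)) := by
  rw [← embed_left, embed_T₁ hN hc]
  rfl

theorem T₂_mul (hN : IsNondegenerateAlgebra A) (hc : IsCoproduct Δ) (a b : A) (t : A ⊗[ℂ] A) :
    T₂ Δ (a ⊗ₜ b) * t = LinearMap.rTensor A (LinearMap.mulLeft ℂ a) ((Δ b).left t) := by
  rw [← embed_left, embed_T₂ hN hc]
  rfl

theorem tmul_mul_T₂ (hN : IsNondegenerateAlgebra A) (hc : IsCoproduct Δ) (a b x y : A) :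
    x ⊗ₜ y * T₂ Δ (a ⊗ₜ b) = (Δ b).right ((x * a) ⊗ₜ y) := by
  rw [← embed_right, embed_T₂ hN hc]
  rfl

theorem coproduct_left_tmul (hN : IsNondegenerateAlgebra A) (hc : IsCoproduct Δ) (a x b : A) :
    (Δ a).left (x ⊗ₜ b) = LinearMap.rTensor A (LinearMap.mulRight ℂ x) (T₁ Δ (a ⊗ₜ b)) := by
  refine eq_of_mul_tmul hN hN fun u v => ?_
  rw [← Multiplier.left_mul, rTensor_mulRight_mul, T₁_mul_tmul hN hc,
    Algebra.TensorProduct.tmul_mul_tmul]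

theorem coproduct_right_tmul (hN : IsNondegenerateAlgebra A) (hc : IsCoproduct Δ) (a x b : A) :
    (Δ a).right (x ⊗ₜ b) = LinearMap.lTensor A (LinearMap.mulLeft ℂ b) (T₂ Δ (x ⊗ₜ a)) := by
  refine eq_of_tmul_mul hN hN fun u v => ?_
  rw [← Multiplier.right_mul, mul_lTensor_mulLeft, tmul_mul_T₂ hN hc,
    Algebra.TensorProduct.tmul_mul_tmul]

theorem T₁_tmul_mul (hN : IsNondegenerateAlgebra A) (hc : IsCoproduct Δ) (a b c : A) :
    T₁ Δ (a ⊗ₜ (b * c)) = LinearMap.lTensor A (LinearMap.mulRight ℂ c) (T₁ Δ (a ⊗ₜ b)) := by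
  refine eq_of_mul_tmul hN hN fun u v => ?_
  rw [lTensor_mulRight_mul, T₁_mul_tmul hN hc, T₁_mul_tmul hN hc, mul_assoc]

theorem T₁_lTensor_mulRight (hN : IsNondegenerateAlgebra A) (hc : IsCoproduct Δ) (c : A)
    (t : A ⊗[ℂ] A) : T₁ Δ (LinearMap.lTensor A (LinearMap.mulRight ℂ c) t) =
      LinearMap.lTensor A (LinearMap.mulRight ℂ c) (T₁ Δ t) := by
  induction t using TensorProduct.induction_on with
  | zero => simp
  | add x y hx hy => simp only [map_add, hx, hy]
  | tmul a b => exact T₁_tmul_mul hN hc a b c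

theorem T₁_mul_tmul_left (hN : IsNondegenerateAlgebra A) (hc : IsCoproduct Δ) (u a b : A) :
    T₁ Δ ((u * a) ⊗ₜ b) = (Δ u).left (T₁ Δ (a ⊗ₜ b)) := by
  refine eq_of_mul_tmul hN hN fun x y => ?_
  rw [← Multiplier.left_mul, T₁_mul_tmul hN hc, T₁_mul_tmul hN hc, map_mul,
    Multiplier.mul_left_apply]

/-- Both sides are `(c ⊗ 1)Δ(a)(1 ⊗ b)`. This is the bridge between the two canonical maps. -/
theorem rTensor_mulLeft_T₁ (hN : IsNondegenerateAlgebra A) (hc : IsCoproduct Δ) (c a b : A) :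
    LinearMap.rTensor A (LinearMap.mulLeft ℂ c) (T₁ Δ (a ⊗ₜ b)) =
      LinearMap.lTensor A (LinearMap.mulRight ℂ b) (T₂ Δ (c ⊗ₜ a)) := by
  refine eq_of_mul_tmul hN hN fun x y => ?_
  rw [lTensor_mulRight_mul, T₂_mul hN hc, ← rTensor_mulLeft_mul, T₁_mul_tmul hN hc]

namespace IsCanonicalIdempotent

variable {E : Multiplier (A ⊗[ℂ] A)}

theorem left_T₁ (hE : IsCanonicalIdempotent Δ E) (t : A ⊗[ℂ] A) : E.left (T₁ Δ t) = T₁ Δ t := by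
  have h : T₁ Δ t ∈ LinearMap.range E.left := by rw [hE.range_left]; exact ⟨t, rfl⟩
  obtain ⟨s, hs⟩ := h
  rw [← hs, ← Multiplier.mul_left_apply, hE.idem]

theorem right_T₂ (hE : IsCanonicalIdempotent Δ E) (t : A ⊗[ℂ] A) :
    E.right (T₂ Δ t) = T₂ Δ t := by
  have h : T₂ Δ t ∈ LinearMap.range E.right := by rw [hE.range_right]; exact ⟨t, rfl⟩
  obtain ⟨s, hs⟩ := h
  rw [← hs, ← Multiplier.mul_right_apply, hE.idem]

theorem exists_T₁ (hE : IsCanonicalIdempotent Δ E) (t : A ⊗[ℂ] A) : ∃ s, T₁ Δ s = E.left t := by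
  have h : E.left t ∈ LinearMap.range (T₁ Δ) := by rw [← hE.range_left]; exact ⟨t, rfl⟩
  exact h

theorem exists_T₂ (hE : IsCanonicalIdempotent Δ E) (t : A ⊗[ℂ] A) : ∃ s, T₂ Δ s = E.right t := by
  have h : E.right t ∈ LinearMap.range (T₂ Δ) := by rw [← hE.range_right]; exact ⟨t, rfl⟩
  exact h

/-- `E` fixes the range of `T₁`, and `Δ(a)(x ⊗ b)` is `T₁(a ⊗ b)(x ⊗ 1)`, where the last factor
commutes with the left action of `E`. -/
theorem mul_coproduct (hE : IsCanonicalIdempotent Δ E) (hN : IsNondegenerateAlgebra A)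
    (hc : IsCoproduct Δ) (a : A) : E * Δ a = Δ a := by
  refine Multiplier.left_injective (hN.tensor hN) fun t => ?_
  induction t using TensorProduct.induction_on with
  | zero => simp
  | add x y hx hy => simp only [map_add, hx, hy]
  | tmul x b =>
    rw [Multiplier.mul_left_apply, coproduct_left_tmul hN hc, left_rTensor_mulRight hN hN,
      hE.left_T₁]

theorem coproduct_mul (hE : IsCanonicalIdempotent Δ E) (hN : IsNondegenerateAlgebra A)
    (hc : IsCoproduct Δ) (a : A) : Δ a * E = Δ a := by
  refine Multiplier.right_injective (hN.tensor hN) fun t => ?_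
  induction t using TensorProduct.induction_on with
  | zero => simp
  | add x y hx hy => simp only [map_add, hx, hy]
  | tmul x b =>
    rw [Multiplier.mul_right_apply, coproduct_right_tmul hN hc, right_lTensor_mulLeft hN hN,
      hE.right_T₂]

/-- Equality of the left ranges gives `EF = F`, equality of the right ranges gives `EF = E`. -/
theorem unique (hN : IsNondegenerateAlgebra A) {F : Multiplier (A ⊗[ℂ] A)}
    (hE : IsCanonicalIdempotent Δ E) (hF : IsCanonicalIdempotent Δ F) : E = F := by
  have h1 : E * F = F := Multiplier.left_injective (hN.tensor hN) fun t => by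
    obtain ⟨s, hs⟩ := hF.exists_T₁ t
    rw [Multiplier.mul_left_apply, ← hs, hE.left_T₁]
  have h2 : E * F = E := Multiplier.right_injective (hN.tensor hN) fun t => by
    obtain ⟨s, hs⟩ := hE.exists_T₂ t
    rw [Multiplier.mul_right_apply, ← hs, hF.right_T₂]
  rw [← h2, h1]

end IsCanonicalIdempotent

/-- The multiplier `m` with its two legs exchanged. -/
def flip (m : Multiplier (A ⊗[ℂ] A)) : Multiplier (A ⊗[ℂ] A) :=
  transport (TensorProduct.comm ℂ A A) comm_mul m

theorem flip_left (m : Multiplier (A ⊗[ℂ] A)) (t : A ⊗[ℂ] A) :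
    (flip m).left t =
      TensorProduct.comm ℂ A A (m.left (TensorProduct.comm ℂ A A t)) := rfl

theorem flip_right (m : Multiplier (A ⊗[ℂ] A)) (t : A ⊗[ℂ] A) :
    (flip m).right t =
      TensorProduct.comm ℂ A A (m.right (TensorProduct.comm ℂ A A t)) := rfl

theorem flip_mul (m n : Multiplier (A ⊗[ℂ] A)) : flip (m * n) = flip m * flip n :=
  map_mul _ m n

theorem cop_apply (a : A) : cop Δ a = flip (Δ a) := rfl

theorem comm_comm (t : A ⊗[ℂ] A) :
    TensorProduct.comm ℂ A A (TensorProduct.comm ℂ A A t) = t := by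
  induction t using TensorProduct.induction_on with
  | zero => simp
  | add x y hx hy => simp only [map_add, hx, hy]
  | tmul a b => rfl

theorem flip_flip (m : Multiplier (A ⊗[ℂ] A)) : flip (flip m) = m := by
  apply Subtype.ext; apply Prod.ext
  · refine LinearMap.ext fun x => ?_
    change (flip (flip m)).left x = m.left x
    rw [flip_left, flip_left, comm_comm, comm_comm]
  · apply MulOpposite.unop_injective
    refine LinearMap.ext fun x => ?_
    change (flip (flip m)).right x = m.right x
    rw [flip_right, flip_right, comm_comm, comm_comm]

theorem flip_tens (m n : Multiplier A) : flip (tens m n) = tens n m := by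
  apply Subtype.ext; apply Prod.ext
  · exact TensorProduct.ext' fun x y => rfl
  · apply MulOpposite.unop_injective
    exact TensorProduct.ext' fun x y => rfl

theorem flip_embed (t : A ⊗[ℂ] A) : flip (embed t) = embed (TensorProduct.comm ℂ A A t) :=
  transport_embed _ _ _

theorem cop_cop : cop (cop Δ) = Δ := by
  ext a : 1
  rw [cop_apply, cop_apply, flip_flip]

theorem flip_mem_range_embed {m : Multiplier (A ⊗[ℂ] A)}
    (h : m ∈ LinearMap.range (embed : A ⊗[ℂ] A →ₗ[ℂ] _)) :
    flip m ∈ LinearMap.range (embed : A ⊗[ℂ] A →ₗ[ℂ] _) := by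
  obtain ⟨t, rfl⟩ := h
  exact ⟨_, (flip_embed t).symm⟩

theorem IsRegularWeakMultiplierHopfAlgebra.cop (hA : IsRegularWeakMultiplierHopfAlgebra Δ) :
    IsRegularWeakMultiplierHopfAlgebra (cop Δ) where
  weak := hA.weak_cop
  regular_left a b := by
    rw [cop_apply, ← flip_tens, ← flip_mul]
    exact flip_mem_range_embed (hA.weak.coproduct.covered_right a b)
  regular_right a b := by
    rw [cop_apply, ← flip_tens, ← flip_mul]
    exact flip_mem_range_embed (hA.weak.coproduct.covered_left a b)
  weak_cop := by rw [cop_cop]; exact hA.weak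

/-- The axioms for `cop Δ` provide some canonical idempotent `F`. Since `flip E` is a right unit for
`cop Δ` and `flip F` a left unit for `Δ`, the product `F * flip E` equals both `F` and `flip E`. -/
theorem IsCanonicalIdempotent.cop {E : Multiplier (A ⊗[ℂ] A)} (hE : IsCanonicalIdempotent Δ E)
    (hA : IsRegularWeakMultiplierHopfAlgebra Δ) : IsCanonicalIdempotent (cop Δ) (flip E) := by
  obtain ⟨F, hF, -⟩ := hA.weak_cop.canonical
  have hN := hA.weak.nondegenerate
  have hc := hA.weak.coproduct
  have hc' := hA.weak_cop.coproduct
  have hEΔ (a : A) : flip E * WMHA.cop Δ a = WMHA.cop Δ a := by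
    rw [cop_apply, ← flip_mul, hE.mul_coproduct hN hc]
  have hΔE (a : A) : WMHA.cop Δ a * flip E = WMHA.cop Δ a := by
    rw [cop_apply, ← flip_mul, hE.coproduct_mul hN hc]
  have hFΔ (a : A) : flip F * Δ a = Δ a := by
    rw [← flip_flip (Δ a), ← flip_mul, ← cop_apply, hF.mul_coproduct hN hc']
  have h1 : flip E * F = F := Multiplier.left_injective (hN.tensor hN) fun t => by
    obtain ⟨s, hs⟩ := hF.exists_T₁ t
    rw [Multiplier.mul_left_apply, ← hs]
    clear hs
    induction s using TensorProduct.induction_on with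
    | zero => simp
    | add x y hx hy => simp only [map_add, hx, hy]
    | tmul a b =>
      apply embed_injective (hN.tensor hN)
      rw [← Multiplier.embed_mul_eq, embed_T₁ hN hc', ← mul_assoc, hEΔ]
  have h2 : F * flip E = F := Multiplier.right_injective (hN.tensor hN) fun t => by
    obtain ⟨s, hs⟩ := hF.exists_T₂ t
    rw [Multiplier.mul_right_apply, ← hs]
    clear hs
    induction s using TensorProduct.induction_on with
    | zero => simp
    | add x y hx hy => simp only [map_add, hx, hy]
    | tmul a b =>
      apply embed_injective (hN.tensor hN)
      rw [← Multiplier.mul_embed_eq, embed_T₂ hN hc', mul_assoc, hΔE]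
  have h3 : flip F * E = E := Multiplier.left_injective (hN.tensor hN) fun t => by
    obtain ⟨s, hs⟩ := hE.exists_T₁ t
    rw [Multiplier.mul_left_apply, ← hs]
    clear hs
    induction s using TensorProduct.induction_on with
    | zero => simp
    | add x y hx hy => simp only [map_add, hx, hy]
    | tmul a b =>
      apply embed_injective (hN.tensor hN)
      rw [← Multiplier.embed_mul_eq, embed_T₁ hN hc, ← mul_assoc, hFΔ]
  have h4 : flip E = F := by
    rw [← h2, ← flip_flip F, ← flip_mul, h3]
  rw [h4]
  exact hF

end CoproductTools

/-! ### Left local units in `A`. -/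

section LocalUnits

variable {A : Type*} [NonUnitalRing A] [Module ℂ A] [IsScalarTower ℂ A A] [SMulCommClass ℂ A A]

/-- `ι ⊗ ε : V ⊗ A → V`. -/
def sliceRight {V : Type*} [AddCommGroup V] [Module ℂ V] (ε : A →ₗ[ℂ] ℂ) :
    V ⊗[ℂ] A →ₗ[ℂ] V :=
  (TensorProduct.rid ℂ V).toLinearMap ∘ₗ LinearMap.lTensor V ε

/-- `ε ⊗ ι : A ⊗ V → V`. -/
def sliceLeft {V : Type*} [AddCommGroup V] [Module ℂ V] (ε : A →ₗ[ℂ] ℂ) :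
    A ⊗[ℂ] V →ₗ[ℂ] V :=
  (TensorProduct.lid ℂ V).toLinearMap ∘ₗ LinearMap.rTensor V ε

theorem sliceRight_tmul {V : Type*} [AddCommGroup V] [Module ℂ V] (ε : A →ₗ[ℂ] ℂ) (v : V) (a : A) :
    sliceRight ε (v ⊗ₜ a) = ε a • v := by simp [sliceRight]

theorem sliceLeft_tmul {V : Type*} [AddCommGroup V] [Module ℂ V] (ε : A →ₗ[ℂ] ℂ) (v : V) (a : A) :
    sliceLeft ε (a ⊗ₜ v) = ε a • v := by simp [sliceLeft]

theorem sliceRight_rTensor {V W : Type*} [AddCommGroup V] [Module ℂ V] [AddCommGroup W]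
    [Module ℂ W] (ε : A →ₗ[ℂ] ℂ) (f : V →ₗ[ℂ] W) (t : V ⊗[ℂ] A) :
    sliceRight ε (LinearMap.rTensor A f t) = f (sliceRight ε t) := by
  induction t using TensorProduct.induction_on with
  | zero => simp
  | add x y hx hy => simp only [map_add, hx, hy]
  | tmul a b => simp [sliceRight_tmul]

theorem lTensor_sliceRight_assoc (ε : A →ₗ[ℂ] ℂ) (s : A ⊗[ℂ] A) (q : A) :
    LinearMap.lTensor A (sliceRight ε) (TensorProduct.assoc ℂ A A A (s ⊗ₜ q)) = ε q • s := by
  induction s using TensorProduct.induction_on with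
  | zero => simp
  | add x y hx hy => simp only [map_add, hx, hy, TensorProduct.add_tmul, smul_add]
  | tmul a b => simp [sliceRight_tmul]

theorem lTensor_sliceLeft_assoc (ε : A →ₗ[ℂ] ℂ) (s : A ⊗[ℂ] A) (q : A) :
    LinearMap.lTensor A (sliceLeft ε) (TensorProduct.assoc ℂ A A A (s ⊗ₜ q)) =
      sliceRight ε s ⊗ₜ q := by
  induction s using TensorProduct.induction_on with
  | zero => simp
  | add x y hx hy => simp only [map_add, hx, hy, TensorProduct.add_tmul]
  | tmul a b => simp [sliceRight_tmul, sliceLeft_tmul, TensorProduct.smul_tmul]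

theorem lTensor_sliceRight_leg13 (ε : A →ₗ[ℂ] ℂ) (s : A ⊗[ℂ] A) (b : A) :
    LinearMap.lTensor A (sliceRight ε) (leg13 (s ⊗ₜ b)) = sliceRight ε s ⊗ₜ b := by
  induction s using TensorProduct.induction_on with
  | zero => simp
  | add x y hx hy => simp only [map_add, hx, hy, TensorProduct.add_tmul]
  | tmul p q => simp [leg13, sliceRight_tmul, TensorProduct.smul_tmul]

theorem lTensor_sliceRight_onLegs12 (ε : A →ₗ[ℂ] ℂ) (G : A ⊗[ℂ] A →ₗ[ℂ] A ⊗[ℂ] A)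
    (w : A ⊗[ℂ] (A ⊗[ℂ] A)) :
    LinearMap.lTensor A (sliceRight ε) (onLegs12 G w) =
      G (LinearMap.lTensor A (sliceRight ε) w) := by
  obtain ⟨w, rfl⟩ := (TensorProduct.assoc ℂ A A A).surjective w
  induction w using TensorProduct.induction_on with
  | zero => simp
  | add x y hx hy => simp only [map_add, hx, hy]
  | tmul s q =>
    rw [lTensor_sliceRight_assoc]
    simp [onLegs12, lTensor_sliceRight_assoc]

variable {Δ : A →ₙₐ[ℂ] Multiplier (A ⊗[ℂ] A)}

theorem comm_T₁_cop_mul_tmul (hN : IsNondegenerateAlgebra A) (hc : IsCoproduct (cop Δ))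
    (a b x y : A) :
    TensorProduct.comm ℂ A A (T₁ (cop Δ) (a ⊗ₜ b)) * x ⊗ₜ y = (Δ a).left ((b * x) ⊗ₜ y) := by
  have h := congrArg (TensorProduct.comm ℂ A A) (T₁_mul_tmul hN hc a b y x)
  rw [comm_mul, cop_apply, flip_left, comm_comm] at h
  exact h

theorem rTensor_mulLeft_comm_T₁_cop (hA : IsRegularWeakMultiplierHopfAlgebra Δ) (c a b : A) :
    LinearMap.rTensor A (LinearMap.mulLeft ℂ c)
        (TensorProduct.comm ℂ A A (T₁ (cop Δ) (a ⊗ₜ b))) =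
      LinearMap.rTensor A (LinearMap.mulRight ℂ b) (T₂ Δ (c ⊗ₜ a)) := by
  have hN := hA.weak.nondegenerate
  refine eq_of_mul_tmul hN hN fun x y => ?_
  rw [rTensor_mulRight_mul, T₂_mul hN hA.weak.coproduct, ← rTensor_mulLeft_mul,
    comm_T₁_cop_mul_tmul hN hA.weak_cop.coproduct]

/-- The counit axiom speaks of `(c ⊗ 1)Δ(a)`, while here `Δ(a)(b ⊗ 1)` is sliced. Both occur in `(c
⊗ 1)Δ(a)(b ⊗ 1)`, and `c` is cancelled by non-degeneracy. -/
theorem sliceRight_comm_T₁_cop (hA : IsRegularWeakMultiplierHopfAlgebra Δ) {ε : A →ₗ[ℂ] ℂ}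
    (hε : IsCounit Δ ε) (a b : A) :
    sliceRight ε (TensorProduct.comm ℂ A A (T₁ (cop Δ) (a ⊗ₜ b))) = a * b := by
  refine hA.weak.nondegenerate.eq_of_mul_left fun c => ?_
  have h2 := congrArg (sliceRight ε) (rTensor_mulLeft_comm_T₁_cop hA c a b)
  rw [sliceRight_rTensor, sliceRight_rTensor] at h2
  have h3 : sliceRight ε (T₂ Δ (c ⊗ₜ a)) = c * a := hε.2 c a
  rw [h3] at h2
  rw [← mul_assoc]
  exact h2

/-- The map `y ↦ (ι ⊗ ε)(E y)`. -/
def leftUnitMap (E : Multiplier (A ⊗[ℂ] A)) (ε : A →ₗ[ℂ] ℂ) : A ⊗[ℂ] A →ₗ[ℂ] A :=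
  sliceRight ε ∘ₗ E.left

theorem leftUnitMap_apply (E : Multiplier (A ⊗[ℂ] A)) (ε : A →ₗ[ℂ] ℂ) (t : A ⊗[ℂ] A) :
    leftUnitMap E ε t = sliceRight ε (E.left t) := rfl

/-- Since `Δ(a) = Δ(a)E` and `Et` is a sum of elements `Δ(q)(r ⊗ 1)`, the claim reduces to slicing
`Δ(aq)(r ⊗ 1)` to `aqr`. -/
theorem sliceRight_coproduct_left (hA : IsRegularWeakMultiplierHopfAlgebra Δ)
    {E : Multiplier (A ⊗[ℂ] A)} (hE : IsCanonicalIdempotent Δ E) {ε : A →ₗ[ℂ] ℂ}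
    (hε : IsCounit Δ ε) (a : A) (t : A ⊗[ℂ] A) :
    sliceRight ε ((Δ a).left t) = a * leftUnitMap E ε t := by
  have hN := hA.weak.nondegenerate
  have hc := hA.weak.coproduct
  have hc' := hA.weak_cop.coproduct
  obtain ⟨s, hs⟩ := (hE.cop hA).exists_T₁ (TensorProduct.comm ℂ A A t)
  rw [flip_left, comm_comm] at hs
  have hs' : E.left t = TensorProduct.comm ℂ A A (T₁ (cop Δ) s) := by rw [hs, comm_comm]
  rw [← hE.coproduct_mul hN hc a, Multiplier.mul_left_apply, leftUnitMap_apply, hs']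
  clear hs hs'
  induction s using TensorProduct.induction_on with
  | zero => simp
  | add x y hx hy => simp only [map_add, hx, hy, mul_add]
  | tmul q r =>
    have h : (Δ a).left (TensorProduct.comm ℂ A A (T₁ (cop Δ) (q ⊗ₜ r))) =
        TensorProduct.comm ℂ A A (T₁ (cop Δ) ((a * q) ⊗ₜ r)) := by
      rw [T₁_mul_tmul_left hN hc', cop_apply, flip_left, comm_comm]
    rw [h, sliceRight_comm_T₁_cop hA hε, sliceRight_comm_T₁_cop hA hε, mul_assoc]

/-- The map `a ⊗ c ↦ (ι ⊗ ε)(Δ(a)(1 ⊗ c))`. -/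
def rightUnitMap (Δ : A →ₙₐ[ℂ] Multiplier (A ⊗[ℂ] A)) (ε : A →ₗ[ℂ] ℂ) : A ⊗[ℂ] A →ₗ[ℂ] A :=
  sliceRight ε ∘ₗ T₁ Δ

theorem rightUnitMap_apply (ε : A →ₗ[ℂ] ℂ) (t : A ⊗[ℂ] A) :
    rightUnitMap Δ ε t = sliceRight ε (T₁ Δ t) := rfl

/-- Both sides are `(ι ⊗ ε)(Δ(a)(b ⊗ c))`. Thus `rightUnitMap` and `leftUnitMap`, with `c` fixed,
behave as the right and left halves of one multiplier `(ι ⊗ ε)(E(1 ⊗ c))`. -/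
theorem rightUnitMap_mul (hA : IsRegularWeakMultiplierHopfAlgebra Δ)
    {E : Multiplier (A ⊗[ℂ] A)} (hE : IsCanonicalIdempotent Δ E) {ε : A →ₗ[ℂ] ℂ}
    (hε : IsCounit Δ ε) (a b c : A) :
    rightUnitMap Δ ε (a ⊗ₜ c) * b = a * leftUnitMap E ε (b ⊗ₜ c) := by
  rw [← sliceRight_coproduct_left hA hE hε,
    coproduct_left_tmul hA.weak.nondegenerate hA.weak.coproduct, sliceRight_rTensor]
  rfl

/-- The map `b ⊗ c ↦ (ι ⊗ ε)(Δ(a)(1 ⊗ c)) ⊗ b`. -/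
def crossMap (Δ : A →ₙₐ[ℂ] Multiplier (A ⊗[ℂ] A)) (ε : A →ₗ[ℂ] ℂ) (a : A) :
    A ⊗[ℂ] A →ₗ[ℂ] A ⊗[ℂ] A :=
  (TensorProduct.comm ℂ A A).toLinearMap ∘ₗ
    LinearMap.lTensor A (rightUnitMap Δ ε ∘ₗ TensorProduct.mk ℂ A A a)

theorem crossMap_tmul (ε : A →ₗ[ℂ] ℂ) (a b c : A) :
    crossMap Δ ε a (b ⊗ₜ c) = rightUnitMap Δ ε (a ⊗ₜ c) ⊗ₜ b := rfl

theorem coprodTensorId_left_tmul (p q : A) (x y z : A) :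
    (coprodTensorId Δ (p ⊗ₜ q)).left (x ⊗ₜ (y ⊗ₜ z)) =
      TensorProduct.assoc ℂ A A A ((Δ p).left (x ⊗ₜ y) ⊗ₜ (q * z)) := rfl

theorem idTensorCoprod_left_tmul (p q x : A) (t : A ⊗[ℂ] A) :
    (idTensorCoprod Δ (p ⊗ₜ q)).left (x ⊗ₜ t) = (p * x) ⊗ₜ (Δ q).left t := rfl

theorem eq_of_mul_tmul_tmul (hN : IsNondegenerateAlgebra A) {s t : A ⊗[ℂ] (A ⊗[ℂ] A)}
    (h : ∀ x y z, s * x ⊗ₜ[ℂ] (y ⊗ₜ[ℂ] z) = t * x ⊗ₜ[ℂ] (y ⊗ₜ[ℂ] z)) : s = t := by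
  refine eq_of_mul_tmul hN (hN.tensor hN) fun x w => ?_
  induction w using TensorProduct.induction_on with
  | zero => simp
  | add u v hu hv => simp only [TensorProduct.tmul_add, mul_add, hu, hv]
  | tmul y z => exact h x y z

theorem assoc_tmul_mul (s : A ⊗[ℂ] A) (q x y z : A) :
    TensorProduct.assoc ℂ A A A (s ⊗ₜ q) * x ⊗ₜ[ℂ] (y ⊗ₜ[ℂ] z) =
      TensorProduct.assoc ℂ A A A ((s * x ⊗ₜ y) ⊗ₜ (q * z)) := by
  rw [← Algebra.TensorProduct.tmul_mul_tmul, assoc_mul, TensorProduct.assoc_tmul]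

theorem assoc_rTensor_mulLeft (d : A) (s : A ⊗[ℂ] A) (q : A) :
    TensorProduct.assoc ℂ A A A (LinearMap.rTensor A (LinearMap.mulLeft ℂ d) s ⊗ₜ q) =
      LinearMap.rTensor (A ⊗[ℂ] A) (LinearMap.mulLeft ℂ d)
        (TensorProduct.assoc ℂ A A A (s ⊗ₜ q)) := by
  induction s using TensorProduct.induction_on with
  | zero => simp
  | add x y hx hy => simp only [map_add, hx, hy, TensorProduct.add_tmul]
  | tmul a b => simp

/-- `v ↦ Δ(v) y`. -/
def coproductAt (Δ : A →ₙₐ[ℂ] Multiplier (A ⊗[ℂ] A)) (y : A ⊗[ℂ] A) : A →ₗ[ℂ] A ⊗[ℂ] A :=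
  Multiplier.leftₗ.flip y ∘ₗ (Δ : A →ₗ[ℂ] Multiplier (A ⊗[ℂ] A))

theorem coproductAt_apply (y : A ⊗[ℂ] A) (v : A) : coproductAt Δ y v = (Δ v).left y := rfl

/-- `p ↦ Δ(p)(1 ⊗ b)`. -/
def T₁At (Δ : A →ₙₐ[ℂ] Multiplier (A ⊗[ℂ] A)) (b : A) : A →ₗ[ℂ] A ⊗[ℂ] A :=
  T₁ Δ ∘ₗ (TensorProduct.mk ℂ A A).flip b

theorem T₁At_apply (b p : A) : T₁At Δ b p = T₁ Δ (p ⊗ₜ b) := rfl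

theorem assoc_rTensor_T₁At_mul (hN : IsNondegenerateAlgebra A) (hc : IsCoproduct Δ)
    (b d x y z : A) (t : A ⊗[ℂ] A) :
    TensorProduct.assoc ℂ A A A (LinearMap.rTensor A
        (LinearMap.rTensor A (LinearMap.mulLeft ℂ d) ∘ₗ T₁At Δ b) t) * x ⊗ₜ (y ⊗ₜ z) =
      (tens (embed d) 1).left ((coprodTensorId Δ t).left (x ⊗ₜ ((b * y) ⊗ₜ z))) := by
  induction t using TensorProduct.induction_on with
  | zero =>
    simp only [map_zero, zero_mul]
    exact (map_zero (tens (embed d) (1 : Multiplier (A ⊗[ℂ] A))).left).symm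
  | add u v hu hv => simp only [map_add, add_mul, hu, hv, Multiplier.left_add]
  | tmul p q =>
    rw [coprodTensorId_left_tmul, LinearMap.rTensor_tmul, LinearMap.comp_apply, T₁At_apply,
      assoc_tmul_mul, ← rTensor_mulLeft_mul, T₁_mul_tmul hN hc, assoc_rTensor_mulLeft]
    rfl

theorem lTensor_coproductAt_mul (b c x y z : A) (t : A ⊗[ℂ] A) :
    LinearMap.lTensor A (coproductAt Δ (b ⊗ₜ c)) t * x ⊗ₜ (y ⊗ₜ z) =
      (idTensorCoprod Δ t).left (x ⊗ₜ ((b * y) ⊗ₜ (c * z))) := by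
  induction t using TensorProduct.induction_on with
  | zero =>
    simp only [map_zero, zero_mul]
    rfl
  | add u v hu hv => simp only [map_add, add_mul, hu, hv, Multiplier.left_add]
  | tmul p q =>
    rw [LinearMap.lTensor_tmul, coproductAt_apply, Algebra.TensorProduct.tmul_mul_tmul,
      ← Multiplier.left_mul, Algebra.TensorProduct.tmul_mul_tmul, idTensorCoprod_left_tmul]

/-- Coassociativity for elements of `A ⊗ A ⊗ A`: `d a₁ ⊗ a₂ b ⊗ a₃ c`. -/
theorem coassoc_tensor (hN : IsNondegenerateAlgebra A) (hc : IsCoproduct Δ) (a b c d : A) :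
    TensorProduct.assoc ℂ A A A (LinearMap.rTensor A
        (LinearMap.rTensor A (LinearMap.mulLeft ℂ d) ∘ₗ T₁At Δ b) (T₁ Δ (a ⊗ₜ c))) =
      LinearMap.lTensor A (coproductAt Δ (b ⊗ₜ c)) (T₂ Δ (d ⊗ₜ a)) := by
  refine eq_of_mul_tmul_tmul hN fun x y z => ?_
  rw [assoc_rTensor_T₁At_mul hN hc, lTensor_coproductAt_mul, ← Multiplier.mul_left_apply,
    hc.coassoc, Multiplier.mul_left_apply]
  rfl

/-- Slicing the third leg of coassociativity with `ε` turns one side into `T₁` of the cross map and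
the other into `Δ(a)(1 ⊗ (ι ⊗ ε)(Et))`. So `crossMap Δ ε a t` and `a ⊗ leftUnitMap E ε t` agree
modulo `ker T₁`. -/
theorem T₁_crossMap (hA : IsRegularWeakMultiplierHopfAlgebra Δ)
    {E : Multiplier (A ⊗[ℂ] A)} (hE : IsCanonicalIdempotent Δ E) {ε : A →ₗ[ℂ] ℂ}
    (hε : IsCounit Δ ε) (a : A) (t : A ⊗[ℂ] A) :
    T₁ Δ (crossMap Δ ε a t) = T₁ Δ (a ⊗ₜ leftUnitMap E ε t) := by
  have hN := hA.weak.nondegenerate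
  have hc := hA.weak.coproduct
  induction t using TensorProduct.induction_on with
  | zero => simp
  | add x y hx hy => simp only [map_add, TensorProduct.tmul_add, hx, hy]
  | tmul b c =>
    refine eq_of_rTensor_mulLeft hN fun d => ?_
    have h := congrArg (LinearMap.lTensor A (sliceRight ε)) (coassoc_tensor hN hc a b c d)
    have hl : ∀ t : A ⊗[ℂ] A, LinearMap.lTensor A (sliceRight ε)
        (TensorProduct.assoc ℂ A A A (LinearMap.rTensor A
          (LinearMap.rTensor A (LinearMap.mulLeft ℂ d) ∘ₗ T₁At Δ b) t)) =
        LinearMap.rTensor A (LinearMap.mulLeft ℂ d) (T₁At Δ b (sliceRight ε t)) := by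
      intro t
      induction t using TensorProduct.induction_on with
      | zero => simp
      | add x y hx hy => simp only [map_add, hx, hy]
      | tmul p q =>
        rw [LinearMap.rTensor_tmul, lTensor_sliceRight_assoc, sliceRight_tmul, map_smul, map_smul]
        rfl
    have hr : sliceRight ε ∘ₗ coproductAt Δ (b ⊗ₜ c) =
        LinearMap.mulRight ℂ (leftUnitMap E ε (b ⊗ₜ c)) := by
      refine LinearMap.ext fun v => ?_
      rw [LinearMap.comp_apply, coproductAt_apply, sliceRight_coproduct_left hA hE hε]
      rfl
    rw [hl, ← LinearMap.lTensor_comp_apply, hr, ← rTensor_mulLeft_T₁ hN hc] at h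
    exact h

theorem tensOne_left_assoc (E : Multiplier (A ⊗[ℂ] A)) (s : A ⊗[ℂ] A) (q : A) :
    (tensOne E).left (TensorProduct.assoc ℂ A A A (s ⊗ₜ q)) =
      TensorProduct.assoc ℂ A A A (E.left s ⊗ₜ q) := by
  rw [tensOne, transport_left, LinearEquiv.symm_apply_apply]
  rfl

/-- This is `(ι ⊗ Δ)E = (E ⊗ 1)(1 ⊗ E)` read on elements; the factor `1 ⊗ E` disappears because `E`
fixes the range of `T₁`. -/
theorem tensOne_left_T₁ (hN : IsNondegenerateAlgebra A) (hc : IsCoproduct Δ)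
    {E : Multiplier (A ⊗[ℂ] A)} (hE : IsCanonicalIdempotent Δ E)
    (hx : IsExtensionValue (idTensorCoprod Δ) (oneTens E) E (tensOne E * oneTens E)) (x y z : A) :
    (tensOne E).left (x ⊗ₜ T₁ Δ (y ⊗ₜ z)) = LinearMap.lTensor A (T₁At Δ z) (E.left (x ⊗ₜ y)) := by
  refine eq_of_mul_tmul_tmul hN fun u v w => ?_
  have hr : ∀ t : A ⊗[ℂ] A, LinearMap.lTensor A (T₁At Δ z) t * u ⊗ₜ (v ⊗ₜ w) =
      (idTensorCoprod Δ t).left (u ⊗ₜ (v ⊗ₜ (z * w))) := by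
    intro t
    induction t using TensorProduct.induction_on with
    | zero => simp [Multiplier.left]
    | add u v hu hv => simp only [map_add, add_mul, hu, hv, Multiplier.left_add]
    | tmul p q =>
      rw [LinearMap.lTensor_tmul, Algebra.TensorProduct.tmul_mul_tmul, T₁At_apply,
        T₁_mul_tmul hN hc]
      rfl
  have h3 : (oneTens E).left (x ⊗ₜ T₁ Δ (y ⊗ₜ z)) = x ⊗ₜ T₁ Δ (y ⊗ₜ z) := by
    change x ⊗ₜ E.left (T₁ Δ (y ⊗ₜ z)) = _
    rw [hE.left_T₁]
  rw [hr, ← hx.2.2.1, ← h3, ← Multiplier.mul_left_apply, ← Multiplier.left_mul,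
    Multiplier.mul_left_apply _ (idTensorCoprod Δ _), ← hr]
  rfl

/-- Applying `ι ⊗ ε ⊗ ι` to `tensOne_left_T₁` expresses `E(x ⊗ yz)` as an element of `V ⊗ A`, where
`V` is the range in question. Hence the range of `T₁` lies in `V ⊗ A`, and fullness gives `V = A`.
-/
theorem leftUnitMap_surjective (hA : IsRegularWeakMultiplierHopfAlgebra Δ)
    {E : Multiplier (A ⊗[ℂ] A)} (hE : IsCanonicalIdempotent Δ E)
    (hx : IsExtensionValue (idTensorCoprod Δ) (oneTens E) E (tensOne E * oneTens E))
    {ε : A →ₗ[ℂ] ℂ} (hε : IsCounit Δ ε) : LinearMap.range (leftUnitMap E ε) = ⊤ := by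
  have hN := hA.weak.nondegenerate
  have hc := hA.weak.coproduct
  apply hA.weak.full.1
  set V := LinearMap.range (leftUnitMap E ε) with hV
  have key : ∀ t, E.left t ∈ LinearMap.range (LinearMap.rTensor A V.subtype) := by
    intro t
    refine tensor_span_induction (S := Set.univ) Submodule.span_univ hA.weak.idempotent
      (P := fun t => E.left t ∈ LinearMap.range (LinearMap.rTensor A V.subtype)) ?_ ?_ ?_ ?_ t
    · rw [map_zero]; exact Submodule.zero_mem _
    · intro x y h1 h2; rw [map_add]; exact Submodule.add_mem _ h1 h2
    · intro c x h1; rw [map_smul]; exact Submodule.smul_mem _ c h1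
    rintro x - _ ⟨y, z, rfl⟩
    have h := congrArg (LinearMap.lTensor A (sliceLeft ε)) (tensOne_left_T₁ hN hc hE hx x y z)
    have h1 : sliceLeft ε ∘ₗ T₁At Δ z = LinearMap.mulRight ℂ z :=
      LinearMap.ext fun y => hε.1 y z
    rw [← LinearMap.lTensor_comp_apply, h1, ← left_lTensor_mulRight hN hN] at h
    change _ = E.left (x ⊗ₜ (y * z)) at h
    rw [← h]
    clear h
    induction T₁ Δ (y ⊗ₜ z) using TensorProduct.induction_on with
    | zero => simp
    | add s t hs ht =>
      rw [TensorProduct.tmul_add, map_add, map_add]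
      exact Submodule.add_mem _ hs ht
    | tmul u v =>
      rw [← TensorProduct.assoc_tmul, tensOne_left_assoc, lTensor_sliceLeft_assoc]
      exact ⟨(⟨leftUnitMap E ε (x ⊗ₜ u), ⟨_, rfl⟩⟩ : V) ⊗ₜ v, rfl⟩
  rintro _ ⟨t, rfl⟩
  rw [← hE.left_T₁]
  exact key _

theorem rightUnitMap_surjective (hA : IsRegularWeakMultiplierHopfAlgebra Δ)
    {E : Multiplier (A ⊗[ℂ] A)} (hE : IsCanonicalIdempotent Δ E)
    (hx : IsExtensionValue (idTensorCoprod Δ) (oneTens E) E (tensOne E * oneTens E))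
    {ε : A →ₗ[ℂ] ℂ} (hε : IsCounit Δ ε) : LinearMap.range (rightUnitMap Δ ε) = ⊤ := by
  rw [eq_top_iff, ← leftUnitMap_surjective hA hE hx hε]
  rintro _ ⟨t, rfl⟩
  obtain ⟨s, hs⟩ := hE.exists_T₁ t
  exact ⟨s, by rw [rightUnitMap_apply, hs]; rfl⟩

/-- Linear maps on `A ⊗ A` are determined by their values on the ranges of the maps `crossMap`. -/
theorem ext_crossMap {ε : A →ₗ[ℂ] ℂ} (hψ : LinearMap.range (rightUnitMap Δ ε) = ⊤)
    {W : Type*} [AddCommGroup W] [Module ℂ W] {f g : A ⊗[ℂ] A →ₗ[ℂ] W}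
    (h : ∀ a b c, f (crossMap Δ ε a (b ⊗ₜ c)) = g (crossMap Δ ε a (b ⊗ₜ c))) : f = g := by
  refine TensorProduct.ext' fun x b => ?_
  have hx : x ∈ LinearMap.range (rightUnitMap Δ ε) := hψ ▸ Submodule.mem_top
  obtain ⟨t, rfl⟩ := hx
  induction t using TensorProduct.induction_on with
  | zero => simp
  | add s t hs ht => simp only [map_add, TensorProduct.add_tmul, hs, ht]
  | tmul a c => exact h a b c

theorem leg13_tmul_mul (s : A ⊗[ℂ] A) (b x u v : A) :
    leg13 (s ⊗ₜ b) * x ⊗ₜ[ℂ] (u ⊗ₜ[ℂ] v) = leg13 ((s * x ⊗ₜ v) ⊗ₜ (b * u)) := by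
  rw [← Algebra.TensorProduct.tmul_mul_tmul, leg13_mul]
  rfl

theorem coprod13_left_leg13 (a : A) (s : A ⊗[ℂ] A) (b : A) :
    (coprod13 Δ a).left (leg13 (s ⊗ₜ b)) = leg13 ((Δ a).left s ⊗ₜ b) := by
  rw [coprod13, transport_left, LinearEquiv.symm_apply_apply]
  rfl

/-- The defining identity of `G₁` is sliced with `ε` in the third leg. `G` touches only the first
two legs and survives, and both sides become cross maps, the right one evaluated at `E(b ⊗ c)`. -/
theorem IsG₁.crossMap (hN : IsNondegenerateAlgebra A) (hc : IsCoproduct Δ)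
    {E : Multiplier (A ⊗[ℂ] A)} {G : A ⊗[ℂ] A →ₗ[ℂ] A ⊗[ℂ] A} (hG : IsG₁ Δ E G)
    (ε : A →ₗ[ℂ] ℂ) (a : A) (t : A ⊗[ℂ] A) :
    G (crossMap Δ ε a t) = crossMap Δ ε a (E.left t) := by
  induction t using TensorProduct.induction_on with
  | zero => simp
  | add s t hs ht => simp only [map_add, hs, ht]
  | tmul b c =>
    let Λ : A ⊗[ℂ] A →ₗ[ℂ] A ⊗[ℂ] (A ⊗[ℂ] A) := leg13.toLinearMap ∘ₗ
      (TensorProduct.comm ℂ A (A ⊗[ℂ] A)).toLinearMap ∘ₗ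
      LinearMap.lTensor A (T₁ Δ ∘ₗ TensorProduct.mk ℂ A A a)
    have hΛ : ∀ b c, Λ (b ⊗ₜ c) = leg13 (T₁ Δ (a ⊗ₜ c) ⊗ₜ b) := fun b c => rfl
    -- `Λ` sends `b ⊗ c` to `Δ₁₃(a)(1 ⊗ b ⊗ c)`; slicing its third leg recovers the cross map.
    have hs : ∀ t, LinearMap.lTensor A (sliceRight ε) (Λ t) = WMHA.crossMap Δ ε a t := by
      intro t
      induction t using TensorProduct.induction_on with
      | zero => simp
      | add s t hs ht => simp only [map_add, hs, ht]
      | tmul b c => rw [hΛ, lTensor_sliceRight_leg13]; rfl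
    have he : ∀ y, coprod13 Δ a * tens 1 (embed y) = embed (Λ y) := by
      intro y
      induction y using TensorProduct.induction_on with
      | zero => simp
      | add s t hs ht => simp only [map_add, mul_add, hs, ht]
      | tmul b c =>
        refine Multiplier.left_injective (hN.tensor (hN.tensor hN)) fun w => ?_
        obtain ⟨w, rfl⟩ := leg13.surjective w
        induction w using TensorProduct.induction_on with
        | zero => simp
        | add s t hs ht => simp only [map_add, hs, ht]
        | tmul s u =>
          induction s using TensorProduct.induction_on with
          | zero => simp
          | add s t hs ht => simp only [map_add, TensorProduct.add_tmul, hs, ht]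
          | tmul x v =>
            rw [Multiplier.mul_left_apply, embed_left, hΛ]
            have h1 : leg13 (x ⊗ₜ[ℂ] v ⊗ₜ[ℂ] u) = x ⊗ₜ[ℂ] (u ⊗ₜ[ℂ] v) := rfl
            have h2 : (tens 1 (embed (b ⊗ₜ[ℂ] c))).left (x ⊗ₜ[ℂ] (u ⊗ₜ[ℂ] v)) =
                leg13 (x ⊗ₜ[ℂ] (c * v) ⊗ₜ[ℂ] (b * u)) := by
              change x ⊗ₜ[ℂ] (b ⊗ₜ[ℂ] c * u ⊗ₜ[ℂ] v) = _
              rw [Algebra.TensorProduct.tmul_mul_tmul]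
              rfl
            rw [h1, h2, coprod13_left_leg13, leg13_tmul_mul, T₁_mul_tmul hN hc]
    have h := hG a b c
    rw [tens_embed_embed, mul_assoc, oneTens, tens_mul_tens, one_mul, Multiplier.embed_mul_eq,
      he] at h
    have h' := embed_injective (hN.tensor (hN.tensor hN)) h
    have h'' := congrArg (LinearMap.lTensor A (sliceRight ε)) h'
    rw [lTensor_sliceRight_onLegs12, ← hΛ, hs, hs] at h''
    exact h''

theorem crossMap_rTensor_mulRight (ε : A →ₗ[ℂ] ℂ) (a c : A) (t : A ⊗[ℂ] A) :
    crossMap Δ ε a (LinearMap.rTensor A (LinearMap.mulRight ℂ c) t) =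
      LinearMap.lTensor A (LinearMap.mulRight ℂ c) (crossMap Δ ε a t) := by
  induction t using TensorProduct.induction_on with
  | zero => simp
  | add s t hs ht => simp only [map_add, hs, ht]
  | tmul b d => rfl

/-- The properties of the projection `G₁` along the kernel of `T₁`. -/
structure IsKernelProjection (Δ : A →ₙₐ[ℂ] Multiplier (A ⊗[ℂ] A)) (E : Multiplier (A ⊗[ℂ] A))
    (ε : A →ₗ[ℂ] ℂ) (G : A ⊗[ℂ] A →ₗ[ℂ] A ⊗[ℂ] A) : Prop where
  rightUnit_surjective : LinearMap.range (rightUnitMap Δ ε) = ⊤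
  leftUnit_surjective : LinearMap.range (leftUnitMap E ε) = ⊤
  map_crossMap : ∀ a t, G (crossMap Δ ε a t) = crossMap Δ ε a (E.left t)
  idem : ∀ t, G (G t) = G t
  map_mulRight : ∀ c t, G (LinearMap.lTensor A (LinearMap.mulRight ℂ c) t) =
    LinearMap.lTensor A (LinearMap.mulRight ℂ c) (G t)
  T₁_map : ∀ t, T₁ Δ (G t) = T₁ Δ t
  map_eq_zero : ∀ t, T₁ Δ t = 0 → G t = 0

/-- The ranges of the cross maps span `A ⊗ A`, and there `G` is given by `E`. Idempotency and right
linearity of `G` are thus inherited from `E`; the rest is `ker T₁ = (1 - G)(A ⊗ A)`. -/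
theorem exists_isKernelProjection (hA : IsRegularWeakMultiplierHopfAlgebra Δ)
    {E : Multiplier (A ⊗[ℂ] A)} (hE : IsCanonicalIdempotent Δ E) {ε : A →ₗ[ℂ] ℂ}
    (hε : IsCounit Δ ε) : ∃ G, IsKernelProjection Δ E ε G := by
  have hN := hA.weak.nondegenerate
  have hc := hA.weak.coproduct
  obtain ⟨F, hF, hx, -, ⟨G, hG, hker⟩, -⟩ := hA.weak.canonical
  obtain rfl := hE.unique hN hF
  have hψ := rightUnitMap_surjective hA hE hx hε
  have hcross := hG.crossMap hN hc ε
  have hidem : ∀ t, G (G t) = G t := by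
    have : G ∘ₗ G = G := ext_crossMap hψ fun a b c => by
      rw [LinearMap.comp_apply, hcross, hcross, ← Multiplier.mul_left_apply, hE.idem]
    exact LinearMap.congr_fun this
  refine ⟨G, hψ, leftUnitMap_surjective hA hE hx hε, hcross, hidem, ?_, ?_, ?_⟩
  · intro c
    have : G ∘ₗ LinearMap.lTensor A (LinearMap.mulRight ℂ c) =
        LinearMap.lTensor A (LinearMap.mulRight ℂ c) ∘ₗ G := ext_crossMap hψ fun a b d => by
      rw [LinearMap.comp_apply, LinearMap.comp_apply, ← crossMap_rTensor_mulRight, hcross, hcross,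
        left_rTensor_mulRight hN hN, crossMap_rTensor_mulRight]
    exact LinearMap.congr_fun this
  · intro t
    have : t - G t ∈ LinearMap.ker (T₁ Δ) := by rw [hker]; exact ⟨t, rfl⟩
    rw [LinearMap.mem_ker, map_sub, sub_eq_zero] at this
    exact this.symm
  · intro t ht
    have : t ∈ LinearMap.ker (T₁ Δ) := ht
    rw [hker] at this
    obtain ⟨s, rfl⟩ := this
    rw [LinearMap.sub_apply, LinearMap.id_apply, map_sub, hidem, sub_self]

theorem IsKernelProjection.map_eq {E : Multiplier (A ⊗[ℂ] A)} {ε : A →ₗ[ℂ] ℂ}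
    {G : A ⊗[ℂ] A →ₗ[ℂ] A ⊗[ℂ] A} (hG : IsKernelProjection Δ E ε G) {s t : A ⊗[ℂ] A}
    (h : T₁ Δ s = T₁ Δ t) : G s = G t := by
  rw [← sub_eq_zero, ← map_sub]
  exact hG.map_eq_zero _ (by rw [map_sub, h, sub_self])

/-- `Δ(a)(1 ⊗ z)` lies in `A ⊗ Az`, since it does after left multiplication by every `d ⊗ 1`. It
therefore equals `T₁` of some `s(1 ⊗ z)`, and `G` depends only on the image under `T₁` and commutes
with `1 ⊗ z`. -/
theorem IsKernelProjection.map_tmul_mem_range {E : Multiplier (A ⊗[ℂ] A)} {ε : A →ₗ[ℂ] ℂ}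
    {G : A ⊗[ℂ] A →ₗ[ℂ] A ⊗[ℂ] A} (hG : IsKernelProjection Δ E ε G)
    (hN : IsNondegenerateAlgebra A) (hc : IsCoproduct Δ) (hE : IsCanonicalIdempotent Δ E)
    (a z : A) :
    G (a ⊗ₜ z) ∈ LinearMap.range (LinearMap.lTensor A (LinearMap.mulRight ℂ z)) := by
  have h : T₁ Δ (a ⊗ₜ z) ∈ LinearMap.range (LinearMap.lTensor A (LinearMap.mulRight ℂ z)) := by
    refine mem_range_lTensor_of_forall (fun d : A => LinearMap.mulLeft ℂ d)
      (fun v hv => hN.2 v hv) _ fun d => ?_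
    rw [rTensor_mulLeft_T₁ hN hc]
    exact ⟨_, rfl⟩
  obtain ⟨t, ht⟩ := h
  obtain ⟨s, hs⟩ := hE.exists_T₁ t
  have h2 : T₁ Δ (a ⊗ₜ z) = T₁ Δ (LinearMap.lTensor A (LinearMap.mulRight ℂ z) s) := by
    rw [T₁_lTensor_mulRight hN hc, hs, ← left_lTensor_mulRight hN hN, ht, hE.left_T₁]
  rw [hG.map_eq h2, hG.map_mulRight]
  exact ⟨_, rfl⟩

/-- It is shown that `z` vanishes in `A/Az`. With `z = φ(y)` for `φ = leftUnitMap E ε`, this class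
is obtained by evaluating the tensor `∑ θ_c ⊗ [d]`, where `Ey = ∑ d ⊗ c`, and that tensor is zero.
-/
theorem exists_mul_eq_self (hA : IsRegularWeakMultiplierHopfAlgebra Δ) (z : A) :
    ∃ e : A, e * z = z := by
  have hN := hA.weak.nondegenerate
  have hc := hA.weak.coproduct
  obtain ⟨E, hE, -⟩ := hA.weak.canonical
  obtain ⟨ε, hε⟩ := hA.weak.counit
  obtain ⟨G, hG⟩ := exists_isKernelProjection hA hE hε
  have hz : z ∈ LinearMap.range (leftUnitMap E ε) := hG.leftUnit_surjective ▸ Submodule.mem_top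
  obtain ⟨y, hy⟩ := hz
  set N := LinearMap.range (LinearMap.mulRight ℂ z) with hNdef
  -- `θ c` is left multiplication by the multiplier `(ι ⊗ ε)(E(1 ⊗ c))`.
  let θ : A →ₗ[ℂ] A →ₗ[ℂ] A := (TensorProduct.curry (leftUnitMap E ε)).flip
  have hθ : ∀ c b, θ c b = leftUnitMap E ε (b ⊗ₜ c) := fun _ _ => rfl
  have hθmul : ∀ c b d, θ c (b * d) = θ c b * d := by
    intro c b d
    have : (b * d) ⊗ₜ[ℂ] c = LinearMap.rTensor A (LinearMap.mulRight ℂ d) (b ⊗ₜ c) := rfl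
    rw [hθ, hθ, this, leftUnitMap_apply, left_rTensor_mulRight hN hN, sliceRight_rTensor]
    rfl
  let S := LinearMap.range θ
  let θ' : A →ₗ[ℂ] S := θ.rangeRestrict
  -- The element equals `G(a ⊗ z)`, because `crossMap Δ ε a y` and `a ⊗ z` have the same image under
  -- `T₁`; and `G(a ⊗ z)` lies in `A ⊗ Az`.
  have hz' : ∀ a, LinearMap.lTensor A N.mkQ (crossMap Δ ε a (E.left y)) = 0 := by
    intro a
    obtain ⟨w, hw⟩ := hG.map_tmul_mem_range hN hc hE a z
    rw [← hG.map_crossMap, hG.map_eq (T₁_crossMap hA hE hε a y), hy, ← hw,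
      ← LinearMap.lTensor_comp_apply]
    have : N.mkQ ∘ₗ LinearMap.mulRight ℂ z = 0 := LinearMap.ext fun b => by
      simp only [LinearMap.comp_apply, Submodule.mkQ_apply, LinearMap.zero_apply]
      exact (Submodule.Quotient.mk_eq_zero _).2 ⟨b, rfl⟩
    rw [this, LinearMap.lTensor_zero, LinearMap.zero_apply]
  -- Operators `θ_c` are separated by the elements `a θ_c(b) = ψ(a ⊗ c)b`, with `ψ = rightUnitMap Δ
  -- ε`, so the vanishing found for each `a` lifts to operators.
  have h0 : TensorProduct.map θ' N.mkQ (TensorProduct.comm ℂ A A (E.left y)) = 0 := by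
    refine eq_zero_of_forall_rTensor
      (fun p : A × A => LinearMap.mulLeft ℂ p.1 ∘ₗ LinearMap.applyₗ p.2 ∘ₗ S.subtype) ?_ _ ?_
    · intro v hv
      apply Subtype.ext
      refine LinearMap.ext fun b => hN.2 _ fun a => hv (a, b)
    · rintro ⟨a, b⟩
      have h1 : ∀ t : A ⊗[ℂ] A, LinearMap.rTensor (A ⧸ N)
          (LinearMap.mulLeft ℂ a ∘ₗ LinearMap.applyₗ b ∘ₗ S.subtype)
            (TensorProduct.map θ' N.mkQ (TensorProduct.comm ℂ A A t)) =
          LinearMap.rTensor (A ⧸ N) (LinearMap.mulRight ℂ b)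
            (LinearMap.lTensor A N.mkQ (crossMap Δ ε a t)) := by
        intro t
        induction t using TensorProduct.induction_on with
        | zero => simp
        | add s t hs ht => simp only [map_add, hs, ht]
        | tmul d c =>
          rw [crossMap_tmul, LinearMap.lTensor_tmul, LinearMap.rTensor_tmul,
            LinearMap.mulRight_apply, rightUnitMap_mul hA hE hε]
          rfl
      change LinearMap.rTensor (A ⧸ N)
          (LinearMap.mulLeft ℂ a ∘ₗ LinearMap.applyₗ b ∘ₗ S.subtype) _ = 0
      rw [h1, hz', map_zero]
  -- Right linearity `θ_c(bz) = θ_c(b)z` makes the operators descend to `A/Az`, where they can be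
  -- evaluated on `[d]`.
  have hS : ∀ s : S, N ≤ N.comap (s : A →ₗ[ℂ] A) := by
    rintro ⟨_, c, rfl⟩ _ ⟨b, rfl⟩
    exact ⟨θ c b, (hθmul c b z).symm⟩
  let β : S →ₗ[ℂ] (A ⧸ N) →ₗ[ℂ] (A ⧸ N) :=
    { toFun := fun s => N.mapQ N (s : A →ₗ[ℂ] A) (hS s)
      map_add' := fun s t => by
        refine LinearMap.ext fun x => ?_
        obtain ⟨x, rfl⟩ := N.mkQ_surjective x
        rfl
      map_smul' := fun c t => by
        refine LinearMap.ext fun x => ?_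
        obtain ⟨x, rfl⟩ := N.mkQ_surjective x
        rfl }
  have h2 : ∀ t : A ⊗[ℂ] A, TensorProduct.lift β
      (TensorProduct.map θ' N.mkQ (TensorProduct.comm ℂ A A t)) = N.mkQ (leftUnitMap E ε t) := by
    intro t
    induction t using TensorProduct.induction_on with
    | zero => simp
    | add s t hs ht => simp only [map_add, hs, ht]
    | tmul d c => rfl
  have h3 : leftUnitMap E ε (E.left y) = z := by
    rw [leftUnitMap_apply, ← Multiplier.mul_left_apply, hE.idem]
    exact hy
  have h4 := h2 (E.left y)
  rw [h0, map_zero, h3] at h4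
  obtain ⟨e, he⟩ := (Submodule.Quotient.mk_eq_zero N).1 h4.symm
  exact ⟨e, he⟩

/-- `A` has left local units. -/
theorem exists_leftLocalUnit (hA : IsRegularWeakMultiplierHopfAlgebra Δ) (s : Finset A) :
    ∃ e : A, ∀ a ∈ s, e * a = a := by
  classical
  induction s using Finset.induction_on with
  | empty => exact ⟨0, by simp⟩
  | insert a s _ ih =>
    obtain ⟨e, he⟩ := ih
    obtain ⟨f, hf⟩ := exists_mul_eq_self hA (a - e * a)
    -- Formally `1 - (e + f - fe) = (1 - f)(1 - e)`: the factor `1 - e` kills the old elements, and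
    -- `1 - f` kills what remains of the new one.
    refine ⟨e + f - f * e, fun b hb => ?_⟩
    rw [sub_mul, add_mul, mul_assoc]
    rcases Finset.mem_insert.1 hb with rfl | hb
    · rw [mul_sub] at hf
      rw [add_sub_assoc, hf, add_sub_cancel]
    · rw [he b hb, add_sub_cancel_right]

end LocalUnits

/-! ### Extension of unital non-degenerate modules to multiplier algebras. -/

section SmoothModules

variable {B : Type*} [NonUnitalRing B] [Module ℂ B] [IsScalarTower ℂ B B] [SMulCommClass ℂ B B]
  {C : Type*} [NonUnitalRing C] [Module ℂ C] [IsScalarTower ℂ C C] [SMulCommClass ℂ C C]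
  {D : Type*} [NonUnitalRing D] [Module ℂ D] [IsScalarTower ℂ D D] [SMulCommClass ℂ D D]
  {V : Type*} [AddCommGroup V] [Module ℂ V] {W : Type*} [AddCommGroup W] [Module ℂ W]
  {U : Type*} [AddCommGroup U] [Module ℂ U]

/-- The module is unital and non-degenerate. -/
structure IsSmooth (ρ : B →ₙₐ[ℂ] Module.End ℂ V) : Prop where
  unital : IsUnitalModule ρ
  nondegenerate : ∀ v, (∀ b, ρ b v = 0) → v = 0

variable {ρ : B →ₙₐ[ℂ] Module.End ℂ V} {σ : C →ₙₐ[ℂ] Module.End ℂ W}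
  {τ : D →ₙₐ[ℂ] Module.End ℂ U}

theorem IsUnitalModule.linearMap_ext (h : IsUnitalModule ρ) {f g : V →ₗ[ℂ] W}
    (hfg : ∀ b v, f (ρ b v) = g (ρ b v)) : f = g := by
  refine LinearMap.ext_on h ?_
  rintro _ ⟨b, v, rfl⟩
  exact hfg b v

theorem IsSmooth.eq (h : IsSmooth ρ) {v w : V} (hvw : ∀ b, ρ b v = ρ b w) : v = w := by
  rw [← sub_eq_zero]
  exact h.nondegenerate _ fun b => by rw [map_sub, hvw, sub_self]

theorem IsSmooth.ext_apply (h : IsSmooth ρ) (m : Multiplier B) (b : B) (v : V) :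
    extendedAction ρ m (ρ b v) = ρ (m.left b) v :=
  extendedAction_apply ρ h.unital h.nondegenerate m b v

theorem IsSmooth.ext_eq (h : IsSmooth ρ) {m : Multiplier B} {f : Module.End ℂ V}
    (hf : ∀ b v, f (ρ b v) = ρ (m.left b) v) : extendedAction ρ m = f :=
  h.unital.linearMap_ext fun b v => by rw [h.ext_apply, hf]

theorem IsSmooth.ext_mul (h : IsSmooth ρ) (m n : Multiplier B) (v : V) :
    extendedAction ρ (m * n) v = extendedAction ρ m (extendedAction ρ n v) := by
  have : extendedAction ρ (m * n) = extendedAction ρ m ∘ₗ extendedAction ρ n :=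
    h.ext_eq fun b v => by
      rw [LinearMap.comp_apply, h.ext_apply, h.ext_apply, Multiplier.mul_left_apply]
  rw [this, LinearMap.comp_apply]

theorem IsSmooth.ext_embed (h : IsSmooth ρ) (b : B) : extendedAction ρ (embed b) = ρ b :=
  h.ext_eq fun c v => by
    rw [← Module.End.mul_apply, ← map_mul]
    rfl

theorem IsSmooth.ext_one (h : IsSmooth ρ) : extendedAction ρ (1 : Multiplier B) = LinearMap.id :=
  h.ext_eq fun _ _ => rfl

theorem IsSmooth.ext_zero (h : IsSmooth ρ) : extendedAction ρ (0 : Multiplier B) = 0 :=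
  h.ext_eq fun b v => by
    have : (0 : Multiplier B).left b = 0 := rfl
    rw [this, map_zero]
    rfl

theorem IsSmooth.ext_add (h : IsSmooth ρ) (m n : Multiplier B) :
    extendedAction ρ (m + n) = extendedAction ρ m + extendedAction ρ n :=
  h.ext_eq fun b v => by
    rw [LinearMap.add_apply, h.ext_apply, h.ext_apply, Multiplier.left_add, map_add]
    rfl

theorem IsSmooth.apply_ext (h : IsSmooth ρ) (m : Multiplier B) (b : B) (v : V) :
    ρ b (extendedAction ρ m v) = ρ (m.right b) v := by
  rw [← h.ext_embed, ← h.ext_mul, Multiplier.mul_embed_eq, h.ext_embed]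

theorem IsSmooth.tensor (h : IsSmooth ρ) (k : IsSmooth σ) : IsSmooth (tensorAction ρ σ) where
  unital := by
    rw [IsUnitalModule, eq_top_iff]
    rintro t -
    refine tensor_span_induction h.unital k.unital
      (P := fun t => t ∈ Submodule.span ℂ {x | ∃ b v, x = tensorAction ρ σ b v})
      (Submodule.zero_mem _) (fun _ _ => Submodule.add_mem _) (fun c _ => Submodule.smul_mem _ c)
      ?_ t
    rintro _ ⟨b, v, rfl⟩ _ ⟨c, w, rfl⟩
    exact Submodule.subset_span ⟨b ⊗ₜ c, v ⊗ₜ w, rfl⟩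
  nondegenerate t ht := by
    refine eq_zero_of_forall_rTensor (fun b => ρ b) h.nondegenerate t fun b => ?_
    refine eq_zero_of_forall_lTensor (fun c => σ c) k.nondegenerate _ fun c => ?_
    rw [← LinearMap.comp_apply, LinearMap.lTensor_comp_rTensor]
    exact ht (b ⊗ₜ c)

theorem IsSmooth.ext_tens (h : IsSmooth ρ) (k : IsSmooth σ) (m : Multiplier B)
    (n : Multiplier C) : extendedAction (tensorAction ρ σ) (tens m n) =
      TensorProduct.map (extendedAction ρ m) (extendedAction σ n) := by
  refine (h.tensor k).ext_eq fun t x => ?_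
  induction t using TensorProduct.induction_on with
  | zero => simp
  | add s t hs ht => simp only [map_add, LinearMap.add_apply, hs, ht]
  | tmul b c =>
    induction x using TensorProduct.induction_on with
    | zero => simp
    | add s t hs ht => simp only [map_add, hs, ht]
    | tmul v w =>
      rw [tensorAction_tmul, TensorProduct.map_tmul, h.ext_apply, k.ext_apply]
      rfl

theorem IsSmooth.ext_transport (h : IsSmooth ρ) (k : IsSmooth σ) (e : B ≃ₗ[ℂ] C)
    (he : ∀ x y, e (x * y) = e x * e y) (φ : V ≃ₗ[ℂ] W)
    (hφ : ∀ b v, φ (ρ b v) = σ (e b) (φ v)) (m : Multiplier B) (v : V) :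
    extendedAction σ (transport e he m) (φ v) = φ (extendedAction ρ m v) := by
  have : extendedAction σ (transport e he m) =
      φ.toLinearMap ∘ₗ extendedAction ρ m ∘ₗ φ.symm.toLinearMap := by
    refine k.ext_eq fun c w => ?_
    obtain ⟨b, rfl⟩ := e.surjective c
    obtain ⟨v, rfl⟩ := φ.surjective w
    rw [← hφ, transport_left, e.symm_apply_apply, ← hφ]
    simp [h.ext_apply]
  rw [this]
  simp

theorem assoc_tensorAction (x : (B ⊗[ℂ] C) ⊗[ℂ] D) (v : (V ⊗[ℂ] W) ⊗[ℂ] U) :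
    TensorProduct.assoc ℂ V W U (tensorAction (tensorAction ρ σ) τ x v) =
      tensorAction ρ (tensorAction σ τ) (TensorProduct.assoc ℂ B C D x)
        (TensorProduct.assoc ℂ V W U v) := by
  induction x using TensorProduct.induction_on with
  | zero => simp
  | add s t hs ht => simp only [map_add, LinearMap.add_apply, hs, ht]
  | tmul y d =>
    induction y using TensorProduct.induction_on with
    | zero => simp
    | add s t hs ht => simp only [map_add, LinearMap.add_apply, TensorProduct.add_tmul, hs, ht]
    | tmul b c =>
      induction v using TensorProduct.induction_on with
      | zero => simp
      | add s t hs ht => simp only [map_add, hs, ht]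
      | tmul y u =>
        induction y using TensorProduct.induction_on with
        | zero => simp
        | add s t hs ht => simp only [map_add, TensorProduct.add_tmul, hs, ht]
        | tmul v w => rfl

end SmoothModules

/-! ### The smash product expressed by multipliers acting on `R ⊗ R ⊗ A`. -/

section SmashTools

variable {A : Type*} [NonUnitalRing A] [Module ℂ A] [IsScalarTower ℂ A A] [SMulCommClass ℂ A A]
  {R : Type*} [NonUnitalRing R] [Module ℂ R] [IsScalarTower ℂ R R] [SMulCommClass ℂ R R]
  {Δ : A →ₙₐ[ℂ] Multiplier (A ⊗[ℂ] A)} {act : A →ₙₐ[ℂ] Module.End ℂ R}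
  {E : Multiplier (A ⊗[ℂ] A)}

theorem isSmooth_leftRegular (hA : IsRegularWeakMultiplierHopfAlgebra Δ) :
    IsSmooth (leftRegular : A →ₙₐ[ℂ] Module.End ℂ A) where
  unital := hA.weak.idempotent
  nondegenerate := hA.weak.nondegenerate.2

theorem IsUnitalModule.exists_localUnit (hA : IsRegularWeakMultiplierHopfAlgebra Δ)
    {V : Type*} [AddCommGroup V] [Module ℂ V] {ρ : A →ₙₐ[ℂ] Module.End ℂ V}
    (hρ : IsUnitalModule ρ) (v : V) : ∃ e, ρ e v = v := by
  classical
  have hv : v ∈ Submodule.span ℂ {x : V | ∃ b v, x = ρ b v} := hρ ▸ Submodule.mem_top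
  -- A single unit must serve all summands of `v`, so the induction collects the algebra elements
  -- that occur.
  have key : ∃ s : Finset A, ∀ e, (∀ a ∈ s, e * a = a) → ρ e v = v := by
    induction hv using Submodule.span_induction with
    | zero => exact ⟨∅, by simp⟩
    | add x y _ _ hx hy =>
      obtain ⟨s, hs⟩ := hx
      obtain ⟨t, ht⟩ := hy
      refine ⟨s ∪ t, fun e he => ?_⟩
      rw [map_add, hs e fun a ha => he a (Finset.mem_union_left _ ha),
        ht e fun a ha => he a (Finset.mem_union_right _ ha)]
    | smul c x _ hx =>
      obtain ⟨s, hs⟩ := hx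
      exact ⟨s, fun e he => by rw [map_smul, hs e he]⟩
    | mem x hx =>
      obtain ⟨b, w, rfl⟩ := hx
      refine ⟨{b}, fun e he => ?_⟩
      rw [← Module.End.mul_apply, ← map_mul, he b (Finset.mem_singleton_self b)]
  obtain ⟨s, hs⟩ := key
  obtain ⟨e, he⟩ := exists_leftLocalUnit hA s
  exact ⟨e, hs e he⟩

theorem IsUnitalModule.isSmooth (hA : IsRegularWeakMultiplierHopfAlgebra Δ)
    {V : Type*} [AddCommGroup V] [Module ℂ V] {ρ : A →ₙₐ[ℂ] Module.End ℂ V}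
    (hρ : IsUnitalModule ρ) : IsSmooth ρ where
  unital := hρ
  nondegenerate v hv := by
    obtain ⟨e, he⟩ := hρ.exists_localUnit hA v
    rw [← he, hv]

/-- The product of the first two legs of `R ⊗ R ⊗ A`. -/
def mulLegs : R ⊗[ℂ] (R ⊗[ℂ] A) →ₗ[ℂ] R ⊗[ℂ] A :=
  LinearMap.rTensor A (LinearMap.mul' ℂ R) ∘ₗ (TensorProduct.assoc ℂ R R A).symm.toLinearMap

theorem mulLegs_assoc (ξ : (R ⊗[ℂ] R) ⊗[ℂ] A) :
    mulLegs (TensorProduct.assoc ℂ R R A ξ) = LinearMap.rTensor A (LinearMap.mul' ℂ R) ξ := by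
  simp [mulLegs]

theorem mulLegs_tmul (r : R) (y : R ⊗[ℂ] A) :
    mulLegs (r ⊗ₜ y) = LinearMap.rTensor A (LinearMap.mulLeft ℂ r) y := by
  induction y using TensorProduct.induction_on with
  | zero => simp
  | add s t hs ht => simp only [map_add, TensorProduct.tmul_add, hs, ht]
  | tmul s a => rfl

/-- The action of `A ⊗ A ⊗ A` on `R ⊗ R ⊗ A`. -/
abbrev tripleAction (act : A →ₙₐ[ℂ] Module.End ℂ R) :
    A ⊗[ℂ] (A ⊗[ℂ] A) →ₙₐ[ℂ] Module.End ℂ (R ⊗[ℂ] (R ⊗[ℂ] A)) :=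
  tensorAction act (smashAction act)

theorem isSmooth_smashAction (hA : IsRegularWeakMultiplierHopfAlgebra Δ) (hs : IsSmooth act) :
    IsSmooth (smashAction act) :=
  hs.tensor (isSmooth_leftRegular hA)

theorem isSmooth_tripleAction (hA : IsRegularWeakMultiplierHopfAlgebra Δ) (hs : IsSmooth act) :
    IsSmooth (B := A ⊗[ℂ] (A ⊗[ℂ] A)) (tripleAction act) :=
  hs.tensor (isSmooth_smashAction hA hs)

/-- The map `p ⊗ q ↦ (p ▷ s) ⊗ q`. -/
def actOn (act : A →ₙₐ[ℂ] Module.End ℂ R) (s : R) : A ⊗[ℂ] A →ₗ[ℂ] R ⊗[ℂ] A :=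
  LinearMap.rTensor A ((act : A →ₗ[ℂ] Module.End ℂ R).flip s)

theorem actOn_tmul (s : R) (p q : A) : actOn act s (p ⊗ₜ q) = act p s ⊗ₜ q := rfl

theorem smashAction_tmul (w : A ⊗[ℂ] A) (r : R) (a : A) :
    smashAction act w (r ⊗ₜ a) =
      actOn act r (LinearMap.lTensor A (LinearMap.mulRight ℂ a) w) := by
  induction w using TensorProduct.induction_on with
  | zero => simp
  | add s t hs ht => simp only [map_add, LinearMap.add_apply, hs, ht]
  | tmul p q => rfl

theorem actOn_act (w : A ⊗[ℂ] A) (u : A) (s : R) :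
    actOn act (act u s) w = actOn act s (LinearMap.rTensor A (LinearMap.mulRight ℂ u) w) := by
  induction w using TensorProduct.induction_on with
  | zero => simp
  | add s t hs ht => simp only [map_add, hs, ht]
  | tmul p q =>
    rw [LinearMap.rTensor_tmul, actOn_tmul, actOn_tmul, LinearMap.mulRight_apply, map_mul]
    rfl

theorem actOn_add (r s : R) (w : A ⊗[ℂ] A) :
    actOn act (r + s) w = actOn act r w + actOn act s w := by
  rw [actOn, map_add, LinearMap.rTensor_add]
  rfl

theorem actOn_smul (c : ℂ) (s : R) (w : A ⊗[ℂ] A) :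
    actOn act (c • s) w = c • actOn act s w := by
  rw [actOn, map_smul, LinearMap.rTensor_smul]
  rfl

/-- Identifies the explicit Sweedler formula with the abstract action of `Δ(a)`. The extended action
is known only on products, so `s` and `b` are first expanded by unitality and idempotency. -/
theorem smashExt_coproduct_tmul (hA : IsRegularWeakMultiplierHopfAlgebra Δ) (hs : IsSmooth act)
    (a : A) (s : R) (b : A) :
    smashExt act (Δ a) (s ⊗ₜ b) = actOn act s (T₁ Δ (a ⊗ₜ b)) := by
  have hN := hA.weak.nondegenerate
  have hc := hA.weak.coproduct
  have hb : b ∈ Submodule.span ℂ {x : A | ∃ a b : A, x = a * b} :=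
    hA.weak.idempotent ▸ Submodule.mem_top
  have hs' : s ∈ Submodule.span ℂ {x : R | ∃ b v, x = act b v} := hs.unital ▸ Submodule.mem_top
  induction hs' using Submodule.span_induction with
  | zero =>
    have : actOn act (0 : R) (T₁ Δ (a ⊗ₜ b)) = 0 := by simp [actOn]
    rw [TensorProduct.zero_tmul, map_zero, this]
  | add x y _ _ hx hy => rw [TensorProduct.add_tmul, map_add, hx, hy, actOn_add]
  | smul c x _ hx => rw [← TensorProduct.smul_tmul', map_smul, hx, actOn_smul]
  | mem x hx =>
    obtain ⟨u, s, rfl⟩ := hx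
    induction hb using Submodule.span_induction with
    | zero => simp
    | add x y _ _ hx hy => simp only [TensorProduct.tmul_add, map_add, hx, hy]
    | smul c x _ hx => simp only [TensorProduct.tmul_smul, map_smul, hx]
    | mem x hx =>
      obtain ⟨v, b, rfl⟩ := hx
      have h1 : act u s ⊗ₜ[ℂ] (v * b) = smashAction act (u ⊗ₜ v) (s ⊗ₜ b) := rfl
      rw [h1, smashExt, (isSmooth_smashAction hA hs).ext_apply, smashAction_tmul,
        coproduct_left_tmul hN hc, T₁_tmul_mul hN hc, actOn_act]
      have h2 := LinearMap.congr_fun ((LinearMap.lTensor_comp_rTensor A (LinearMap.mulRight ℂ u)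
        (LinearMap.mulRight ℂ b)).trans (LinearMap.rTensor_comp_lTensor A _ _).symm)
        (T₁ Δ (a ⊗ₜ v))
      exact congrArg (actOn act s) h2

/-- The working form of the product: it reduces identities in `R # A` to identities of multipliers
of `A ⊗ A ⊗ A`, with the multiplication of the first two legs applied last. -/
theorem smashMul_tmul_left (hA : IsRegularWeakMultiplierHopfAlgebra Δ) (hs : IsSmooth act)
    (r : R) (a : A) (y : R ⊗[ℂ] A) :
    smashMul Δ act (r ⊗ₜ a) y = mulLegs (r ⊗ₜ smashExt act (Δ a) y) := by
  rw [mulLegs_tmul]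
  induction y using TensorProduct.induction_on with
  | zero => simp
  | add s t hs ht => simp only [map_add, hs, ht]
  | tmul s b =>
    rw [smashExt_coproduct_tmul hA hs, actOn, ← LinearMap.rTensor_comp_apply]
    rfl

theorem smashMul_actOn (hA : IsRegularWeakMultiplierHopfAlgebra Δ) (hs : IsSmooth act)
    (r : R) (w : A ⊗[ℂ] A) (y : R ⊗[ℂ] A) :
    smashMul Δ act (actOn act r w) y =
      mulLegs (extendedAction (tripleAction act) (idTensorCoprod Δ w) (r ⊗ₜ y)) := by
  have hX := isSmooth_smashAction hA hs
  have hZ := isSmooth_tripleAction hA hs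
  induction w using TensorProduct.induction_on with
  | zero => simp [hZ.ext_zero]
  | add s t hs ht => simp only [map_add, LinearMap.add_apply, hs, ht, hZ.ext_add]
  | tmul p q =>
    rw [actOn_tmul, smashMul_tmul_left hA hs]
    change _ = mulLegs (extendedAction (tripleAction act) (tens (embed p) (Δ q)) (r ⊗ₜ y))
    rw [hs.ext_tens hX, hs.ext_embed, TensorProduct.map_tmul]
    rfl

/-- The multiplier `m ⊗ n` of `A ⊗ A ⊗ A`, for `m ∈ M(A ⊗ A)` and `n ∈ M(A)`. -/
def tensLeft (m : Multiplier (A ⊗[ℂ] A)) (n : Multiplier A) : Multiplier (A ⊗[ℂ] (A ⊗[ℂ] A)) :=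
  transport (TensorProduct.assoc ℂ A A A) assoc_mul (tens m n)

theorem tripleAction_tensLeft (hA : IsRegularWeakMultiplierHopfAlgebra Δ)
    (hs : IsSmooth act) (m : Multiplier (A ⊗[ℂ] A)) (n : Multiplier A) (ξ : (R ⊗[ℂ] R) ⊗[ℂ] A) :
    extendedAction (tripleAction act)
        (tensLeft m n) (TensorProduct.assoc ℂ R R A ξ) =
      TensorProduct.assoc ℂ R R A (TensorProduct.map
        (extendedAction (tensorAction act act) m) (extendedAction leftRegular n) ξ) := by
  have hl := isSmooth_leftRegular hA
  rw [← (hs.tensor hs).ext_tens hl]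
  exact ((hs.tensor hs).tensor hl).ext_transport (isSmooth_tripleAction hA hs) _ _ _
    (fun b v => assoc_tensorAction b v) _ _

theorem act_mul' (hact : IsModuleAlgebra Δ act) (a : A) (ξ : R ⊗[ℂ] R) :
    act a (LinearMap.mul' ℂ R ξ) =
      LinearMap.mul' ℂ R (extendedAction (tensorAction act act) (Δ a) ξ) := by
  induction ξ using TensorProduct.induction_on with
  | zero => simp
  | add s t hs ht => simp only [map_add, hs, ht]
  | tmul x y => exact hact.act_mul a x y

/-- Acting by `a` puts `Δ(a)` in front of `E`, where `Δ(a)E = Δ(a)`; then `a` is cancelled because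
the module `R` is non-degenerate. -/
theorem mul'_ext_idempotent (hA : IsRegularWeakMultiplierHopfAlgebra Δ) (hs : IsSmooth act)
    (hE : IsCanonicalIdempotent Δ E) (hact : IsModuleAlgebra Δ act) (ξ : R ⊗[ℂ] R) :
    LinearMap.mul' ℂ R (extendedAction (tensorAction act act) E ξ) = LinearMap.mul' ℂ R ξ := by
  refine hs.eq fun a => ?_
  rw [act_mul' hact, act_mul' hact, ← (hs.tensor hs).ext_mul,
    hE.coproduct_mul hA.weak.nondegenerate hA.weak.coproduct]

theorem mulLegs_ext_tensOne (hA : IsRegularWeakMultiplierHopfAlgebra Δ) (hs : IsSmooth act)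
    (hE : IsCanonicalIdempotent Δ E) (hact : IsModuleAlgebra Δ act) (ξ : R ⊗[ℂ] (R ⊗[ℂ] A)) :
    mulLegs (extendedAction (tripleAction act) (tensOne E) ξ) = mulLegs ξ := by
  obtain ⟨ξ, rfl⟩ := (TensorProduct.assoc ℂ R R A).surjective ξ
  change mulLegs (extendedAction (tripleAction act) (tensLeft E 1) _) = _
  rw [tripleAction_tensLeft hA hs, mulLegs_assoc, mulLegs_assoc]
  induction ξ using TensorProduct.induction_on with
  | zero => simp
  | add s t hs ht => simp only [map_add, hs, ht]
  | tmul x a =>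
    rw [TensorProduct.map_tmul, LinearMap.rTensor_tmul, LinearMap.rTensor_tmul,
      mul'_ext_idempotent hA hs hE hact, (isSmooth_leftRegular hA).ext_one, LinearMap.id_apply]

theorem smashAction_mulLegs (hA : IsRegularWeakMultiplierHopfAlgebra Δ) (hs : IsSmooth act)
    (hact : IsModuleAlgebra Δ act) (t : A ⊗[ℂ] A) (ξ : R ⊗[ℂ] (R ⊗[ℂ] A)) :
    smashAction act t (mulLegs ξ) =
      mulLegs (extendedAction (tripleAction act) (coprodTensorId Δ t) ξ) := by
  have hZ := isSmooth_tripleAction hA hs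
  induction t using TensorProduct.induction_on with
  | zero => simp [hZ.ext_zero]
  | add s t hs ht => simp only [map_add, LinearMap.add_apply, hs, ht, hZ.ext_add]
  | tmul a b =>
    change _ = mulLegs (extendedAction (tripleAction act) (tensLeft (Δ a) (embed b)) ξ)
    obtain ⟨ξ, rfl⟩ := (TensorProduct.assoc ℂ R R A).surjective ξ
    rw [tripleAction_tensLeft hA hs, mulLegs_assoc, mulLegs_assoc]
    induction ξ using TensorProduct.induction_on with
    | zero => simp
    | add s t hs ht => simp only [map_add, hs, ht]
    | tmul x c =>
      rw [TensorProduct.map_tmul, LinearMap.rTensor_tmul, LinearMap.rTensor_tmul,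
        ← act_mul' hact, (isSmooth_leftRegular hA).ext_embed]
      rfl

end SmashTools

/-! ### Associativity, the identities for `E`, and the easy half of non-degeneracy. -/

section SmashProduct

variable {A : Type*} [NonUnitalRing A] [Module ℂ A] [IsScalarTower ℂ A A] [SMulCommClass ℂ A A]
  {R : Type*} [NonUnitalRing R] [Module ℂ R] [IsScalarTower ℂ R R] [SMulCommClass ℂ R R]
  {Δ : A →ₙₐ[ℂ] Multiplier (A ⊗[ℂ] A)} {act : A →ₙₐ[ℂ] Module.End ℂ R}
  {E : Multiplier (A ⊗[ℂ] A)}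

theorem idTensorCoprod_tmul (p q : A) : idTensorCoprod Δ (p ⊗ₜ q) = tens (embed p) (Δ q) := rfl

theorem idTensorCoprod_rTensor_mulLeft (d : A) (w : A ⊗[ℂ] A) :
    idTensorCoprod Δ (LinearMap.rTensor A (LinearMap.mulLeft ℂ d) w) =
      tens (embed d) 1 * idTensorCoprod Δ w := by
  induction w using TensorProduct.induction_on with
  | zero => simp
  | add s t hs ht => simp only [map_add, mul_add, hs, ht]
  | tmul p q =>
    rw [LinearMap.rTensor_tmul, idTensorCoprod_tmul, idTensorCoprod_tmul, tens_mul_tens, one_mul,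
      LinearMap.mulLeft_apply, embed_mul]

theorem idTensorCoprod_rTensor_mulRight (d : A) (w : A ⊗[ℂ] A) :
    idTensorCoprod Δ (LinearMap.rTensor A (LinearMap.mulRight ℂ d) w) =
      idTensorCoprod Δ w * tens (embed d) 1 := by
  induction w using TensorProduct.induction_on with
  | zero => simp
  | add s t hs ht => simp only [map_add, add_mul, hs, ht]
  | tmul p q =>
    rw [LinearMap.rTensor_tmul, idTensorCoprod_tmul, idTensorCoprod_tmul, tens_mul_tens, mul_one,
      LinearMap.mulRight_apply, embed_mul]

theorem idTensorCoprod_lTensor_mulRight (b : A) (w : A ⊗[ℂ] A) :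
    idTensorCoprod Δ (LinearMap.lTensor A (LinearMap.mulRight ℂ b) w) =
      idTensorCoprod Δ w * tens 1 (Δ b) := by
  induction w using TensorProduct.induction_on with
  | zero => simp
  | add s t hs ht => simp only [map_add, add_mul, hs, ht]
  | tmul p q =>
    rw [LinearMap.lTensor_tmul, idTensorCoprod_tmul, idTensorCoprod_tmul, tens_mul_tens, mul_one,
      LinearMap.mulRight_apply, map_mul]

theorem eq_of_tens_embed_mul (hN : IsNondegenerateAlgebra A)
    {m n : Multiplier (A ⊗[ℂ] (A ⊗[ℂ] A))}
    (h : ∀ d, tens (embed d) 1 * m = tens (embed d) 1 * n) : m = n := by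
  refine Multiplier.left_injective (hN.tensor (hN.tensor hN)) fun x => ?_
  refine eq_of_rTensor_mulLeft hN fun d => ?_
  exact congrArg (fun m : Multiplier (A ⊗[ℂ] (A ⊗[ℂ] A)) => m.left x) (h d)

/-- The multiplier `(Δ ⊗ ι)(Δ(a)(1 ⊗ v))(1 ⊗ u ⊗ 1)`, as a linear function of `u ⊗ v`. -/
def doubleCoproduct (Δ : A →ₙₐ[ℂ] Multiplier (A ⊗[ℂ] A)) (a : A) :
    A ⊗[ℂ] A →ₗ[ℂ] Multiplier (A ⊗[ℂ] (A ⊗[ℂ] A)) :=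
  TensorProduct.lift (((LinearMap.mul ℂ (Multiplier (A ⊗[ℂ] (A ⊗[ℂ] A)))).compl₁₂
    (coprodTensorId Δ ∘ₗ T₁ Δ ∘ₗ TensorProduct.mk ℂ A A a)
    (tens (1 : Multiplier A) ∘ₗ
      ((tens : Multiplier A →ₗ[ℂ] Multiplier A →ₗ[ℂ] _).flip 1 ∘ₗ embed))).flip)

theorem doubleCoproduct_tmul (a u v : A) : doubleCoproduct Δ a (u ⊗ₜ v) =
    coprodTensorId Δ (T₁ Δ (a ⊗ₜ v)) * tens 1 (tens (embed u) 1) := rfl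

theorem tens_one_mul_embed (u v : A) :
    tens (1 : Multiplier A) (tens (1 : Multiplier A) (embed v)) *
        tens (1 : Multiplier A) (tens (embed u) (1 : Multiplier A)) =
      tens (1 : Multiplier A) (embed (u ⊗ₜ[ℂ] v)) := by
  rw [tens_mul_tens, tens_mul_tens, one_mul, one_mul, mul_one, tens_embed_embed]

theorem tens_embed_mul_doubleCoproduct_tmul (hc : IsCoproduct Δ) (a d u v : A) :
    tens (embed d) 1 * doubleCoproduct Δ a (u ⊗ₜ v) =
      idTensorCoprod Δ (T₂ Δ (d ⊗ₜ a)) * tens 1 (embed (u ⊗ₜ v)) := by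
  rw [doubleCoproduct_tmul, ← tens_one_mul_embed, ← mul_assoc, ← mul_assoc, hc.coassoc]

theorem tens_embed_mul_doubleCoproduct (hc : IsCoproduct Δ) (a d : A) (w : A ⊗[ℂ] A) :
    tens (embed d) 1 * doubleCoproduct Δ a w =
      idTensorCoprod Δ (T₂ Δ (d ⊗ₜ a)) * tens 1 (embed w) := by
  induction w using TensorProduct.induction_on with
  | zero => rw [map_zero, map_zero, map_zero, mul_zero, mul_zero]
  | add s t hs ht => rw [map_add, map_add, map_add, mul_add, mul_add, hs, ht]
  | tmul u v => exact tens_embed_mul_doubleCoproduct_tmul hc a d u v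

theorem tens_embed_mul_idTensorCoprod_T₁ (hN : IsNondegenerateAlgebra A) (hc : IsCoproduct Δ)
    (a b d : A) : tens (embed d) 1 * idTensorCoprod Δ (T₁ Δ (a ⊗ₜ b)) =
      idTensorCoprod Δ (T₂ Δ (d ⊗ₜ a)) * tens 1 (Δ b) := by
  rw [← idTensorCoprod_rTensor_mulLeft, rTensor_mulLeft_T₁ hN hc, idTensorCoprod_lTensor_mulRight]

/-- Coassociativity in the form needed for associativity. The axiom is covered by `d ⊗ 1 ⊗ 1` on the
left, so both sides are compared after that multiplication. -/
theorem idTensorCoprod_T₁_mul (hN : IsNondegenerateAlgebra A) (hc : IsCoproduct Δ) (a b : A)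
    (t : A ⊗[ℂ] A) :
    idTensorCoprod Δ (T₁ Δ (a ⊗ₜ b)) * tens 1 (embed t) =
      doubleCoproduct Δ a ((Δ b).left t) := by
  refine eq_of_tens_embed_mul hN fun d => ?_
  have h : tens (1 : Multiplier A) (Δ b) * tens 1 (embed t) = tens 1 (embed ((Δ b).left t)) := by
    rw [tens_mul_tens, one_mul, Multiplier.embed_mul_eq]
  rw [tens_embed_mul_doubleCoproduct hc, ← mul_assoc, tens_embed_mul_idTensorCoprod_T₁ hN hc,
    mul_assoc, h]

theorem ext_tens_one (hA : IsRegularWeakMultiplierHopfAlgebra Δ) (hs : IsSmooth act)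
    (m : Multiplier (A ⊗[ℂ] A)) (r : R) (y : R ⊗[ℂ] A) :
    extendedAction (tripleAction act) (tens 1 m) (r ⊗ₜ y) = r ⊗ₜ smashExt act m y := by
  rw [hs.ext_tens (isSmooth_smashAction hA hs), hs.ext_one]
  rfl

theorem smashExt_coproduct_mulLegs (hA : IsRegularWeakMultiplierHopfAlgebra Δ)
    (hs : IsSmooth act) (hact : IsModuleAlgebra Δ act) (a v : A) (s t : R) (c : A) :
    smashExt act (Δ a) (mulLegs (s ⊗ₜ (t ⊗ₜ (v * c)))) =
      mulLegs (extendedAction (tripleAction act) (coprodTensorId Δ (T₁ Δ (a ⊗ₜ v)))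
        (s ⊗ₜ (t ⊗ₜ c))) := by
  have hX := isSmooth_smashAction hA hs
  have hl := isSmooth_leftRegular hA
  have h1 : mulLegs (s ⊗ₜ[ℂ] (t ⊗ₜ[ℂ] (v * c))) =
      smashExt act (tens 1 (embed v)) (mulLegs (s ⊗ₜ (t ⊗ₜ c))) := by
    change (s * t) ⊗ₜ[ℂ] (v * c) = smashExt act (tens 1 (embed v)) ((s * t) ⊗ₜ c)
    rw [smashExt, smashAction, hs.ext_tens hl, hs.ext_one, hl.ext_embed]
    rfl
  rw [h1, smashExt, smashExt, ← hX.ext_mul,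
    ← embed_T₁ hA.weak.nondegenerate hA.weak.coproduct, hX.ext_embed,
    smashAction_mulLegs hA hs hact]

theorem smashExt_coproduct_doubleCoproduct (hA : IsRegularWeakMultiplierHopfAlgebra Δ)
    (hs : IsSmooth act) (hact : IsModuleAlgebra Δ act) (a : A) (s t : R) (c : A) (w : A ⊗[ℂ] A) :
    smashExt act (Δ a) (mulLegs (s ⊗ₜ smashAction act w (t ⊗ₜ c))) =
      mulLegs (extendedAction (tripleAction act) (doubleCoproduct Δ a w) (s ⊗ₜ (t ⊗ₜ c))) := by
  have hZ := isSmooth_tripleAction hA hs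
  have hl := isSmooth_leftRegular hA
  induction w using TensorProduct.induction_on with
  | zero => simp [hZ.ext_zero]
  | add x y hx hy =>
    simp only [map_add, LinearMap.add_apply, TensorProduct.tmul_add, hx, hy, hZ.ext_add]
  | tmul u v =>
    rw [doubleCoproduct_tmul, hZ.ext_mul, ext_tens_one hA hs]
    have h1 : smashExt act (tens (embed u) 1) (t ⊗ₜ c) = act u t ⊗ₜ c := by
      rw [smashExt, smashAction, hs.ext_tens hl, hs.ext_embed, hl.ext_one]
      rfl
    rw [h1]
    exact smashExt_coproduct_mulLegs hA hs hact a v s (act u t) c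

/-- By unitality `z` may be taken as `w ▷ y` with `w ∈ A ⊗ A`. Then `Δ(b)w` is again in `A ⊗ A`, and
`smashExt_coproduct_doubleCoproduct` applies to it. -/
theorem smashExt_coproduct_mul (hA : IsRegularWeakMultiplierHopfAlgebra Δ)
    (hs : IsSmooth act) (hact : IsModuleAlgebra Δ act) (a b : A) (s : R) (z : R ⊗[ℂ] A) :
    smashExt act (Δ a) (mulLegs (s ⊗ₜ smashExt act (Δ b) z)) =
      mulLegs (extendedAction (tripleAction act) (idTensorCoprod Δ (T₁ Δ (a ⊗ₜ b)))
        (s ⊗ₜ z)) := by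
  have hX := isSmooth_smashAction hA hs
  have hZ := isSmooth_tripleAction hA hs
  have key : smashExt act (Δ a) ∘ₗ mulLegs ∘ₗ TensorProduct.mk ℂ R (R ⊗[ℂ] A) s ∘ₗ
        smashExt act (Δ b) =
      mulLegs ∘ₗ extendedAction (tripleAction act) (idTensorCoprod Δ (T₁ Δ (a ⊗ₜ b))) ∘ₗ
        TensorProduct.mk ℂ R (R ⊗[ℂ] A) s := by
    refine hX.unital.linearMap_ext fun w y => ?_
    induction y using TensorProduct.induction_on with
    | zero => simp
    | add x y hx hy => simp only [map_add, hx, hy]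
    | tmul t c =>
      change smashExt act (Δ a) (mulLegs (s ⊗ₜ smashExt act (Δ b) (smashAction act w (t ⊗ₜ c)))) =
        mulLegs (extendedAction (tripleAction act) (idTensorCoprod Δ (T₁ Δ (a ⊗ₜ b)))
          (s ⊗ₜ smashAction act w (t ⊗ₜ c)))
      rw [smashExt, smashExt, hX.ext_apply, ← smashExt,
        smashExt_coproduct_doubleCoproduct hA hs hact,
        ← idTensorCoprod_T₁_mul hA.weak.nondegenerate hA.weak.coproduct, hZ.ext_mul,
        ext_tens_one hA hs, smashExt, hX.ext_embed]
  exact LinearMap.congr_fun key z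

theorem smashMul_rTensor_mulLeft (hA : IsRegularWeakMultiplierHopfAlgebra Δ) (hs : IsSmooth act)
    (r : R) (x y : R ⊗[ℂ] A) :
    smashMul Δ act (LinearMap.rTensor A (LinearMap.mulLeft ℂ r) x) y =
      LinearMap.rTensor A (LinearMap.mulLeft ℂ r) (smashMul Δ act x y) := by
  induction x using TensorProduct.induction_on with
  | zero => simp
  | add x y hx hy => simp only [map_add, LinearMap.add_apply, hx, hy]
  | tmul s a =>
    rw [LinearMap.rTensor_tmul, smashMul_tmul_left hA hs, smashMul_tmul_left hA hs, mulLegs_tmul,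
      mulLegs_tmul, LinearMap.mulLeft_apply, LinearMap.mulLeft_mul, LinearMap.rTensor_comp_apply]

/-- On elementary tensors both sides are `r` times the product of the first two legs of `(ι ⊗
Δ)(Δ(a)(1 ⊗ b)) ▷ (s ⊗ z)`. -/
theorem smashMul_assoc (hA : IsRegularWeakMultiplierHopfAlgebra Δ)
    (hs : IsSmooth act) (hact : IsModuleAlgebra Δ act) (x y z : R ⊗[ℂ] A) :
    smashMul Δ act (smashMul Δ act x y) z = smashMul Δ act x (smashMul Δ act y z) := by
  induction x using TensorProduct.induction_on with
  | zero => simp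
  | add x y hx hy => simp only [map_add, LinearMap.add_apply, hx, hy]
  | tmul r a =>
    induction y using TensorProduct.induction_on with
    | zero => simp
    | add x y hx hy => simp only [map_add, LinearMap.add_apply, hx, hy]
    | tmul s b =>
      rw [smashMul_tmul_left hA hs r a, smashMul_tmul_left hA hs r a, smashMul_tmul_left hA hs s b,
        mulLegs_tmul r, mulLegs_tmul r, smashMul_rTensor_mulLeft hA hs,
        smashExt_coproduct_tmul hA hs, smashMul_actOn hA hs, smashExt_coproduct_mul hA hs hact]

theorem oneTens_mul_idTensorCoprod (hA : IsRegularWeakMultiplierHopfAlgebra Δ)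
    (hE : IsCanonicalIdempotent Δ E) (w : A ⊗[ℂ] A) :
    oneTens E * idTensorCoprod Δ w = idTensorCoprod Δ w := by
  induction w using TensorProduct.induction_on with
  | zero => simp
  | add x y hx hy => simp only [map_add, mul_add, hx, hy]
  | tmul p q =>
    rw [idTensorCoprod_tmul, oneTens, tens_mul_tens, one_mul,
      hE.mul_coproduct hA.weak.nondegenerate hA.weak.coproduct]

theorem IsCanonicalIdempotent.isExtensionValue (hE : IsCanonicalIdempotent Δ E)
    (hA : IsRegularWeakMultiplierHopfAlgebra Δ) :
    IsExtensionValue (idTensorCoprod Δ) (oneTens E) E (tensOne E * oneTens E) ∧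
      tensOne E * oneTens E = oneTens E * tensOne E := by
  obtain ⟨F, hF, hx, hcomm, -⟩ := hA.weak.canonical
  obtain rfl := hE.unique hA.weak.nondegenerate hF
  exact ⟨hx, hcomm⟩

/-- Replacing `w` by `Ew` turns `(ι ⊗ Δ)(w)` into `(E ⊗ 1)(1 ⊗ E)(ι ⊗ Δ)(w)`. The factor `1 ⊗ E` is
absorbed by `Δ`, and `E ⊗ 1` by the product of `R`. -/
theorem smashMul_smashExt_left (hA : IsRegularWeakMultiplierHopfAlgebra Δ)
    (hs : IsSmooth act) (hact : IsModuleAlgebra Δ act) (hE : IsCanonicalIdempotent Δ E)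
    (x y : R ⊗[ℂ] A) :
    smashMul Δ act (smashExt act E x) y = smashMul Δ act x y := by
  have hX := isSmooth_smashAction hA hs
  have hZ := isSmooth_tripleAction hA hs
  have key : (smashMul Δ act).flip y ∘ₗ smashExt act E = (smashMul Δ act).flip y := by
    refine hX.unital.linearMap_ext fun w x => ?_
    induction x using TensorProduct.induction_on with
    | zero => simp
    | add x y hx hy => simp only [map_add, hx, hy]
    | tmul r a =>
      change smashMul Δ act (smashExt act E (smashAction act w (r ⊗ₜ a))) y =
        smashMul Δ act (smashAction act w (r ⊗ₜ a)) y
      rw [smashExt, hX.ext_apply, smashAction_tmul, smashAction_tmul, smashMul_actOn hA hs,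
        smashMul_actOn hA hs, idTensorCoprod_lTensor_mulRight, idTensorCoprod_lTensor_mulRight,
        ← (hE.isExtensionValue hA).1.2.2.1, mul_assoc, mul_assoc, ← mul_assoc (oneTens E),
        oneTens_mul_idTensorCoprod hA hE, hZ.ext_mul, mulLegs_ext_tensOne hA hs hE hact]
  exact LinearMap.congr_fun key x

theorem smashMul_smashExt_right (hA : IsRegularWeakMultiplierHopfAlgebra Δ)
    (hs : IsSmooth act) (hE : IsCanonicalIdempotent Δ E) (x y : R ⊗[ℂ] A) :
    smashMul Δ act x (smashExt act E y) = smashMul Δ act x y := by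
  induction x using TensorProduct.induction_on with
  | zero => simp
  | add x y hx hy => simp only [map_add, LinearMap.add_apply, hx, hy]
  | tmul r a =>
    rw [smashMul_tmul_left hA hs, smashMul_tmul_left hA hs, smashExt, smashExt,
      ← (isSmooth_smashAction hA hs).ext_mul,
      hE.coproduct_mul hA.weak.nondegenerate hA.weak.coproduct]

/-- The isomorphism `x ⊗ y ⊗ z ↦ z ⊗ y ⊗ x`. -/
def reverse : A ⊗[ℂ] (A ⊗[ℂ] A) ≃ₗ[ℂ] A ⊗[ℂ] (A ⊗[ℂ] A) :=
  ((TensorProduct.comm ℂ A (A ⊗[ℂ] A)).trans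
    (TensorProduct.congr (TensorProduct.comm ℂ A A) (LinearEquiv.refl ℂ A))).trans
    (TensorProduct.assoc ℂ A A A)

theorem reverse_mul (x y : A ⊗[ℂ] (A ⊗[ℂ] A)) : reverse (x * y) = reverse x * reverse y := by
  have h : (LinearMap.mul ℂ _).compr₂ (reverse (A := A)).toLinearMap =
      (LinearMap.mul ℂ _).compl₁₂ (reverse (A := A)).toLinearMap
        (reverse (A := A)).toLinearMap := by
    ext; simp [reverse]
  exact LinearMap.congr_fun₂ h x y

/-- The automorphism of `M(A ⊗ A ⊗ A)` that reverses the order of the legs. -/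
def reverseMultiplier :
    Multiplier (A ⊗[ℂ] (A ⊗[ℂ] A)) →ₐ[ℂ] Multiplier (A ⊗[ℂ] (A ⊗[ℂ] A)) :=
  transport reverse reverse_mul

theorem reverseMultiplier_left (m : Multiplier (A ⊗[ℂ] (A ⊗[ℂ] A))) (t : A ⊗[ℂ] (A ⊗[ℂ] A)) :
    (reverseMultiplier m).left t = reverse (m.left (reverse.symm t)) := rfl

theorem reverse_symm_tmul (x y z : A) :
    reverse.symm (x ⊗ₜ[ℂ] (y ⊗ₜ[ℂ] z)) = z ⊗ₜ[ℂ] (y ⊗ₜ[ℂ] x) := rfl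

theorem reverse_tmul_comm (w : A) (s : A ⊗[ℂ] A) :
    reverse (w ⊗ₜ[ℂ] TensorProduct.comm ℂ A A s) = TensorProduct.assoc ℂ A A A (s ⊗ₜ w) := by
  simp [reverse]

theorem reverse_assoc_comm (w : A) (s : A ⊗[ℂ] A) :
    reverse (TensorProduct.assoc ℂ A A A (TensorProduct.comm ℂ A A s ⊗ₜ w)) = w ⊗ₜ s := by
  induction s using TensorProduct.induction_on with
  | zero => simp
  | add x y hx hy => simp only [map_add, TensorProduct.add_tmul, TensorProduct.tmul_add, hx, hy]
  | tmul a b => rfl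

theorem Multiplier.left_injective₃ (hN : IsNondegenerateAlgebra A)
    {m n : Multiplier (A ⊗[ℂ] (A ⊗[ℂ] A))}
    (h : ∀ x y z, m.left (x ⊗ₜ (y ⊗ₜ z)) = n.left (x ⊗ₜ (y ⊗ₜ z))) : m = n := by
  refine Multiplier.left_injective (hN.tensor (hN.tensor hN)) fun t => ?_
  induction t using TensorProduct.induction_on with
  | zero => simp
  | add x y hx hy => simp only [map_add, hx, hy]
  | tmul x s =>
    induction s using TensorProduct.induction_on with
    | zero => simp
    | add x y hx hy => simp only [map_add, TensorProduct.tmul_add, hx, hy]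
    | tmul y z => exact h x y z

theorem reverseMultiplier_idTensorCoprod (hN : IsNondegenerateAlgebra A) (w : A ⊗[ℂ] A) :
    reverseMultiplier (idTensorCoprod (cop Δ) w) =
      coprodTensorId Δ (TensorProduct.comm ℂ A A w) := by
  induction w using TensorProduct.induction_on with
  | zero => simp
  | add x y hx hy => simp only [map_add, hx, hy]
  | tmul p q =>
    refine Multiplier.left_injective₃ hN fun x y z => ?_
    rw [reverseMultiplier_left, reverse_symm_tmul, idTensorCoprod_left_tmul, cop_apply, flip_left,
      reverse_tmul_comm]
    rfl

theorem reverseMultiplier_oneTens (hN : IsNondegenerateAlgebra A) :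
    reverseMultiplier (oneTens (flip E)) = tensOne E := by
  refine Multiplier.left_injective₃ hN fun x y z => ?_
  rw [reverseMultiplier_left, reverse_symm_tmul]
  change reverse (z ⊗ₜ (flip E).left (y ⊗ₜ x)) = _
  rw [flip_left, reverse_tmul_comm]
  rfl

theorem reverseMultiplier_tensOne (hN : IsNondegenerateAlgebra A) :
    reverseMultiplier (tensOne (flip E)) = oneTens E := by
  refine Multiplier.left_injective₃ hN fun x y z => ?_
  rw [reverseMultiplier_left, reverse_symm_tmul, ← TensorProduct.assoc_tmul, tensOne_left_assoc, flip_left,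
    reverse_assoc_comm]
  rfl

/-- The formula for `(Δ ⊗ ι)E` is the one for `(ι ⊗ cop Δ)(flip E)` with the three legs reversed. It
is therefore supplied by the axioms for the opposite coproduct. -/
theorem coprodTensorId_mul (hA : IsRegularWeakMultiplierHopfAlgebra Δ)
    (hE : IsCanonicalIdempotent Δ E) (w : A ⊗[ℂ] A) :
    coprodTensorId Δ w * (tensOne E * oneTens E) = coprodTensorId Δ (E.right w) := by
  have hN := hA.weak.nondegenerate
  have h := ((hE.cop hA).isExtensionValue hA.cop).1.2.2.2 (TensorProduct.comm ℂ A A w)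
  have h' := congrArg reverseMultiplier h
  rw [map_mul, map_mul, reverseMultiplier_idTensorCoprod hN, reverseMultiplier_idTensorCoprod hN,
    reverseMultiplier_oneTens hN, reverseMultiplier_tensOne hN, flip_right, comm_comm, comm_comm] at h'
  rw [(hE.isExtensionValue hA).2]
  exact h'

/-- Tested against `t ∈ A ⊗ A`, the left side brings in `(Δ ⊗ ι)(tE) = (Δ ⊗ ι)(t)(E ⊗ 1)(1 ⊗ E)`. On
the right side `E ⊗ 1` can be inserted freely, since multiplying the first two legs absorbs it. -/
theorem smashExt_mulLegs (hA : IsRegularWeakMultiplierHopfAlgebra Δ)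
    (hs : IsSmooth act) (hact : IsModuleAlgebra Δ act) (hE : IsCanonicalIdempotent Δ E)
    (ξ : R ⊗[ℂ] (R ⊗[ℂ] A)) :
    smashExt act E (mulLegs ξ) =
      mulLegs (extendedAction (tripleAction act) (oneTens E) ξ) := by
  have hX := isSmooth_smashAction hA hs
  have hZ := isSmooth_tripleAction hA hs
  rw [← mulLegs_ext_tensOne hA hs hE hact (extendedAction _ (oneTens E) ξ), ← hZ.ext_mul]
  refine hX.eq fun t => ?_
  rw [smashExt, hX.apply_ext, smashAction_mulLegs hA hs hact, smashAction_mulLegs hA hs hact,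
    ← coprodTensorId_mul hA hE, hZ.ext_mul]

theorem smashExt_smashMul (hA : IsRegularWeakMultiplierHopfAlgebra Δ)
    (hs : IsSmooth act) (hact : IsModuleAlgebra Δ act) (hE : IsCanonicalIdempotent Δ E)
    (x y : R ⊗[ℂ] A) : smashExt act E (smashMul Δ act x y) = smashMul Δ act x y := by
  induction x using TensorProduct.induction_on with
  | zero => simp
  | add x y hx hy => simp only [map_add, LinearMap.add_apply, hx, hy]
  | tmul r a =>
    rw [smashMul_tmul_left hA hs, smashExt_mulLegs hA hs hact hE, oneTens, ext_tens_one hA hs,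
      smashExt, smashExt, ← (isSmooth_smashAction hA hs).ext_mul,
      hE.mul_coproduct hA.weak.nondegenerate hA.weak.coproduct]

theorem smashExt_idem (hA : IsRegularWeakMultiplierHopfAlgebra Δ) (hs : IsSmooth act)
    (hE : IsCanonicalIdempotent Δ E) {x : R ⊗[ℂ] A} (hx : x ∈ smashProduct act E) :
    smashExt act E x = x := by
  obtain ⟨y, rfl⟩ := hx
  rw [smashExt, ← (isSmooth_smashAction hA hs).ext_mul, hE.idem]

/-- Cancelling `r` leaves `Δ(a) ▷ x = 0` for all `a`. Since `(A ⊗ A)E` is the range of `T₂`, it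
kills `x`, and `x = E ▷ x` vanishes by non-degeneracy of the module. -/
theorem eq_zero_of_smashMul_right (hA : IsRegularWeakMultiplierHopfAlgebra Δ)
    (hR : IsNondegenerateAlgebra R) (hs : IsSmooth act) (hE : IsCanonicalIdempotent Δ E)
    {x : R ⊗[ℂ] A} (hx : x ∈ smashProduct act E) (h : ∀ y, smashMul Δ act y x = 0) : x = 0 := by
  have hX := isSmooth_smashAction hA hs
  have h1 : ∀ a, smashExt act (Δ a) x = 0 := by
    intro a
    refine eq_zero_of_forall_rTensor (fun r : R => LinearMap.mulLeft ℂ r) (fun v hv => hR.2 v hv) _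
      fun r => ?_
    rw [← mulLegs_tmul, ← smashMul_tmul_left hA hs]
    exact h _
  rw [← smashExt_idem hA hs hE hx]
  refine hX.nondegenerate _ fun t => ?_
  rw [smashExt, hX.apply_ext]
  obtain ⟨s, hs'⟩ := hE.exists_T₂ t
  rw [← hs']
  clear hs'
  induction s using TensorProduct.induction_on with
  | zero => simp
  | add x y hx hy => simp only [map_add, LinearMap.add_apply, hx, hy, add_zero]
  | tmul a b =>
    rw [← hX.ext_embed, embed_T₂ hA.weak.nondegenerate hA.weak.coproduct, hX.ext_mul]
    have := h1 b
    rw [smashExt] at this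
    rw [this, map_zero]

end SmashProduct

/-! ### The hard half of non-degeneracy: transferring the canonical map of `cop Δ` to `R ⊗ A`. -/

section Nondegeneracy

variable {A : Type*} [NonUnitalRing A] [Module ℂ A] [IsScalarTower ℂ A A] [SMulCommClass ℂ A A]
  {R : Type*} [NonUnitalRing R] [Module ℂ R] [IsScalarTower ℂ R R] [SMulCommClass ℂ R R]
  {Δ : A →ₙₐ[ℂ] Multiplier (A ⊗[ℂ] A)} {act : A →ₙₐ[ℂ] Module.End ℂ R}
  {E : Multiplier (A ⊗[ℂ] A)}

theorem actOn_localUnit {e : A} {r : R} (he : act e r = r) (a : A) :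
    actOn act r (e ⊗ₜ a) = r ⊗ₜ a := by
  rw [actOn_tmul, he]

theorem linearMap_ext_actOn (hA : IsRegularWeakMultiplierHopfAlgebra Δ)
    (hu : IsUnitalModule act) {W : Type*} [AddCommGroup W] [Module ℂ W]
    {f g : R ⊗[ℂ] A →ₗ[ℂ] W} (h : ∀ r w, f (actOn act r w) = g (actOn act r w)) : f = g := by
  refine TensorProduct.ext' fun r a => ?_
  obtain ⟨e, he⟩ := hu.exists_localUnit hA r
  rw [← actOn_localUnit he]
  exact h _ _

/-- The map `r ⊗ w ↦ w ▷ r`. -/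
def actOnLift (act : A →ₙₐ[ℂ] Module.End ℂ R) : R ⊗[ℂ] (A ⊗[ℂ] A) →ₗ[ℂ] R ⊗[ℂ] A :=
  TensorProduct.lift
    (LinearMap.rTensorHom A ∘ₗ (act : A →ₗ[ℂ] Module.End ℂ R).flip)

theorem actOnLift_tmul (r : R) (w : A ⊗[ℂ] A) : actOnLift act (r ⊗ₜ w) = actOn act r w := rfl

theorem exists_lTensor_mulLeft_eq (hA : IsRegularWeakMultiplierHopfAlgebra Δ)
    (t : R ⊗[ℂ] (A ⊗[ℂ] A)) :
    ∃ e : A, LinearMap.lTensor R (LinearMap.rTensor A (LinearMap.mulLeft ℂ e)) t = t := by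
  classical
  have key : ∃ s : Finset A, ∀ e, (∀ a ∈ s, e * a = a) →
      LinearMap.lTensor R (LinearMap.rTensor A (LinearMap.mulLeft ℂ e)) t = t := by
    induction t using TensorProduct.induction_on with
    | zero => exact ⟨∅, by simp⟩
    | add x y hx hy =>
      obtain ⟨s, hs⟩ := hx
      obtain ⟨t, ht⟩ := hy
      refine ⟨s ∪ t, fun e he => ?_⟩
      rw [map_add, hs e fun a ha => he a (Finset.mem_union_left _ ha),
        ht e fun a ha => he a (Finset.mem_union_right _ ha)]
    | tmul r w =>
      induction w using TensorProduct.induction_on with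
      | zero => exact ⟨∅, by simp⟩
      | add x y hx hy =>
        obtain ⟨s, hs⟩ := hx
        obtain ⟨t, ht⟩ := hy
        refine ⟨s ∪ t, fun e he => ?_⟩
        rw [TensorProduct.tmul_add, map_add,
          hs e fun a ha => he a (Finset.mem_union_left _ ha),
          ht e fun a ha => he a (Finset.mem_union_right _ ha)]
      | tmul p q =>
        refine ⟨{p}, fun e he => ?_⟩
        rw [LinearMap.lTensor_tmul, LinearMap.rTensor_tmul, LinearMap.mulLeft_apply,
          he p (Finset.mem_singleton_self p)]
  obtain ⟨s, hs⟩ := key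
  obtain ⟨e, he⟩ := exists_leftLocalUnit hA s
  exact ⟨e, hs e he⟩

/-- An endomorphism `f` of `A ⊗ A` with `f(w(c ⊗ 1)) = f(w)(c ⊗ 1)` induces an endomorphism of
`R ⊗ A`. -/
theorem exists_induced (hA : IsRegularWeakMultiplierHopfAlgebra Δ) (hu : IsUnitalModule act)
    (f : A ⊗[ℂ] A →ₗ[ℂ] A ⊗[ℂ] A)
    (hf : ∀ c t, f (LinearMap.rTensor A (LinearMap.mulRight ℂ c) t) =
      LinearMap.rTensor A (LinearMap.mulRight ℂ c) (f t)) :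
    ∃ F : R ⊗[ℂ] A →ₗ[ℂ] R ⊗[ℂ] A, ∀ r w, F (actOn act r w) = actOn act r (f w) := by
  have hker : ∀ t, actOnLift act t = 0 → actOnLift act (LinearMap.lTensor R f t) = 0 := by
    intro t ht
    obtain ⟨e, he⟩ := exists_lTensor_mulLeft_eq hA t
    -- With one local unit `e` for all first legs, `f(p ⊗ q) = f(e ⊗ q)(p ⊗ 1)`. So `f(p ⊗ q) ▷ r`
    -- is `f(e ⊗ q) ▷ (p ▷ r)`, which depends only on `(p ▷ r) ⊗ q`.
    let h : R ⊗[ℂ] A →ₗ[ℂ] R ⊗[ℂ] A :=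
      actOnLift act ∘ₗ LinearMap.lTensor R (f ∘ₗ TensorProduct.mk ℂ A A e)
    have key : ∀ t, actOnLift act (LinearMap.lTensor R f
        (LinearMap.lTensor R (LinearMap.rTensor A (LinearMap.mulLeft ℂ e)) t)) =
        h (actOnLift act t) := by
      intro t
      induction t using TensorProduct.induction_on with
      | zero => simp
      | add x y hx hy => simp only [map_add, hx, hy]
      | tmul r w =>
        induction w using TensorProduct.induction_on with
        | zero => simp
        | add x y hx hy => simp only [TensorProduct.tmul_add, map_add, hx, hy]
        | tmul p q =>
          change actOn act r (f (LinearMap.rTensor A (LinearMap.mulRight ℂ p) (e ⊗ₜ q))) =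
            actOn act (act p r) (f (e ⊗ₜ q))
          rw [hf, actOn_act]
    rw [← he, key, ht, map_zero]
  have hsurj : LinearMap.range (actOnLift act) = ⊤ := by
    rw [eq_top_iff]
    rintro t -
    induction t using TensorProduct.induction_on with
    | zero => exact Submodule.zero_mem _
    | add x y hx hy => exact Submodule.add_mem _ hx hy
    | tmul r a =>
      obtain ⟨e, he⟩ := hu.exists_localUnit hA r
      exact ⟨r ⊗ₜ (e ⊗ₜ a), by rw [actOnLift_tmul, actOn_localUnit he]⟩
  obtain ⟨s, hs⟩ := (actOnLift act).exists_rightInverse_of_surjective hsurj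
  refine ⟨actOnLift act ∘ₗ LinearMap.lTensor R f ∘ₗ s, fun r w => ?_⟩
  have h1 : actOnLift act (s (actOn act r w) - r ⊗ₜ w) = 0 := by
    rw [map_sub, actOnLift_tmul, sub_eq_zero]
    exact LinearMap.congr_fun hs _
  have h2 := hker _ h1
  rw [map_sub, map_sub, sub_eq_zero] at h2
  exact h2

/-- `f` with the two legs exchanged. -/
def swapLegs (f : A ⊗[ℂ] A →ₗ[ℂ] A ⊗[ℂ] A) : A ⊗[ℂ] A →ₗ[ℂ] A ⊗[ℂ] A :=
  (TensorProduct.comm ℂ A A).toLinearMap ∘ₗ f ∘ₗ (TensorProduct.comm ℂ A A).toLinearMap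

theorem swapLegs_apply (f : A ⊗[ℂ] A →ₗ[ℂ] A ⊗[ℂ] A) (t : A ⊗[ℂ] A) :
    swapLegs f t = TensorProduct.comm ℂ A A (f (TensorProduct.comm ℂ A A t)) := rfl

theorem swapLegs_comp (f g : A ⊗[ℂ] A →ₗ[ℂ] A ⊗[ℂ] A) (t : A ⊗[ℂ] A) :
    swapLegs f (swapLegs g t) = swapLegs (f ∘ₗ g) t := by
  rw [swapLegs_apply, swapLegs_apply, comm_comm]
  rfl

theorem swapLegs_rTensor {f : A ⊗[ℂ] A →ₗ[ℂ] A ⊗[ℂ] A}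
    (hf : ∀ c t, f (LinearMap.lTensor A (LinearMap.mulRight ℂ c) t) =
      LinearMap.lTensor A (LinearMap.mulRight ℂ c) (f t)) (c : A) (t : A ⊗[ℂ] A) :
    swapLegs f (LinearMap.rTensor A (LinearMap.mulRight ℂ c) t) =
      LinearMap.rTensor A (LinearMap.mulRight ℂ c) (swapLegs f t) := by
  rw [swapLegs_apply, swapLegs_apply, comm_rTensor, hf, comm_lTensor]

theorem embed_swapLegs_T₁ (hA : IsRegularWeakMultiplierHopfAlgebra Δ) (p a : A) :
    embed (swapLegs (T₁ (cop Δ)) (p ⊗ₜ a)) = Δ a * tens (embed p) 1 := by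
  have h : swapLegs (T₁ (cop Δ)) (p ⊗ₜ a) =
      TensorProduct.comm ℂ A A (T₁ (cop Δ) (a ⊗ₜ p)) := rfl
  rw [h, ← flip_embed, embed_T₁ hA.weak.nondegenerate hA.weak_cop.coproduct, flip_mul, flip_tens,
    cop_apply, flip_flip]

/-- A generalized inverse of `T₁`. -/
theorem IsKernelProjection.exists_inverse {ε : A →ₗ[ℂ] ℂ} {G : A ⊗[ℂ] A →ₗ[ℂ] A ⊗[ℂ] A}
    (hG : IsKernelProjection Δ E ε G) (hN : IsNondegenerateAlgebra A) (hc : IsCoproduct Δ)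
    (hE : IsCanonicalIdempotent Δ E) :
    ∃ S : A ⊗[ℂ] A →ₗ[ℂ] A ⊗[ℂ] A,
      (∀ c t, S (LinearMap.lTensor A (LinearMap.mulRight ℂ c) t) =
        LinearMap.lTensor A (LinearMap.mulRight ℂ c) (S t)) ∧
      S ∘ₗ T₁ Δ = G ∧ T₁ Δ ∘ₗ S = E.left ∧ G ∘ₗ S = S := by
  have hr : ∀ t, E.left t ∈ LinearMap.range (T₁ Δ) := fun t => hE.exists_T₁ t
  -- The linear lift `s` of `E` through `T₁` is arbitrary; composing with `G` removes the ambiguity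
  -- in `ker T₁` and makes the result right linear.
  obtain ⟨s, hs⟩ := Module.projective_lifting_property (T₁ Δ).rangeRestrict
    (E.left.codRestrict _ hr) (LinearMap.surjective_rangeRestrict _)
  have hs' : ∀ t, T₁ Δ (s t) = E.left t := fun t =>
    congrArg Subtype.val (LinearMap.congr_fun hs t)
  refine ⟨G ∘ₗ s, fun c t => ?_, ?_, ?_, ?_⟩
  · rw [LinearMap.comp_apply, LinearMap.comp_apply, ← hG.map_mulRight]
    apply hG.map_eq
    rw [hs', T₁_lTensor_mulRight hN hc, hs', left_lTensor_mulRight hN hN]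
  · refine LinearMap.ext fun t => ?_
    apply hG.map_eq
    rw [hs', hE.left_T₁]
  · refine LinearMap.ext fun t => ?_
    rw [LinearMap.comp_apply, LinearMap.comp_apply, hG.T₁_map, hs']
  · exact LinearMap.ext fun t => hG.idem _

theorem smashExt_actOn (hA : IsRegularWeakMultiplierHopfAlgebra Δ) (hs : IsSmooth act)
    (m : Multiplier (A ⊗[ℂ] A)) (r : R) (w : A ⊗[ℂ] A) :
    smashExt act m (actOn act r w) = actOn act r (m.left w) := by
  have hN := hA.weak.nondegenerate
  refine tensor_span_induction (S := Set.univ) Submodule.span_univ hA.weak.idempotent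
    (P := fun w => smashExt act m (actOn act r w) = actOn act r (m.left w)) ?_ ?_ ?_ ?_ w
  · simp
  · intro x y hx hy; simp only [map_add, hx, hy]
  · intro c x hx; simp only [map_smul, hx]
  rintro p - _ ⟨u, v, rfl⟩
  have h : (p ⊗ₜ[ℂ] (u * v) : A ⊗[ℂ] A) =
      LinearMap.lTensor A (LinearMap.mulRight ℂ v) (p ⊗ₜ u) := rfl
  rw [h, left_lTensor_mulRight hN hN, ← smashAction_tmul, ← smashAction_tmul, smashExt,
    (isSmooth_smashAction hA hs).ext_apply]

/-- The action of `A ⊗ A` on `A ⊗ R`. -/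
abbrev regularAction (act : A →ₙₐ[ℂ] Module.End ℂ R) :
    A ⊗[ℂ] A →ₙₐ[ℂ] Module.End ℂ (A ⊗[ℂ] R) :=
  tensorAction leftRegular act

/-- The action of `A ⊗ A ⊗ A` on `A ⊗ R ⊗ R`. -/
abbrev regularTripleAction (act : A →ₙₐ[ℂ] Module.End ℂ R) :
    A ⊗[ℂ] (A ⊗[ℂ] A) →ₙₐ[ℂ] Module.End ℂ (A ⊗[ℂ] (R ⊗[ℂ] R)) :=
  tensorAction leftRegular (tensorAction act act)

theorem isSmooth_regularAction (hA : IsRegularWeakMultiplierHopfAlgebra Δ) (hs : IsSmooth act) :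
    IsSmooth (B := A ⊗[ℂ] A) (regularAction act) :=
  (isSmooth_leftRegular hA).tensor hs

theorem isSmooth_regularTripleAction (hA : IsRegularWeakMultiplierHopfAlgebra Δ)
    (hs : IsSmooth act) : IsSmooth (B := A ⊗[ℂ] (A ⊗[ℂ] A)) (regularTripleAction act) :=
  (isSmooth_leftRegular hA).tensor (hs.tensor hs)

theorem regularAction_tmul (w : A ⊗[ℂ] A) (v : A) (t : R) :
    regularAction act w (v ⊗ₜ t) = LinearMap.lTensor A ((act : A →ₗ[ℂ] Module.End ℂ R).flip t)
      (LinearMap.rTensor A (LinearMap.mulRight ℂ v) w) := by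
  induction w using TensorProduct.induction_on with
  | zero => simp
  | add x y hx hy => simp only [map_add, LinearMap.add_apply, hx, hy]
  | tmul p q => rfl

theorem ext_regularAction_tmul (hA : IsRegularWeakMultiplierHopfAlgebra Δ) (hs : IsSmooth act)
    (m : Multiplier (A ⊗[ℂ] A)) (c b : A) (t : R) :
    extendedAction (regularAction act) m (c ⊗ₜ act b t) =
      LinearMap.lTensor A ((act : A →ₗ[ℂ] Module.End ℂ R).flip t) (m.left (c ⊗ₜ b)) := by
  have hN := hA.weak.nondegenerate
  have hc : c ∈ Submodule.span ℂ {x : A | ∃ a b : A, x = a * b} :=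
    hA.weak.idempotent ▸ Submodule.mem_top
  induction hc using Submodule.span_induction with
  | zero => simp
  | add x y _ _ hx hy => simp only [TensorProduct.add_tmul, map_add, hx, hy]
  | smul c x _ hx => simp only [← TensorProduct.smul_tmul', map_smul, hx]
  | mem x hx =>
    obtain ⟨u, v, rfl⟩ := hx
    have h1 : (u * v) ⊗ₜ[ℂ] act b t = regularAction act (u ⊗ₜ b) (v ⊗ₜ t) := rfl
    have h2 : ((u * v) ⊗ₜ[ℂ] b : A ⊗[ℂ] A) =
      LinearMap.rTensor A (LinearMap.mulRight ℂ v) (u ⊗ₜ b) := rfl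
    rw [h1, h2, left_rTensor_mulRight hN hN, ← regularAction_tmul,
      (isSmooth_regularAction hA hs).ext_apply]

theorem regularAction_lTensor_mul' (hA : IsRegularWeakMultiplierHopfAlgebra Δ)
    (hs : IsSmooth act) (hact : IsModuleAlgebra Δ act) (w : A ⊗[ℂ] A) (η : A ⊗[ℂ] (R ⊗[ℂ] R)) :
    regularAction act w (LinearMap.lTensor A (LinearMap.mul' ℂ R) η) =
      LinearMap.lTensor A (LinearMap.mul' ℂ R)
        (extendedAction (regularTripleAction act) (idTensorCoprod Δ w) η) := by
  have hZ := isSmooth_regularTripleAction hA hs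
  have hl := isSmooth_leftRegular hA
  induction w using TensorProduct.induction_on with
  | zero => simp [hZ.ext_zero]
  | add x y hx hy => simp only [map_add, LinearMap.add_apply, hx, hy, hZ.ext_add]
  | tmul p q =>
    rw [idTensorCoprod_tmul, hl.ext_tens (hs.tensor hs), hl.ext_embed]
    induction η using TensorProduct.induction_on with
    | zero => simp
    | add x y hx hy => simp only [map_add, hx, hy]
    | tmul c ξ =>
      rw [TensorProduct.map_tmul, LinearMap.lTensor_tmul, LinearMap.lTensor_tmul,
        ← act_mul' hact]
      rfl

/-- Acting on a product `ts` in the second leg brings in `(ι ⊗ Δ)E = (1 ⊗ E)(E ⊗ 1)`. The factor `1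
⊗ E` is absorbed by the product of `R`, which leaves `E` acting on `c ⊗ t` alone. -/
theorem ext_regularAction_mul (hA : IsRegularWeakMultiplierHopfAlgebra Δ)
    (hs : IsSmooth act) (hact : IsModuleAlgebra Δ act) (hE : IsCanonicalIdempotent Δ E)
    (c : A) (t s : R) :
    extendedAction (regularAction act) E (c ⊗ₜ (t * s)) =
      LinearMap.lTensor A (LinearMap.mulRight ℂ s)
        (extendedAction (regularAction act) E (c ⊗ₜ t)) := by
  have hX := isSmooth_regularAction hA hs
  have hZ := isSmooth_regularTripleAction hA hs
  have hl := isSmooth_leftRegular hA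
  obtain ⟨hx, hcomm⟩ := hE.isExtensionValue hA
  have h1 : ∀ η : A ⊗[ℂ] (R ⊗[ℂ] R), LinearMap.lTensor A (LinearMap.mul' ℂ R)
      (extendedAction (regularTripleAction act) (oneTens E) η) =
      LinearMap.lTensor A (LinearMap.mul' ℂ R) η := by
    intro η
    rw [oneTens, hl.ext_tens (hs.tensor hs), hl.ext_one]
    induction η using TensorProduct.induction_on with
    | zero => simp
    | add x y hx hy => simp only [map_add, hx, hy]
    | tmul c ξ =>
      rw [TensorProduct.map_tmul, LinearMap.lTensor_tmul, LinearMap.lTensor_tmul,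
        mul'_ext_idempotent hA hs hE hact, LinearMap.id_apply]
  have h2 : extendedAction (regularTripleAction act) (tensOne E)
      (TensorProduct.assoc ℂ A R R ((c ⊗ₜ t) ⊗ₜ s)) = TensorProduct.assoc ℂ A R R
        (extendedAction (regularAction act) E (c ⊗ₜ t) ⊗ₜ s) := by
    rw [tensOne]
    have h3 : extendedAction (tensorAction (regularAction act) act) (tens E 1)
        ((c ⊗ₜ[ℂ] t) ⊗ₜ[ℂ] s) = extendedAction (regularAction act) E (c ⊗ₜ t) ⊗ₜ s := by
      rw [hX.ext_tens hs, hs.ext_one]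
      rfl
    rw [← h3]
    exact (hX.tensor hs).ext_transport hZ _ _ _ (fun b v => assoc_tensorAction b v) _ _
  have h4 : ∀ y : A ⊗[ℂ] R, LinearMap.lTensor A (LinearMap.mul' ℂ R)
      (TensorProduct.assoc ℂ A R R (y ⊗ₜ s)) = LinearMap.lTensor A (LinearMap.mulRight ℂ s) y := by
    intro y
    induction y using TensorProduct.induction_on with
    | zero => simp
    | add x y hx hy => simp only [map_add, TensorProduct.add_tmul, hx, hy]
    | tmul c ξ => rfl
  rw [← h4, ← h2, ← h1, ← hZ.ext_mul, ← hcomm]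
  have h5 : c ⊗ₜ[ℂ] (t * s) =
      LinearMap.lTensor A (LinearMap.mul' ℂ R) (TensorProduct.assoc ℂ A R R ((c ⊗ₜ t) ⊗ₜ s)) := rfl
  rw [h5]
  refine hX.eq fun w => ?_
  rw [hX.apply_ext, regularAction_lTensor_mul' hA hs hact, regularAction_lTensor_mul' hA hs hact,
    ← hx.2.2.2, hZ.ext_mul]

/-- The map `c ⊗ t ↦ t ⊗ (ι ⊗ ε)(Δ(a)(1 ⊗ c))`. -/
def crossModuleMap (Δ : A →ₙₐ[ℂ] Multiplier (A ⊗[ℂ] A)) (ε : A →ₗ[ℂ] ℂ) (a : A) :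
    A ⊗[ℂ] R →ₗ[ℂ] R ⊗[ℂ] A :=
  (TensorProduct.comm ℂ A R).toLinearMap ∘ₗ
    LinearMap.rTensor R (rightUnitMap Δ ε ∘ₗ TensorProduct.mk ℂ A A a)

theorem crossModuleMap_lTensor (ε : A →ₗ[ℂ] ℂ) (a : A) (s : R) (y : A ⊗[ℂ] R) :
    crossModuleMap Δ ε a (LinearMap.lTensor A (LinearMap.mulRight ℂ s) y) =
      LinearMap.rTensor A (LinearMap.mulRight ℂ s) (crossModuleMap Δ ε a y) := by
  induction y using TensorProduct.induction_on with
  | zero => simp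
  | add x y hx hy => simp only [map_add, hx, hy]
  | tmul c t => rfl

theorem actOn_comm_crossMap (ε : A →ₗ[ℂ] ℂ) (a : A) (t : R) (y : A ⊗[ℂ] A) :
    actOn act t (TensorProduct.comm ℂ A A (crossMap Δ ε a (TensorProduct.comm ℂ A A y))) =
      crossModuleMap Δ ε a
        (LinearMap.lTensor A ((act : A →ₗ[ℂ] Module.End ℂ R).flip t) y) := by
  induction y using TensorProduct.induction_on with
  | zero => simp
  | add x y hx hy => simp only [map_add, hx, hy]
  | tmul c t => rfl

/-- On the spanning elements `t ⊗ ψ(a ⊗ c)`, with `ψ = rightUnitMap (cop Δ) ε`, the induced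
projection is the action of `E` on `c ⊗ t` followed by a map that only permutes `R` past `A`. The
claim thus reduces to `ext_regularAction_mul`. -/
theorem induced_projection_mulRight (hA : IsRegularWeakMultiplierHopfAlgebra Δ)
    (hs : IsSmooth act) (hact : IsModuleAlgebra Δ act) (hE : IsCanonicalIdempotent Δ E)
    {ε : A →ₗ[ℂ] ℂ} {G : A ⊗[ℂ] A →ₗ[ℂ] A ⊗[ℂ] A}
    (hG : IsKernelProjection (cop Δ) (flip E) ε G) {F : R ⊗[ℂ] A →ₗ[ℂ] R ⊗[ℂ] A}
    (hF : ∀ r w, F (actOn act r w) = actOn act r (swapLegs G w)) (s : R) (w : R ⊗[ℂ] A) :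
    F (LinearMap.rTensor A (LinearMap.mulRight ℂ s) w) =
      LinearMap.rTensor A (LinearMap.mulRight ℂ s) (F w) := by
  have key : ∀ a c t, F (t ⊗ₜ rightUnitMap (cop Δ) ε (a ⊗ₜ c)) =
      crossModuleMap (cop Δ) ε a (extendedAction (regularAction act) E (c ⊗ₜ t)) := by
    intro a c t
    obtain ⟨e, he⟩ := hact.unital.exists_localUnit hA t
    rw [← actOn_localUnit he, hF, swapLegs_apply]
    have h1 : TensorProduct.comm ℂ A A (e ⊗ₜ[ℂ] rightUnitMap (cop Δ) ε (a ⊗ₜ[ℂ] c)) =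
        crossMap (cop Δ) ε a (e ⊗ₜ c) := rfl
    have h2 : (flip E).left (e ⊗ₜ[ℂ] c) = TensorProduct.comm ℂ A A (E.left (c ⊗ₜ e)) := rfl
    rw [h1, hG.map_crossMap, h2, actOn_comm_crossMap, ← ext_regularAction_tmul hA hs, he]
  induction w using TensorProduct.induction_on with
  | zero => simp
  | add x y hx hy => simp only [map_add, hx, hy]
  | tmul t a =>
    have ha : a ∈ LinearMap.range (rightUnitMap (cop Δ) ε) :=
      hG.rightUnit_surjective ▸ Submodule.mem_top
    obtain ⟨x, rfl⟩ := ha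
    induction x using TensorProduct.induction_on with
    | zero => simp
    | add x y hx hy => simp only [map_add, TensorProduct.tmul_add, hx, hy]
    | tmul a c =>
      rw [LinearMap.rTensor_tmul, LinearMap.mulRight_apply, key, key,
        ext_regularAction_mul hA hs hact hE, crossModuleMap_lTensor]

theorem tens_embed_comm (p c : A) :
    tens (embed p) (1 : Multiplier (A ⊗[ℂ] A)) *
        tens (1 : Multiplier A) (tens (1 : Multiplier A) (embed c)) =
      tens (1 : Multiplier A) (tens (1 : Multiplier A) (embed c)) *
        tens (embed p) (1 : Multiplier (A ⊗[ℂ] A)) := by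
  rw [tens_mul_tens, tens_mul_tens, one_mul, mul_one, one_mul, mul_one]

theorem tens_embed_mul_idTensorCoprod_swapLegs_T₁ (hA : IsRegularWeakMultiplierHopfAlgebra Δ)
    (d p a : A) :
    tens (embed d) (1 : Multiplier (A ⊗[ℂ] A)) *
        idTensorCoprod Δ (swapLegs (T₁ (cop Δ)) (p ⊗ₜ a)) =
      idTensorCoprod Δ (T₂ Δ (d ⊗ₜ a)) * tens (embed p) (1 : Multiplier (A ⊗[ℂ] A)) := by
  have h : LinearMap.rTensor A (LinearMap.mulLeft ℂ d) (swapLegs (T₁ (cop Δ)) (p ⊗ₜ a)) =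
      LinearMap.rTensor A (LinearMap.mulRight ℂ p) (T₂ Δ (d ⊗ₜ a)) :=
    rTensor_mulLeft_comm_T₁_cop hA d a p
  rw [← idTensorCoprod_rTensor_mulLeft, h, idTensorCoprod_rTensor_mulRight]

/-- Coassociativity for `Δ(a)(p ⊗ 1)`, obtained from the axiom by covering on the left with `d ⊗ 1 ⊗
1`; `p` and `c` sit in different legs and commute. -/
theorem idTensorCoprod_swapLegs_T₁_mul (hA : IsRegularWeakMultiplierHopfAlgebra Δ) (p a c : A) :
    idTensorCoprod Δ (swapLegs (T₁ (cop Δ)) (p ⊗ₜ a)) *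
        tens (1 : Multiplier A) (tens (1 : Multiplier A) (embed c)) =
      coprodTensorId Δ (T₁ Δ (a ⊗ₜ c)) * tens (embed p) (1 : Multiplier (A ⊗[ℂ] A)) := by
  refine eq_of_tens_embed_mul hA.weak.nondegenerate fun d => ?_
  rw [← mul_assoc, tens_embed_mul_idTensorCoprod_swapLegs_T₁ hA d p a, mul_assoc,
    tens_embed_comm p c, ← mul_assoc, ← mul_assoc, hA.weak.coproduct.coassoc]

theorem induced_T₁_mulRight (hA : IsRegularWeakMultiplierHopfAlgebra Δ)
    (hs : IsSmooth act) {T : R ⊗[ℂ] A →ₗ[ℂ] R ⊗[ℂ] A}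
    (hT : ∀ r w, T (actOn act r w) = actOn act r (swapLegs (T₁ (cop Δ)) w)) (t : R) (a b : A) :
    LinearMap.lTensor R (LinearMap.mulRight ℂ b) (T (t ⊗ₜ a)) = smashExt act (Δ a) (t ⊗ₜ b) := by
  have hX := isSmooth_smashAction hA hs
  have hl := isSmooth_leftRegular hA
  obtain ⟨e, he⟩ := hs.unital.exists_localUnit hA t
  have h1 : ∀ w : A ⊗[ℂ] A, LinearMap.lTensor R (LinearMap.mulRight ℂ b) (actOn act t w) =
      smashAction act w (t ⊗ₜ b) := by
    intro w
    induction w using TensorProduct.induction_on with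
    | zero => simp
    | add x y hx hy => simp only [map_add, LinearMap.add_apply, hx, hy]
    | tmul p q => rfl
  have h2 : extendedAction (smashAction act) (tens (embed e) 1) (t ⊗ₜ b) = t ⊗ₜ b := by
    rw [smashAction, hs.ext_tens hl, hs.ext_embed, hl.ext_one, TensorProduct.map_tmul, he,
      LinearMap.id_apply]
  rw [← actOn_localUnit he, hT, h1, ← hX.ext_embed, embed_swapLegs_T₁ hA, hX.ext_mul, h2]
  rfl

/-- In Sweedler notation `(a₍₁₎ ▷ t)(a₍₂₎ ▷ s) ⊗ a₍₃₎cb = (a₍₁₎ ▷ (ts)) ⊗ a₍₂₎cb`. The factor `c`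
covers the last leg so that elements of `A ⊗ A` appear, while `b` stays in the module. -/
theorem smashMul_induced_T₁ (hA : IsRegularWeakMultiplierHopfAlgebra Δ)
    (hs : IsSmooth act) (hact : IsModuleAlgebra Δ act) {T : R ⊗[ℂ] A →ₗ[ℂ] R ⊗[ℂ] A}
    (hT : ∀ r w, T (actOn act r w) = actOn act r (swapLegs (T₁ (cop Δ)) w))
    (w : R ⊗[ℂ] A) (s : R) (c b : A) :
    smashMul Δ act (T w) (s ⊗ₜ (c * b)) = LinearMap.lTensor R (LinearMap.mulRight ℂ (c * b))
      (T (LinearMap.rTensor A (LinearMap.mulRight ℂ s) w)) := by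
  have hX := isSmooth_smashAction hA hs
  have hZ := isSmooth_tripleAction hA hs
  have hl := isSmooth_leftRegular hA
  induction w using TensorProduct.induction_on with
  | zero => simp
  | add x y hx hy => simp only [map_add, LinearMap.add_apply, hx, hy]
  | tmul t a =>
    obtain ⟨p, hp⟩ := hs.unital.exists_localUnit hA t
    rw [LinearMap.rTensor_tmul, LinearMap.mulRight_apply, induced_T₁_mulRight hA hs hT]
    have h1 : (t * s) ⊗ₜ[ℂ] (c * b) = mulLegs (t ⊗ₜ (s ⊗ₜ (c * b))) := rfl
    have h2 : s ⊗ₜ[ℂ] (c * b) = smashExt act (tens 1 (embed c)) (s ⊗ₜ b) := by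
      rw [smashExt, smashAction, hs.ext_tens hl, hs.ext_one, hl.ext_embed]
      rfl
    have h3 : extendedAction (tripleAction act) (tens (embed p) 1) (t ⊗ₜ (s ⊗ₜ b)) =
        t ⊗ₜ (s ⊗ₜ b) := by
      rw [hs.ext_tens hX, hs.ext_embed, hX.ext_one, TensorProduct.map_tmul, hp, LinearMap.id_apply]
    rw [h1, smashExt_coproduct_mulLegs hA hs hact, ← actOn_localUnit hp, hT, smashMul_actOn hA hs,
      h2, ← ext_tens_one hA hs, ← hZ.ext_mul, idTensorCoprod_swapLegs_T₁_mul hA, hZ.ext_mul, h3]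

theorem eq_zero_of_smashMul_left (hA : IsRegularWeakMultiplierHopfAlgebra Δ)
    (hR : IsNondegenerateAlgebra R) (hs : IsSmooth act) (hact : IsModuleAlgebra Δ act)
    (hE : IsCanonicalIdempotent Δ E) {x : R ⊗[ℂ] A} (hx : x ∈ smashProduct act E)
    (h : ∀ y, smashMul Δ act x y = 0) : x = 0 := by
  have hN := hA.weak.nondegenerate
  have hc' := hA.weak_cop.coproduct
  have hE' := hE.cop hA
  obtain ⟨ε, hε⟩ := hA.weak_cop.counit
  obtain ⟨G, hG⟩ := exists_isKernelProjection hA.cop hE' hε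
  obtain ⟨S, hS, hST, hTS, hGS⟩ := hG.exists_inverse hN hc' hE'
  obtain ⟨T', hT'⟩ := exists_induced hA hact.unital (swapLegs (T₁ (cop Δ)))
    (swapLegs_rTensor (T₁_lTensor_mulRight hN hc'))
  obtain ⟨G', hG'⟩ := exists_induced hA hact.unital (swapLegs G)
    (swapLegs_rTensor hG.map_mulRight)
  obtain ⟨S', hS'⟩ := exists_induced hA hact.unital (swapLegs S) (swapLegs_rTensor hS)
  have hST' : S' ∘ₗ T' = G' := linearMap_ext_actOn hA hact.unital fun r w => by
    rw [LinearMap.comp_apply, hT', hS', hG', swapLegs_comp, hST]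
  have hGS' : G' ∘ₗ S' = S' := linearMap_ext_actOn hA hact.unital fun r w => by
    rw [LinearMap.comp_apply, hS', hG', swapLegs_comp, hGS]
  have hTS' : T' ∘ₗ S' = smashExt act E := linearMap_ext_actOn hA hact.unital fun r w => by
    rw [LinearMap.comp_apply, hS', hT', swapLegs_comp, hTS, smashExt_actOn hA hs, swapLegs_apply,
      flip_left, comm_comm, comm_comm]
  -- This is the only place where the hypothesis on `x` enters: `T'S'` acts as `E`, which fixes `x`.
  have hTx : T' (S' x) = x := by
    rw [← LinearMap.comp_apply, hTS', smashExt_idem hA hs hE hx]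
  have h1 : ∀ s, T' (LinearMap.rTensor A (LinearMap.mulRight ℂ s) (S' x)) = 0 := by
    intro s
    refine eq_zero_of_forall_lTensor (fun p : A × A => LinearMap.mulRight ℂ (p.1 * p.2)) ?_ _ ?_
    · intro v hv
      refine hN.1 v fun c => hN.1 _ fun b => ?_
      rw [mul_assoc]
      exact hv (c, b)
    · rintro ⟨c, b⟩
      change LinearMap.lTensor R (LinearMap.mulRight ℂ (c * b)) _ = 0
      rw [← smashMul_induced_T₁ hA hs hact hT', hTx]
      exact h _
  -- Applying `S'` to `h1` gives `G'(S'(x)(s ⊗ 1)) = 0`. As `G'` commutes with `s ⊗ 1` and fixes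
  -- `S'(x)`, this says `S'(x)(s ⊗ 1) = 0`.
  have h2 : S' x = 0 := by
    refine eq_zero_of_forall_rTensor (fun s : R => LinearMap.mulRight ℂ s) (fun v hv => hR.1 v hv) _
      fun s => ?_
    have h3 := induced_projection_mulRight hA hs hact hE hG hG' s (S' x)
    rw [← LinearMap.comp_apply G' S', hGS', ← hST', LinearMap.comp_apply, h1, map_zero] at h3
    exact h3.symm
  rw [← hTx, h2, map_zero]

end Nondegeneracy

end WMHA

end

open WMHA in
theorem proposition4p3
    {A : Type*} [NonUnitalRing A] [Module ℂ A] [IsScalarTower ℂ A A] [SMulCommClass ℂ A A]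
    {R : Type*} [NonUnitalRing R] [Module ℂ R] [IsScalarTower ℂ R R] [SMulCommClass ℂ R R]
    (Δ : A →ₙₐ[ℂ] Multiplier (A ⊗[ℂ] A)) (hA : IsRegularWeakMultiplierHopfAlgebra Δ)
    (E : Multiplier (A ⊗[ℂ] A)) (hE : IsCanonicalIdempotent Δ E)
    (hR : IsNondegenerateAlgebra R)
    (act : A →ₙₐ[ℂ] Module.End ℂ R) (hact : IsModuleAlgebra Δ act) :
    -- the product of `R # A` is associative
    (∀ x y z : R ⊗[ℂ] A,
      smashMul Δ act (smashMul Δ act x y) z = smashMul Δ act x (smashMul Δ act y z)) ∧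
    -- `R # A` is an `M(A ⊗ A)`-module, extending the action of `A ⊗ A`
    (∀ (m : Multiplier (A ⊗[ℂ] A)) (t : A ⊗[ℂ] A) (x : R ⊗[ℂ] A),
      smashExt act m (smashAction act t x) = smashAction act (m.left t) x) ∧
    (∀ x y : R ⊗[ℂ] A,
      smashMul Δ act (smashExt act E x) y = smashMul Δ act x y ∧
      smashMul Δ act x (smashExt act E y) = smashMul Δ act x y ∧
      smashExt act E (smashMul Δ act x y) = smashMul Δ act (smashExt act E x) y) ∧
    -- `E ▷ (R # A)` is a subalgebra and a right ideal
    (∀ x ∈ smashProduct act E, ∀ y ∈ smashProduct act E,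
      smashMul Δ act x y ∈ smashProduct act E) ∧
    (∀ x ∈ smashProduct act E, ∀ y : R ⊗[ℂ] A, smashMul Δ act x y ∈ smashProduct act E) ∧
    -- its product is non-degenerate
    (∀ x ∈ smashProduct act E,
      (∀ y ∈ smashProduct act E, smashMul Δ act x y = 0) → x = 0) ∧
    (∀ x ∈ smashProduct act E,
      (∀ y ∈ smashProduct act E, smashMul Δ act y x = 0) → x = 0) := by
  have hs : IsSmooth act := hact.unital.isSmooth hA
  have hideal : ∀ x y : R ⊗[ℂ] A, smashMul Δ act x y ∈ smashProduct act E := fun x y =>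
    ⟨_, smashExt_smashMul hA hs hact hE x y⟩
  refine ⟨smashMul_assoc hA hs hact, fun m t x => (isSmooth_smashAction hA hs).ext_apply m t x,
    fun x y => ⟨smashMul_smashExt_left hA hs hact hE x y, smashMul_smashExt_right hA hs hE x y, ?_⟩,
    fun x _ y _ => hideal x y, fun x _ y => hideal x y, fun x hx h => ?_, fun x hx h => ?_⟩
  · rw [smashExt_smashMul hA hs hact hE, smashMul_smashExt_left hA hs hact hE]
  -- Testing against `E ▷ (R # A)` is as strong as testing against `R # A`, because a factor `y` may
  -- be replaced by `E ▷ y`.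
  · refine eq_zero_of_smashMul_left hA hR hs hact hE hx fun y => ?_
    rw [← smashMul_smashExt_right hA hs hE]
    exact h _ ⟨y, rfl⟩
  · refine eq_zero_of_smashMul_right hA hR hs hE hx fun y => ?_
    rw [← smashMul_smashExt_left hA hs hact hE]
    exact h _ ⟨y, rfl⟩
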